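/- **Setting.** For $j\in\mathbb N$, $r\in\mathbb Z$ put $I_r^j=[r2^{-j},(r+1)2^{-j}]$. Fix $A\in\mathbb R$ and constants $D_{n,N}\in\mathbb R$ ($n,N\in\mathbb N=\{0,1,2,\dots\}$). For every $j\in\mathbb N$ and $w\in\mathbb R$ let $\Phi_{P_j(w)}:\mathbb R\to\mathbb C$ be an $L^2$-normalized wave packet adapted to the tile $P_j(w)=[w2^{-j},(w+1)2^{-j}]\times[2^j,2^{j+1}]$, uniformly in $j,w$. That is: $\Phi_{P_j(w)}\in C^\infty(\mathbb R)$, $\|\Phi_{P_j(w)}\|_{L^2(\mathbb R)}=1$, $$\big(1+|2^jx-w|\big)^N\,\big|\Phi_{P_j(w)}^{(n)}(x)\big|\le D_{n,N}\,2^{j(n+\frac12)}\qquad(n,N\in\mathbb N,\ x\in\mathbb R),$$ and $\widehat{\Phi_{P_j(w)}}(\xi)=\int_{\mathbb R}\Phi_{P_j(w)}(x)e^{-2\pi i x\xi}\,dx$ vanishes unless $A^{-1}2^j\le|\xi|\le A2^j$. For $m\in\mathbb N$ and bounded measurable $f_1,f_2,f_4:\mathbb R\to\mathbb C$ vanishing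 outside a set of finite measure, the curved trilinear square function $\mathcal T(f_1,f_2,f_4)\ge 0$ is given by $$\mathcal T^2(f_1,f_2,f_4)(x)=\sum_{k\ge m}\ \sum_{r\in\mathbb Z}\ \sum_{\substack{I_u^{m+2k}\subseteq I_r^{m+k}\\ I_v^{m+3k}\subseteq I_u^{m+2k}}}\Bigg(\frac1{2^m}\sum_{2^m\le p<2^{m+1}}\frac{\big|\langle f_1,\Phi_{P_{m+k}(r-p)}\rangle\big|}{|I_r^{m+k}|^{1/2}}\,\frac{\big|\langle f_2,\Phi_{P_{m+2k}(u+p^2/2^m)}\rangle\big|}{|I_u^{m+2k}|^{1/2}}\,\frac{\big|\langle f_4,\Phi_{P_{m+3k}(v-p^3/2^{2m})}\rangle\big|}{|I_v^{m+3k}|^{1/2}}\Bigg)^2\mathbf 1_{I_v^{m+3k}}(x),$$ where $k,p,u,v$ are integers and $\langle f,g\rangle=\int_{\mathbb R} f\,\overline g$. **Proposition.** There are constants $C_p$ ($1<p<\infty$), depending only on $p$, $A$ and $(D_{n,N})_{n,N}$, such that the following holds for every such family of wave packets, every integer $m\ge1$ and all measurable sets $F_1,F_2,F_4\subseteq\mathbb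 R$ of finite nonzero Lebesgue measure. There is a measurable set $F_4'\subseteq F_4$ with $|F_4'|\ge\frac12|F_4|$ such that for all measurable $f_1,f_2,f_4:\mathbb R\to\mathbb C$ with $|f_1|\le\mathbf 1_{F_1}$, $|f_2|\le\mathbf 1_{F_2}$, $|f_4|\le\mathbf 1_{F_4'}$ and all $1<p<\infty$, $$\|\mathcal T(f_1,f_2,f_4)\|_{L^p(\mathbb R)}\le C_p\,m^{10}\,\frac{|F_1|}{|F_4|}\,\frac{|F_2|}{|F_4|}\,|F_4|^{1/p}.$$ -/

import Mathlib

open MeasureTheory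
open scoped ContDiff FourierTransform ComplexConjugate ENNReal

namespace CurvedSquareFunction

/-- The dyadic interval `I_r^j = [r / 2^j, (r + 1) / 2^j]`, of length `2^{-j}`. -/
def dyadicInterval (j : ℕ) (r : ℤ) : Set ℝ :=
  Set.Icc ((r : ℝ) / 2 ^ j) (((r : ℝ) + 1) / 2 ^ j)

/-- `φ` is an `L²`-normalized wave packet adapted to the time-frequency tile
`P_j(w) = [w / 2^j, (w + 1) / 2^j] × [2^j, 2^(j+1)]`, where `w` is any real number:
it is smooth, all its derivatives decay rapidly away from the spatial interval of the tile at the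
scale of the tile (with constants `D n N`), and its frequencies have size comparable to `2^j`
(up to the factor `A`).

Mathlib's Fourier transform has the kernel `exp (-2 π i x ξ)`. Functions whose frequencies, counted
with the kernel `exp (-i x ξ)`, lie in `[2^j, 2^(j+1)]` satisfy the third condition with
`A = 2 π`. -/
structure IsWavePacket (A : ℝ) (D : ℕ → ℕ → ℝ) (j : ℕ) (w : ℝ) (φ : ℝ → ℂ) : Prop where
  contDiff : ContDiff ℝ ∞ φ
  decay : ∀ (n N : ℕ) (x : ℝ),
    (1 + |2 ^ j * x - w|) ^ N * ‖iteratedDeriv n φ x‖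
      ≤ D n N * (2 : ℝ) ^ ((j : ℝ) * (n + 1 / 2))
  fourier_support : ∀ ξ : ℝ, 𝓕 φ ξ ≠ 0 → A⁻¹ * 2 ^ j ≤ |ξ| ∧ |ξ| ≤ A * 2 ^ j
  normalized : eLpNorm φ 2 volume = 1

/-- The normalized coefficient `|⟨f, Φ_{P_j(w)}⟩| / |I|^{1/2}`, where `|I| = 2^{-j}` is the length
of the spatial interval of the tile `P_j(w)`. -/
noncomputable def coeff (Φ : ℕ → ℝ → ℝ → ℂ) (f : ℝ → ℂ) (j : ℕ) (w : ℝ) : ℝ :=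
  ‖∫ x : ℝ, f x * conj (Φ j w x)‖ / √((2 : ℝ) ^ j)⁻¹

/-- The inner average over the integers `p ∼ 2^m`, that is `2^m ≤ p < 2^(m+1)`. -/
noncomputable def curvedAverage (Φ : ℕ → ℝ → ℝ → ℂ) (m k : ℕ) (r u v : ℤ) (f₁ f₂ f₄ : ℝ → ℂ) : ℝ :=
  1 / 2 ^ m * ∑ p ∈ Finset.Ico (2 ^ m : ℕ) (2 ^ (m + 1)),
    coeff Φ f₁ (m + k) ((r : ℝ) - p)
      * coeff Φ f₂ (m + 2 * k) ((u : ℝ) + (p : ℝ) ^ 2 / 2 ^ m)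
      * coeff Φ f₄ (m + 3 * k) ((v : ℝ) - (p : ℝ) ^ 3 / 2 ^ (2 * m))

/-- The square of the curved trilinear square function, with values in `[0, ∞]`: the sum over all
`k ≥ m`, all `r`, all `u` with `I_u^{m+2k} ⊆ I_r^{m+k}` and all `v` with
`I_v^{m+3k} ⊆ I_u^{m+2k}`. -/
noncomputable def curvedSquareSq (Φ : ℕ → ℝ → ℝ → ℂ) (m : ℕ) (f₁ f₂ f₄ : ℝ → ℂ) (x : ℝ) : ℝ≥0∞ :=
  ∑' (k : {k : ℕ // m ≤ k}) (r : ℤ)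
    (u : {u : ℤ // dyadicInterval (m + 2 * k) u ⊆ dyadicInterval (m + k) r})
    (v : {v : ℤ // dyadicInterval (m + 3 * k) v ⊆ dyadicInterval (m + 2 * k) u}),
      (dyadicInterval (m + 3 * k) v).indicator
        (fun _ => ENNReal.ofReal (curvedAverage Φ m k r u v f₁ f₂ f₄ ^ 2)) x

/-- The curved trilinear square function `𝒯(f₁, f₂, f₄)`. -/
noncomputable def curvedSquare (Φ : ℕ → ℝ → ℝ → ℂ) (m : ℕ) (f₁ f₂ f₄ : ℝ → ℂ) (x : ℝ) : ℝ≥0∞ :=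
  curvedSquareSq Φ m f₁ f₂ f₄ x ^ (1 / 2 : ℝ)

end CurvedSquareFunction

/-! Only `f₄` has to oscillate. Taking absolute values in the coefficients of `f₁` and `f₂` replaces
them by averages `amp` of `1_{F₁}` and `1_{F₂}` against bumps. For fixed `k` and `u` the products of
these averages are nonnegative weights on the shifts `p`, and what remains is a square function that
acts on `f₄` alone, with a weighted average over `p` at every scale.

Size of the weights. By `sum_weight_eq` their total mass over `u` is the mass coming from `F₁` times
an average of `1_{F₂}` against normalized weights. The `2^m` shifts of intervals of length
`2^{-m-k}` fill an interval of length about `2^{-k}`, so an ordinary maximal function controls the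
first factor. The second is a maximal function along shifts; a shift moves a fine interval by at
most about `2^m` of its lengths, so only `O(m)` scales interact badly with a given stopping interval
(`tsum_min_len_le`) and the weak `(1,1)` norm is `O(m)` (`KernelBound.weak_type`). Removing from
`F₄` the points where one of the two is large gives `exists_major_subset`: seen from a point of
`F₄'`, the mass over `u` is at most `K₀ ≲ m |F₁||F₂| / |F₄|²` times a power of the distance to `u`.

Weights of mass at most `100^8 K₀`. Calderón–Zygmund theory applies to the square function.
Frequency separation gives `L²` (`exists_scaleOp_l2_bound`), cancellation of the bad part gives weak
`(1,1)` (`exists_weak_bound`), and a Carleson condition gives all higher moments as in the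
John–Nirenberg inequality (`exists_carleson_bound`, `lintegral_tailSum_pow_le`). Since `f₄` is
bounded by an indicator function, pointwise inequalities between powers replace interpolation.

Weights of larger mass. They occur only over `u` far from `F₄'`, where `f₄` lives. The packets
paired with `f₄` are finer than the interval of `u` by the factor `2^{-k}`, so their decay gains a
factor `2^{-k}`, which is summable (`scaleOp_badWeight_le`).

Almost every `x` sees one triple `(r, u, v)` per scale, so the two estimates add up, with total loss
`(m+4)(m+7) ≤ 40 m^10`. -/

namespace CurvedSquareFunction

/-! ### Brackets, dyadic lengths and indices, sums of bumps -/

/-- The bracket `1 + |x|` with values in `[0, ∞]`. -/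
noncomputable def jb (x : ℝ) : ℝ≥0∞ := ENNReal.ofReal (1 + |x|)

/-- The decay factor `(1 + |x|)^{-N}` with values in `[0, ∞]`. -/
noncomputable def rho (N : ℕ) (x : ℝ) : ℝ≥0∞ := ENNReal.ofReal ((1 + |x|) ^ N)⁻¹

/-- The length `2^{-i}` of a dyadic interval of level `i : ℤ`. -/
noncomputable def len (i : ℤ) : ℝ≥0∞ := ENNReal.ofReal ((2 : ℝ) ^ (-i))

/-- The index of the half-open dyadic interval of level `i` that contains `x`. -/
noncomputable def idx (i : ℤ) (x : ℝ) : ℤ := ⌊x * (2 : ℝ) ^ i⌋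

theorem measurable_rho {N : ℕ} : Measurable (rho N) := by
  unfold rho; fun_prop

theorem measurable_jb : Measurable jb := by
  unfold jb; fun_prop

theorem measurable_idx (i : ℤ) : Measurable (idx i) := by
  unfold idx; fun_prop

theorem one_le_jb (x : ℝ) : 1 ≤ jb x := by
  unfold jb
  rw [ENNReal.one_le_ofReal]
  linarith [abs_nonneg x]

theorem rho_ne_top (N : ℕ) (x : ℝ) : rho N x ≠ ⊤ := ENNReal.ofReal_ne_top

theorem rho_le_one (N : ℕ) (x : ℝ) : rho N x ≤ 1 := by
  unfold rho
  rw [ENNReal.ofReal_le_one]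
  exact inv_le_one_of_one_le₀ (one_le_pow₀ (by linarith [abs_nonneg x]))

theorem rho_add (M N : ℕ) (x : ℝ) : rho (M + N) x = rho M x * rho N x := by
  unfold rho
  rw [← ENNReal.ofReal_mul (by positivity), pow_add, mul_inv]

theorem rho_anti {M N : ℕ} (h : M ≤ N) (x : ℝ) : rho N x ≤ rho M x := by
  obtain ⟨d, rfl⟩ := Nat.exists_eq_add_of_le h
  rw [rho_add]
  exact mul_le_of_le_one_right' (rho_le_one _ _)

theorem jb_mul_rho_succ (N : ℕ) (x : ℝ) : jb x * rho (N + 1) x = rho N x := by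
  unfold rho jb
  rw [← ENNReal.ofReal_mul (by positivity)]
  congr 1
  have : (1 + |x|) ≠ 0 := by positivity
  field_simp
  ring

theorem jb_pow_mul_rho (N : ℕ) (x : ℝ) : jb x ^ N * rho N x = 1 := by
  unfold rho jb
  rw [← ENNReal.ofReal_pow (by positivity), ← ENNReal.ofReal_mul (by positivity),
    mul_inv_cancel₀ (by positivity), ENNReal.ofReal_one]

theorem rho_le_mul {N : ℕ} {c x y : ℝ} (hc : 0 ≤ c) (h : 1 + |x| ≤ c * (1 + |y|)) :
    rho N y ≤ ENNReal.ofReal c ^ N * rho N x := by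
  unfold rho
  rw [← ENNReal.ofReal_pow hc, ← ENNReal.ofReal_mul (by positivity)]
  apply ENNReal.ofReal_le_ofReal
  have hx : 0 < 1 + |x| := by positivity
  have hy : 0 < 1 + |y| := by positivity
  rw [inv_le_iff_one_le_mul₀ (by positivity), mul_assoc, mul_comm, mul_assoc,
    inv_mul_eq_div, one_le_div (by positivity), ← mul_pow]
  gcongr
  linarith

theorem jb_le_mul {c x y : ℝ} (hc : 0 ≤ c) (h : 1 + |x| ≤ c * (1 + |y|)) :
    jb x ≤ ENNReal.ofReal c * jb y := by
  unfold jb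
  rw [← ENNReal.ofReal_mul hc]
  exact ENNReal.ofReal_le_ofReal h

theorem rho_neg (N : ℕ) (x : ℝ) : rho N (-x) = rho N x := by
  unfold rho; rw [abs_neg]

theorem len_ne_zero (i : ℤ) : len i ≠ 0 := by
  unfold len
  simp only [ne_eq, ENNReal.ofReal_eq_zero, not_le]
  positivity

theorem len_ne_top (i : ℤ) : len i ≠ ⊤ := ENNReal.ofReal_ne_top

theorem len_add (i j : ℤ) : len (i + j) = len i * len j := by
  unfold len
  rw [← ENNReal.ofReal_mul (by positivity), ← zpow_add₀ (by norm_num)]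
  congr 2
  ring

theorem len_zero : len 0 = 1 := by simp [len]

theorem len_neg_mul (i : ℤ) : len (-i) * len i = 1 := by
  rw [← len_add]; simp [len_zero]

theorem len_mul_neg (i : ℤ) : len i * len (-i) = 1 := by
  rw [← len_add]; simp [len_zero]

theorem len_anti {i j : ℤ} (h : i ≤ j) : len j ≤ len i := by
  unfold len
  apply ENNReal.ofReal_le_ofReal
  exact zpow_le_zpow_right₀ (by norm_num) (by lia)

theorem len_neg_natCast (n : ℕ) : len (-(n : ℤ)) = 2 ^ n := by
  unfold len
  rw [neg_neg, zpow_natCast, ENNReal.ofReal_pow (by norm_num)]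
  simp

theorem idx_eq_iff {i n : ℤ} {x : ℝ} :
    idx i x = n ↔ x ∈ Set.Ico ((n : ℝ) * 2 ^ (-i)) (((n : ℝ) + 1) * 2 ^ (-i)) := by
  have h : (0 : ℝ) < 2 ^ i := by positivity
  unfold idx
  rw [Int.floor_eq_iff, zpow_neg, Set.mem_Ico, ← div_eq_mul_inv, ← div_eq_mul_inv, div_le_iff₀ h,
    lt_div_iff₀ h]

theorem volume_idx_eq (i n : ℤ) : volume {x | idx i x = n} = len i := by
  have : {x | idx i x = n} = Set.Ico ((n : ℝ) * 2 ^ (-i)) (((n : ℝ) + 1) * 2 ^ (-i)) := by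
    ext x; exact idx_eq_iff
  rw [this, Real.volume_Ico, len]
  congr 1
  ring

theorem measurableSet_idx_eq (i n : ℤ) : MeasurableSet {x | idx i x = n} :=
  measurable_idx i (measurableSet_singleton n)

theorem lintegral_eq_tsum_idx (i : ℤ) (f : ℝ → ℝ≥0∞) :
    ∫⁻ x, f x = ∑' n, ∫⁻ x in {x | idx i x = n}, f x := by
  rw [← lintegral_iUnion (measurableSet_idx_eq i)]
  · have : (⋃ n, {x | idx i x = n}) = Set.univ := by ext x; simp
    rw [this, Measure.restrict_univ]
  · intro a b hab
    rw [Function.onFun, Set.disjoint_left]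
    intro x hx hx'
    exact hab (hx.symm.trans hx')

theorem lintegral_comp_idx (i : ℤ) (h : ℤ → ℝ≥0∞) :
    ∫⁻ x, h (idx i x) = len i * ∑' n, h n := by
  rw [lintegral_eq_tsum_idx i, ← ENNReal.tsum_mul_left]
  congr 1
  ext n
  rw [setLIntegral_congr_fun (g := fun _ => h n) (measurableSet_idx_eq i n)]
  · rw [setLIntegral_const, volume_idx_eq, mul_comm]
  · intro x hx
    have : idx i x = n := hx
    simp only [this]

/-- A change of scale in a Lebesgue integral. -/
theorem lintegral_comp_affine (i : ℤ) (w : ℝ) {f : ℝ → ℝ≥0∞} (hf : Measurable f) :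
    ∫⁻ y, len (-i) * f (y * 2 ^ i - w) = ∫⁻ y, f y := by
  have h2 : (2 : ℝ) ^ i ≠ 0 := by positivity
  rw [lintegral_const_mul _ (by fun_prop)]
  have := lintegral_map (μ := volume) (f := fun y => f (y - w)) (g := fun y : ℝ => y * 2 ^ i)
    (by fun_prop) (by fun_prop)
  rw [← this, Real.map_volume_mul_right h2, lintegral_smul_measure, smul_eq_mul, ← mul_assoc,
    lintegral_sub_right_eq_self]
  have : len (-i) * ENNReal.ofReal |((2 : ℝ) ^ i)⁻¹| = 1 := by
    rw [abs_of_pos (by positivity), ← zpow_neg]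
    exact len_neg_mul i
  rw [this, one_mul]

/-- A constant that dominates the integral and the integer sums of `(1 + |x|)^{-2}`. -/
noncomputable def bumpConst : ℝ≥0∞ := 1 + (∫⁻ x, rho 2 x) + 4 * ∑' n : ℤ, rho 2 n

theorem one_le_bumpConst : 1 ≤ bumpConst := by
  unfold bumpConst
  rw [add_assoc]
  exact le_self_add

theorem lintegral_rho_le : ∫⁻ x, rho 2 x ≤ bumpConst := by
  unfold bumpConst
  exact le_trans le_add_self le_self_add

/-- Replacing `z` by its integer part changes the bracket by a factor of at most 2, hence `rho 2` by
at most 4, and the sum over integers is translation invariant. This is the origin of the 4 in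
`bumpConst`. -/
theorem tsum_rho_sub_le (z : ℝ) : ∑' n : ℤ, rho 2 (z - n) ≤ bumpConst := by
  have h : ∀ n : ℤ, rho 2 (z - n) ≤ 4 * rho 2 ((⌊z⌋ - n : ℤ) : ℝ) := by
    intro n
    have : (4 : ℝ≥0∞) = ENNReal.ofReal 2 ^ 2 := by norm_num
    rw [this]
    apply rho_le_mul (by norm_num)
    push_cast
    have h1 := Int.floor_le z
    have h2 := Int.lt_floor_add_one z
    have h3 : |(⌊z⌋ : ℝ) - n| ≤ |z - n| + |⌊z⌋ - z| := by
      have := abs_add_le (z - n) (⌊z⌋ - z)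
      rwa [show z - n + (⌊z⌋ - z) = (⌊z⌋ : ℝ) - n by ring] at this
    have h4 : |⌊z⌋ - z| ≤ 1 := by rw [abs_le]; constructor <;> linarith
    linarith [abs_nonneg (z - n)]
  calc _ ≤ ∑' n : ℤ, 4 * rho 2 ((⌊z⌋ - n : ℤ) : ℝ) := ENNReal.tsum_le_tsum h
    _ = 4 * ∑' n : ℤ, rho 2 (n : ℝ) := by
      rw [ENNReal.tsum_mul_left]
      congr 1
      exact (Equiv.subLeft ⌊z⌋).tsum_eq (fun n : ℤ => rho 2 (n : ℝ))
    _ ≤ _ := le_add_self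

theorem bumpConst_ne_top : bumpConst ≠ ⊤ := by
  unfold bumpConst
  refine ENNReal.add_ne_top.2 ⟨ENNReal.add_ne_top.2 ⟨ENNReal.one_ne_top, ?_⟩,
    ENNReal.mul_ne_top (by norm_num) ?_⟩
  · have := finite_integral_one_add_norm (E := ℝ) (μ := volume) (r := 2) (by simp)
    refine ne_of_lt (lt_of_le_of_lt (lintegral_mono fun x => ?_) this)
    unfold rho
    rw [Real.rpow_neg (by positivity), Real.norm_eq_abs, Real.rpow_ofNat]
  · unfold rho
    have hs : Summable (fun n : ℤ => ((1 + |(n : ℝ)|) ^ 2)⁻¹) := by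
      have h1 : Summable (fun n : ℕ => ((1 + |(n : ℝ)|) ^ 2)⁻¹) := by
        have := (summable_nat_add_iff 1).2 (Real.summable_nat_pow_inv (p := 2).2 (by norm_num))
        refine this.congr fun n => ?_
        rw [abs_of_nonneg (by positivity)]
        push_cast
        rw [add_comm]
      refine Summable.of_nat_of_neg (by simpa using h1) (by simpa using h1)
    rw [← ENNReal.ofReal_tsum_of_nonneg (fun n => by positivity) hs]
    exact ENNReal.ofReal_ne_top

/-! ### Superpositions of shifted bumps and their Schur bounds -/

/-- The `L¹`-normalized bump of scale `2^{-j}` around `w / 2^j`. -/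
noncomputable def ker (N : ℕ) (j : ℤ) (w y : ℝ) : ℝ≥0∞ := len (-j) * rho N (y * 2 ^ j - w)

theorem measurable_ker (N : ℕ) (j : ℤ) (w : ℝ) : Measurable (ker N j w) := by
  unfold ker
  exact (measurable_rho.comp (by fun_prop)).const_mul _

theorem ker_anti {M N : ℕ} (h : M ≤ N) (j : ℤ) (w y : ℝ) : ker N j w y ≤ ker M j w y := by
  unfold ker
  gcongr
  exact rho_anti h _

theorem lintegral_ker_le {N : ℕ} (hN : 2 ≤ N) (j : ℤ) (w : ℝ) : ∫⁻ y, ker N j w y ≤ bumpConst := by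
  refine (lintegral_mono (ker_anti hN j w)).trans ?_
  unfold ker
  rw [lintegral_comp_affine j w measurable_rho]
  exact lintegral_rho_le

/-- The fine level `m + s k` of the scale `k`. -/
def lev (m s k : ℕ) : ℤ := m + s * k

/-- Discrete Schur bounds for a family of kernels `n k v y`, where `v` is the index of a dyadic
interval of level `m + s k`, with decay at the coarser level `s k`. -/
structure KernelBound (m s : ℕ) (K : ℝ≥0∞) (n : ℕ → ℤ → ℝ → ℝ≥0∞) : Prop where
  meas : ∀ k v, Measurable (n k v)
  integral_le : ∀ k (v : ℤ),
    ∫⁻ y, n k v y * jb ((y * 2 ^ lev m s k - v) * 2 ^ (-(m : ℤ))) ≤ K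
  sum_le : ∀ k (y : ℝ),
    len (lev m s k) * ∑' v : ℤ, n k v y * jb ((y * 2 ^ lev m s k - v) * 2 ^ (-(m : ℤ))) ≤ K

/-- A superposition of bumps of scale `2^{-j}` with shifted centres. -/
noncomputable def avgKernel (N : ℕ) (j : ℤ) (P : Finset ℕ) (W : ℕ → ℝ≥0∞) (θ : ℕ → ℝ) (v : ℤ)
    (y : ℝ) : ℝ≥0∞ := ∑ p ∈ P, W p * ker N j (v - θ p) y

theorem measurable_avgKernel (N : ℕ) (j : ℤ) (P : Finset ℕ) (W : ℕ → ℝ≥0∞) (θ : ℕ → ℝ) (v : ℤ) :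
    Measurable (avgKernel N j P W θ v) := by
  unfold avgKernel
  exact Finset.measurable_fun_sum _ fun p _ => (measurable_ker _ _ _).const_mul _

theorem two_zpow_neg_le_one (m : ℕ) : (2 : ℝ) ^ (-(m : ℤ)) ≤ 1 := by
  rw [zpow_neg, zpow_natCast]
  exact inv_le_one_of_one_le₀ (one_le_pow₀ (by norm_num))

/-- A shift by `8 * 2^m` fine intervals is a shift by 8 intervals of the level coarser by `m`. Decay
measured at that coarser level therefore does not see the shifts. -/
theorem jb_scaled_le {m : ℕ} {z θ : ℝ} (h : |θ| ≤ 8 * 2 ^ m) :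
    jb (z * 2 ^ (-(m : ℤ))) ≤ 9 * jb (z + θ) := by
  have : (9 : ℝ≥0∞) = ENNReal.ofReal 9 := by norm_num
  rw [this]
  apply jb_le_mul (by norm_num)
  have h1 := two_zpow_neg_le_one m
  have h0 : (0 : ℝ) < 2 ^ (-(m : ℤ)) := by positivity
  have h2 : |z| ≤ |z + θ| + |θ| := by
    have := abs_sub (z + θ) θ
    simpa using this
  have h3 : |θ| * 2 ^ (-(m : ℤ)) ≤ 8 := by
    calc _ ≤ 8 * 2 ^ m * (2 : ℝ) ^ (-(m : ℤ)) := by gcongr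
      _ = 8 := by rw [zpow_neg, zpow_natCast]; field_simp
  rw [abs_mul, abs_of_pos h0]
  have h4 : |z| * 2 ^ (-(m : ℤ)) ≤ |z + θ| * 1 + 8 := by
    calc _ ≤ (|z + θ| + |θ|) * 2 ^ (-(m : ℤ)) := by gcongr
      _ = |z + θ| * 2 ^ (-(m : ℤ)) + |θ| * 2 ^ (-(m : ℤ)) := by ring
      _ ≤ _ := by gcongr
  linarith [abs_nonneg (z + θ)]

theorem abs_div_two_pow_sub_le (v : ℤ) (k : ℕ) :
    |(v : ℝ) * 2 ^ (-(k : ℤ)) - ((v / 2 ^ k : ℤ) : ℝ)| ≤ 1 := by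
  have h1 := Int.mul_ediv_add_emod v (2 ^ k)
  have h2 := Int.emod_nonneg v (b := 2 ^ k) (by positivity)
  have h3 := Int.emod_lt_of_pos v (b := 2 ^ k) (by positivity)
  have h1' : (2 : ℝ) ^ k * ((v / 2 ^ k : ℤ) : ℝ) + ((v % 2 ^ k : ℤ) : ℝ) = v := by exact_mod_cast h1
  have h2' : (0 : ℝ) ≤ ((v % 2 ^ k : ℤ) : ℝ) := by exact_mod_cast h2
  have h3' : ((v % 2 ^ k : ℤ) : ℝ) ≤ 2 ^ k := by exact_mod_cast h3.le
  have h0 : (0 : ℝ) < 2 ^ k := by positivity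
  rw [zpow_neg, zpow_natCast]
  have : (v : ℝ) * (2 ^ k)⁻¹ - ((v / 2 ^ k : ℤ) : ℝ) = ((v % 2 ^ k : ℤ) : ℝ) / 2 ^ k := by
    rw [← h1']; field_simp; ring
  rw [this, abs_of_nonneg (by positivity), div_le_one h0]
  exact h3'

/-- The distance of the parent index is dominated by the distance of the index. -/
theorem one_add_abs_parent_le {m k : ℕ} (hmk : m ≤ k) {z θ : ℝ} (h : |θ| ≤ 8 * 2 ^ m) (v : ℤ) :
    1 + |z * 2 ^ (-(k : ℤ)) - ((v / 2 ^ k : ℤ) : ℝ)| ≤ 10 * (1 + |z - v + θ|) := by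
  have h1 := abs_div_two_pow_sub_le v k
  have h0 : (0 : ℝ) < 2 ^ (-(k : ℤ)) := by positivity
  have h2 := two_zpow_neg_le_one k
  have h3 : |θ| * 2 ^ (-(k : ℤ)) ≤ 8 := by
    have : (2 : ℝ) ^ (-(k : ℤ)) ≤ 2 ^ (-(m : ℤ)) :=
      zpow_le_zpow_right₀ (by norm_num) (by lia)
    calc _ ≤ 8 * 2 ^ m * (2 : ℝ) ^ (-(m : ℤ)) := by gcongr
      _ = 8 := by rw [zpow_neg, zpow_natCast]; field_simp
  have h4 : z * 2 ^ (-(k : ℤ)) - ((v / 2 ^ k : ℤ) : ℝ)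
      = (z - v + θ) * 2 ^ (-(k : ℤ)) + ((v : ℝ) * 2 ^ (-(k : ℤ)) - ((v / 2 ^ k : ℤ) : ℝ))
        - θ * 2 ^ (-(k : ℤ)) := by ring
  have h5 : |(z - v + θ) * 2 ^ (-(k : ℤ))| ≤ |z - v + θ| := by
    rw [abs_mul, abs_of_pos h0]
    exact mul_le_of_le_one_right (abs_nonneg _) h2
  have h6 : |θ * 2 ^ (-(k : ℤ))| ≤ 8 := by
    rwa [abs_mul, abs_of_pos h0]
  rw [h4]
  have h7 := abs_sub ((z - v + θ) * 2 ^ (-(k : ℤ))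
    + ((v : ℝ) * 2 ^ (-(k : ℤ)) - ((v / 2 ^ k : ℤ) : ℝ))) (θ * 2 ^ (-(k : ℤ)))
  have h8 := abs_add_le ((z - v + θ) * 2 ^ (-(k : ℤ)))
    ((v : ℝ) * 2 ^ (-(k : ℤ)) - ((v / 2 ^ k : ℤ) : ℝ))
  linarith [abs_nonneg (z - v + θ)]

/-- The constant in the Schur bounds for superpositions of bumps. -/
noncomputable def schurConst : ℝ≥0∞ := 900 * bumpConst ^ 2

theorem schurConst_ne_top : schurConst ≠ ⊤ :=
  ENNReal.mul_ne_top (by norm_num) (ENNReal.pow_ne_top bumpConst_ne_top)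

/-- One power of the decay around the shifted centre pays for a bracket around the unshifted index
at the coarse level. -/
theorem avgKernel_mul_jb_le {m : ℕ} {P : Finset ℕ} {θ : ℕ → ℝ} (hθ : ∀ p ∈ P, |θ p| ≤ 8 * 2 ^ m)
    (N : ℕ) (j : ℤ) (W : ℕ → ℝ≥0∞) (v : ℤ) (y : ℝ) :
    avgKernel (N + 1) j P W θ v y * jb ((y * 2 ^ j - v) * 2 ^ (-(m : ℤ)))
      ≤ 9 * avgKernel N j P W θ v y := by
  unfold avgKernel
  rw [Finset.sum_mul, Finset.mul_sum]
  refine Finset.sum_le_sum fun p hp => ?_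
  have h1 := jb_scaled_le (z := y * 2 ^ j - v) (hθ p hp)
  have h2 : ker (N + 1) j (v - θ p) y * jb (y * 2 ^ j - v + θ p) = ker N j (v - θ p) y := by
    unfold ker
    rw [show y * 2 ^ j - (v - θ p) = y * 2 ^ j - v + θ p by ring, mul_assoc,
      mul_comm (rho _ _), jb_mul_rho_succ]
  calc _ ≤ W p * ker (N + 1) j (v - θ p) y * (9 * jb (y * 2 ^ j - v + θ p)) := by gcongr
    _ = 9 * (W p * (ker (N + 1) j (v - θ p) y * jb (y * 2 ^ j - v + θ p))) := by ring
    _ = _ := by rw [h2]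

theorem lintegral_avgKernel_le {P : Finset ℕ} {W : ℕ → ℝ≥0∞} {K : ℝ≥0∞} (hW : ∑ p ∈ P, W p ≤ K)
    {N : ℕ} (hN : 2 ≤ N) (j : ℤ) (θ : ℕ → ℝ) (v : ℤ) :
    ∫⁻ y, avgKernel N j P W θ v y ≤ bumpConst * K := by
  unfold avgKernel
  rw [lintegral_finsetSum _ (fun p _ => (measurable_ker _ _ _).const_mul _)]
  calc _ ≤ ∑ p ∈ P, W p * bumpConst := by
        refine Finset.sum_le_sum fun p _ => ?_
        rw [lintegral_const_mul _ (measurable_ker _ _ _)]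
        gcongr
        exact lintegral_ker_le hN _ _
    _ = bumpConst * ∑ p ∈ P, W p := by rw [← Finset.sum_mul, mul_comm]
    _ ≤ _ := by gcongr

theorem lintegral_avgKernel_jb_le {m : ℕ} {P : Finset ℕ} {θ : ℕ → ℝ}
    (hθ : ∀ p ∈ P, |θ p| ≤ 8 * 2 ^ m) {W : ℕ → ℝ≥0∞} {K : ℝ≥0∞} (hW : ∑ p ∈ P, W p ≤ K)
    {N : ℕ} (hN : 5 ≤ N) (j : ℤ) (v : ℤ) :
    ∫⁻ y, avgKernel N j P W θ v y * jb ((y * 2 ^ j - v) * 2 ^ (-(m : ℤ))) ≤ schurConst * K := by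
  obtain ⟨N, rfl⟩ := Nat.exists_eq_add_of_le' hN
  refine (lintegral_mono fun y => avgKernel_mul_jb_le hθ (N + 4) j W v y).trans ?_
  rw [lintegral_const_mul _ (measurable_avgKernel _ _ _ _ _ _)]
  calc _ ≤ 9 * (bumpConst * K) := by
        gcongr
        exact lintegral_avgKernel_le hW (by lia) _ _ _
    _ ≤ 900 * (bumpConst * bumpConst * K) := by
        gcongr
        · norm_num
        · exact le_mul_of_one_le_left' one_le_bumpConst
    _ = _ := by unfold schurConst; ring

/-- The weights change with the parent `v / 2^k`, so the sum over `v` cannot be done for fixed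
weights. As `m ≤ k`, shifts move a point by at most 8 parent intervals; part of the decay in `v` can
thus be spent as decay in the parent index, after which parents and children are summed
independently. -/
theorem tsum_avgKernel_jb_le {m k : ℕ} (hmk : m ≤ k) {P : Finset ℕ} {θ : ℕ → ℝ}
    (hθ : ∀ p ∈ P, |θ p| ≤ 8 * 2 ^ m) {W : ℤ → ℕ → ℝ≥0∞} {K : ℝ≥0∞}
    (hW : ∀ u, ∑ p ∈ P, W u p ≤ K) {N : ℕ} (hN : 5 ≤ N) (j : ℤ) (y : ℝ) :
    len j * ∑' v : ℤ, avgKernel N j P (W (v / 2 ^ k)) θ v y *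
      jb ((y * 2 ^ j - v) * 2 ^ (-(m : ℤ))) ≤ schurConst * K := by
  obtain ⟨N, rfl⟩ := Nat.exists_eq_add_of_le' hN
  -- The term of `v` is the diagonal entry `u = v / 2^k` of `G`; enlarging to all `u` decouples the
  -- two sums. The constant is `900 = 9 * 10^2`: 9 from the bracket, `10^2` from moving two powers
  -- of decay to the parent.
  set G : ℤ → ℤ → ℝ≥0∞ := fun u v => 900 * ∑ p ∈ P, W u p *
    (rho 2 (y * 2 ^ j * 2 ^ (-(k : ℤ)) - u) * rho 2 (y * 2 ^ j - v + θ p)) with hG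
  have key : ∀ v : ℤ, len j * (avgKernel (N + 5) j P (W (v / 2 ^ k)) θ v y *
      jb ((y * 2 ^ j - v) * 2 ^ (-(m : ℤ)))) ≤ ∑' u, G u v := by
    intro v
    refine le_trans ?_ (ENNReal.le_tsum (v / 2 ^ k))
    calc _ ≤ len j * (9 * avgKernel (N + 4) j P (W (v / 2 ^ k)) θ v y) := by
          exact mul_le_mul' le_rfl (avgKernel_mul_jb_le hθ (N + 4) j _ v y)
      _ = 9 * ∑ p ∈ P, W (v / 2 ^ k) p * rho (N + 4) (y * 2 ^ j - v + θ p) := by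
          unfold avgKernel ker
          rw [mul_left_comm, Finset.mul_sum]
          congr 1
          refine Finset.sum_congr rfl fun p _ => ?_
          rw [show y * 2 ^ j - (v - θ p) = y * 2 ^ j - v + θ p by ring]
          calc _ = W (v / 2 ^ k) p * (len j * len (-j) * rho (N + 4) (y * 2 ^ j - v + θ p)) := by
                ring
            _ = _ := by rw [len_mul_neg, one_mul]
      _ ≤ 9 * ∑ p ∈ P, W (v / 2 ^ k) p * (100 *
            (rho 2 (y * 2 ^ j * 2 ^ (-(k : ℤ)) - ((v / 2 ^ k : ℤ) : ℝ)) *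
              rho 2 (y * 2 ^ j - v + θ p))) := by
          gcongr with p hp
          calc _ ≤ rho (2 + 2) (y * 2 ^ j - v + θ p) := rho_anti (by lia) _
            _ = rho 2 (y * 2 ^ j - v + θ p) * rho 2 (y * 2 ^ j - v + θ p) := rho_add _ _ _
            _ ≤ (ENNReal.ofReal 10 ^ 2 * rho 2 (y * 2 ^ j * 2 ^ (-(k : ℤ)) - ((v / 2 ^ k : ℤ) : ℝ)))
                * rho 2 (y * 2 ^ j - v + θ p) := by
              gcongr
              exact rho_le_mul (by norm_num) (one_add_abs_parent_le hmk (hθ p hp) v)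
            _ = _ := by
              rw [mul_assoc]
              congr 1
              norm_num
      _ = _ := by
          simp only [hG]
          rw [Finset.mul_sum, Finset.mul_sum]
          refine Finset.sum_congr rfl fun p _ => ?_
          ring_nf
  rw [← ENNReal.tsum_mul_left]
  calc _ ≤ ∑' v, ∑' u, G u v := ENNReal.tsum_le_tsum key
    _ = ∑' u, ∑' v, G u v := ENNReal.tsum_comm
    _ ≤ ∑' u : ℤ, 900 * (K * (rho 2 (y * 2 ^ j * 2 ^ (-(k : ℤ)) - u) * bumpConst)) := by
        refine ENNReal.tsum_le_tsum fun u => ?_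
        simp only [hG]
        rw [ENNReal.tsum_mul_left]
        gcongr
        rw [Summable.tsum_finsetSum (fun _ _ => ENNReal.summable)]
        calc _ ≤ ∑ p ∈ P, W u p * (rho 2 (y * 2 ^ j * 2 ^ (-(k : ℤ)) - u) * bumpConst) := by
              refine Finset.sum_le_sum fun p _ => ?_
              rw [ENNReal.tsum_mul_left, ENNReal.tsum_mul_left]
              gcongr
              refine le_trans (le_of_eq (tsum_congr fun v => ?_)) (tsum_rho_sub_le (y * 2 ^ j + θ p))
              rw [show y * 2 ^ j - v + θ p = y * 2 ^ j + θ p - v by ring]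
          _ = (∑ p ∈ P, W u p) * (rho 2 (y * 2 ^ j * 2 ^ (-(k : ℤ)) - u) * bumpConst) := by
              rw [Finset.sum_mul]
          _ ≤ _ := by gcongr; exact hW u
    _ ≤ 900 * (K * (bumpConst * bumpConst)) := by
        rw [ENNReal.tsum_mul_left, ENNReal.tsum_mul_left, ENNReal.tsum_mul_right]
        gcongr
        exact tsum_rho_sub_le _
    _ = _ := by unfold schurConst; ring

/-- Doubling: two points of one cell of level `j` differ by less than one unit of the scale of the
bump. -/
theorem ker_le_of_idx_eq (N : ℕ) {j : ℤ} (w : ℝ) {y y' : ℝ} (h : idx j y = idx j y') :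
    ker N j w y ≤ 2 ^ N * ker N j w y' := by
  unfold ker
  rw [mul_left_comm]
  gcongr
  have : (2 : ℝ≥0∞) = ENNReal.ofReal 2 := by norm_num
  rw [this]
  apply rho_le_mul (by norm_num)
  unfold idx at h
  have h1 := Int.abs_sub_lt_one_of_floor_eq_floor h
  have h2 : |y' * 2 ^ j - w| ≤ |y * 2 ^ j - w| + |y * 2 ^ j - y' * 2 ^ j| := by
    have := abs_sub (y * 2 ^ j - w) (y * 2 ^ j - y' * 2 ^ j)
    rwa [show y * 2 ^ j - w - (y * 2 ^ j - y' * 2 ^ j) = y' * 2 ^ j - w by ring] at this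
  linarith [abs_nonneg (y * 2 ^ j - w)]

theorem avgKernel_le_of_idx_eq (N : ℕ) {j : ℤ} (P : Finset ℕ) (W : ℕ → ℝ≥0∞) (θ : ℕ → ℝ) (v : ℤ)
    {y y' : ℝ} (h : idx j y = idx j y') :
    avgKernel N j P W θ v y ≤ 2 ^ N * avgKernel N j P W θ v y' := by
  unfold avgKernel
  rw [Finset.mul_sum]
  refine Finset.sum_le_sum fun p _ => ?_
  rw [mul_left_comm]
  gcongr
  exact ker_le_of_idx_eq N _ h

theorem jb_add_le (x y : ℝ) : jb (x + y) ≤ jb x * jb y := by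
  unfold jb
  rw [← ENNReal.ofReal_mul (by positivity)]
  apply ENNReal.ofReal_le_ofReal
  nlinarith [abs_add_le x y, abs_nonneg x, abs_nonneg y, mul_nonneg (abs_nonneg x) (abs_nonneg y)]

/-- Lets the decay around one index be traded for decay around another; `smear` uses it to move the
bracket from `v` to the neighbour `v'`. -/
theorem jb_index_shift_le (m : ℕ) (z v v' : ℝ) :
    jb ((z - v) * 2 ^ (-(m : ℤ))) ≤ jb ((z - v') * 2 ^ (-(m : ℤ))) * jb (v' - v) := by
  rw [show (z - v) * 2 ^ (-(m : ℤ)) = (z - v') * 2 ^ (-(m : ℤ)) + (v' - v) * 2 ^ (-(m : ℤ)) by ring]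
  refine (jb_add_le _ _).trans ?_
  gcongr
  unfold jb
  apply ENNReal.ofReal_le_ofReal
  rw [abs_mul, abs_of_pos (show (0 : ℝ) < 2 ^ (-(m : ℤ)) by positivity)]
  gcongr
  exact mul_le_of_le_one_right (abs_nonneg _) (two_zpow_neg_le_one m)

/-- The Schur bounds are stable under averaging over neighbouring indices. -/
theorem KernelBound.smear {m s : ℕ} {K : ℝ≥0∞} {n : ℕ → ℤ → ℝ → ℝ≥0∞} (h : KernelBound m s K n) :
    KernelBound m s (bumpConst * K)
      (fun k v y => ∑' v' : ℤ, rho 3 ((v' : ℝ) - v) * n k v' y) := by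
  have hm : ∀ k v', Measurable (n k v') := h.meas
  have hterm : ∀ k (v v' : ℤ) (y : ℝ), rho 3 ((v' : ℝ) - v) * n k v' y *
      jb ((y * 2 ^ lev m s k - v) * 2 ^ (-(m : ℤ))) ≤
      rho 2 ((v' : ℝ) - v) * (n k v' y * jb ((y * 2 ^ lev m s k - v') * 2 ^ (-(m : ℤ)))) := by
    intro k v v' y
    calc _ ≤ rho 3 ((v' : ℝ) - v) * n k v' y *
          (jb ((y * 2 ^ lev m s k - v') * 2 ^ (-(m : ℤ))) * jb ((v' : ℝ) - v)) := by
          gcongr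
          exact jb_index_shift_le _ _ _ _
      _ = (jb ((v' : ℝ) - v) * rho (2 + 1) ((v' : ℝ) - v)) *
          (n k v' y * jb ((y * 2 ^ lev m s k - v') * 2 ^ (-(m : ℤ)))) := by ring
      _ = _ := by rw [jb_mul_rho_succ]
  refine ⟨fun k v => Measurable.tsum fun v' => (hm k v').const_mul _, fun k v => ?_,
    fun k y => ?_⟩
  · calc _ ≤ ∫⁻ y, ∑' v' : ℤ, rho 2 ((v' : ℝ) - v) *
          (n k v' y * jb ((y * 2 ^ lev m s k - v') * 2 ^ (-(m : ℤ)))) := by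
          refine lintegral_mono fun y => ?_
          simp only
          rw [← ENNReal.tsum_mul_right]
          exact ENNReal.tsum_le_tsum fun v' => hterm k v v' y
      _ = ∑' v' : ℤ, rho 2 ((v' : ℝ) - v) *
          ∫⁻ y, n k v' y * jb ((y * 2 ^ lev m s k - v') * 2 ^ (-(m : ℤ))) := by
          have hmj : ∀ v' : ℤ, Measurable fun y : ℝ =>
              n k v' y * jb ((y * 2 ^ lev m s k - v') * 2 ^ (-(m : ℤ))) := fun v' =>
            (hm k v').mul (measurable_jb.comp (by fun_prop))
          rw [lintegral_tsum fun v' => ((hmj v').const_mul _).aemeasurable]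
          congr 1
          ext v'
          rw [lintegral_const_mul _ (hmj v')]
      _ ≤ ∑' v' : ℤ, rho 2 ((v : ℝ) - v') * K := by
          refine ENNReal.tsum_le_tsum fun v' => ?_
          rw [← rho_neg 2 ((v : ℝ) - v'), neg_sub]
          gcongr
          exact h.integral_le k v'
      _ ≤ _ := by
          rw [ENNReal.tsum_mul_right]
          gcongr
          exact tsum_rho_sub_le _
  · calc _ ≤ len (lev m s k) * ∑' v : ℤ, ∑' v' : ℤ, rho 2 ((v' : ℝ) - v) *
          (n k v' y * jb ((y * 2 ^ lev m s k - v') * 2 ^ (-(m : ℤ)))) := by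
          gcongr with v
          rw [← ENNReal.tsum_mul_right]
          exact ENNReal.tsum_le_tsum fun v' => hterm k v v' y
      _ ≤ len (lev m s k) * ∑' v' : ℤ, bumpConst *
          (n k v' y * jb ((y * 2 ^ lev m s k - v') * 2 ^ (-(m : ℤ)))) := by
          rw [ENNReal.tsum_comm]
          gcongr with v'
          rw [ENNReal.tsum_mul_right]
          gcongr
          exact tsum_rho_sub_le _
      _ = bumpConst * (len (lev m s k) * ∑' v' : ℤ,
          (n k v' y * jb ((y * 2 ^ lev m s k - v') * 2 ^ (-(m : ℤ))))) := by
          rw [ENNReal.tsum_mul_left]; ring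
      _ ≤ _ := by gcongr; exact h.sum_le k y

/-! ### Off-diagonal decay and the number of interacting scales -/

/-- In units of `2^{-l}` the points are `2^{l-i}` apart. Replacing `x` by its index at level `m + l`
costs at most `2^{-m} ≤ 1` such units, which the summand 1 absorbs. -/
theorem two_zpow_le_one_add_abs {m : ℕ} {j l i : ℤ} (hj : j = m + l) {x y : ℝ}
    (h : (2 : ℝ) ^ (-i) ≤ |x - y|) :
    (2 : ℝ) ^ (l - i) ≤ 1 + |(y * 2 ^ j - idx j x) * 2 ^ (-(m : ℤ))| := by
  have h1 := Int.floor_le (x * (2 : ℝ) ^ j)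
  have h2 := (Int.lt_floor_add_one (x * (2 : ℝ) ^ j)).le
  have h0 : (0 : ℝ) < 2 ^ (-(m : ℤ)) := by positivity
  have e1 : (2 : ℝ) ^ l = 2 ^ j * 2 ^ (-(m : ℤ)) := by
    rw [← zpow_add₀ (by norm_num), hj]; congr 1; ring
  have e2 : (2 : ℝ) ^ (l - i) = 2 ^ l * 2 ^ (-i) := by
    rw [← zpow_add₀ (by norm_num)]; congr 1
  have h3 : |(x - y) * 2 ^ l| ≤ |(y * 2 ^ j - idx j x) * 2 ^ (-(m : ℤ))| + 1 := by
    have h4 : (x - y) * 2 ^ l = (x * 2 ^ j - idx j x) * 2 ^ (-(m : ℤ))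
        - (y * 2 ^ j - idx j x) * 2 ^ (-(m : ℤ)) := by rw [e1]; ring
    have h5 : |(x * 2 ^ j - idx j x) * 2 ^ (-(m : ℤ))| ≤ 1 := by
      unfold idx
      rw [abs_of_nonneg (mul_nonneg (by linarith) h0.le)]
      exact mul_le_one₀ (by linarith) h0.le (two_zpow_neg_le_one m)
    rw [h4]
    exact (abs_sub _ _).trans (by linarith)
  rw [abs_mul, abs_of_pos (show (0 : ℝ) < 2 ^ l by positivity)] at h3
  calc _ = (2 : ℝ) ^ l * 2 ^ (-i) := e2
    _ ≤ 2 ^ l * |x - y| := by gcongr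
    _ ≤ _ := by linarith

theorem one_le_min_len_mul_jb {m : ℕ} {j l i : ℤ} (hj : j = m + l) {x y : ℝ}
    (h : (2 : ℝ) ^ (-i) ≤ |x - y|) :
    1 ≤ min 1 (len (l - i)) * jb ((y * 2 ^ j - idx j x) * 2 ^ (-(m : ℤ))) := by
  have h1 := two_zpow_le_one_add_abs hj h
  rcases min_choice 1 (len (l - i)) with h2 | h2 <;> rw [h2]
  · rw [one_mul]; exact one_le_jb _
  · calc (1 : ℝ≥0∞) = len (l - i) * len (-(l - i)) := (len_mul_neg _).symm
      _ ≤ _ := by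
        gcongr
        unfold len jb
        rw [neg_neg]
        exact ENNReal.ofReal_le_ofReal h1

theorem lev_eq (m s k : ℕ) : lev m s k = m + ((s * k : ℕ) : ℤ) := by
  unfold lev; push_cast; ring

theorem KernelBound.lintegral_le {m s : ℕ} {K : ℝ≥0∞} {n : ℕ → ℤ → ℝ → ℝ≥0∞}
    (h : KernelBound m s K n) (k : ℕ) (v : ℤ) : ∫⁻ y, n k v y ≤ K :=
  (lintegral_mono fun _ => le_mul_of_one_le_right' (one_le_jb _)).trans (h.integral_le k v)

theorem KernelBound.tsum_le {m s : ℕ} {K : ℝ≥0∞} {n : ℕ → ℤ → ℝ → ℝ≥0∞}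
    (h : KernelBound m s K n) (k : ℕ) (y : ℝ) : len (lev m s k) * ∑' v, n k v y ≤ K := by
  refine le_trans ?_ (h.sum_le k y)
  gcongr
  exact le_mul_of_one_le_right' (one_le_jb _)

/-- At distance at least `2^{-i}` the extra bracket in the Schur bounds is at least `2^{sk-i}`. The
decay thus starts at the coarse level `s k`, not at the level `m + s k` of the intervals; this gap
of `m` levels is the source of the loss in `m`. -/
theorem KernelBound.lintegral_far_le {m s : ℕ} {K : ℝ≥0∞} {n : ℕ → ℤ → ℝ → ℝ≥0∞}
    (h : KernelBound m s K n) (k : ℕ) (y : ℝ) (i : ℤ) :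
    ∫⁻ x in {x | (2 : ℝ) ^ (-i) ≤ |x - y|}, n k (idx (lev m s k) x) y
      ≤ min 1 (len ((s * k : ℕ) - i)) * K := by
  have hS : MeasurableSet {x : ℝ | (2 : ℝ) ^ (-i) ≤ |x - y|} :=
    measurableSet_le measurable_const (by fun_prop)
  set G : ℤ → ℝ≥0∞ := fun v => min 1 (len ((s * k : ℕ) - i)) *
    (n k v y * jb ((y * 2 ^ lev m s k - v) * 2 ^ (-(m : ℤ)))) with hG
  calc _ ≤ ∫⁻ x in {x | (2 : ℝ) ^ (-i) ≤ |x - y|}, G (idx (lev m s k) x) := by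
        refine setLIntegral_mono' hS fun x hx => ?_
        simp only [hG]
        rw [mul_left_comm]
        exact le_mul_of_one_le_right' (one_le_min_len_mul_jb (lev_eq m s k) hx)
    _ ≤ ∫⁻ x, G (idx (lev m s k) x) := setLIntegral_le_lintegral _ _
    _ = min 1 (len ((s * k : ℕ) - i)) * (len (lev m s k) * ∑' v : ℤ,
          n k v y * jb ((y * 2 ^ lev m s k - v) * 2 ^ (-(m : ℤ)))) := by
        rw [lintegral_comp_idx, hG, ENNReal.tsum_mul_left]; ring
    _ ≤ _ := by gcongr; exact h.sum_le k y

theorem KernelBound.lintegral_y_far_le {m s : ℕ} {K : ℝ≥0∞} {n : ℕ → ℤ → ℝ → ℝ≥0∞}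
    (h : KernelBound m s K n) (k : ℕ) (x : ℝ) (i : ℤ) :
    ∫⁻ y in {y | (2 : ℝ) ^ (-i) ≤ |x - y|}, n k (idx (lev m s k) x) y
      ≤ min 1 (len ((s * k : ℕ) - i)) * K := by
  have hS : MeasurableSet {y : ℝ | (2 : ℝ) ^ (-i) ≤ |x - y|} :=
    measurableSet_le measurable_const (by fun_prop)
  calc _ ≤ ∫⁻ y in {y | (2 : ℝ) ^ (-i) ≤ |x - y|}, min 1 (len ((s * k : ℕ) - i)) *
          (n k (idx (lev m s k) x) y *
            jb ((y * 2 ^ lev m s k - idx (lev m s k) x) * 2 ^ (-(m : ℤ)))) := by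
        refine setLIntegral_mono' hS fun y hy => ?_
        rw [mul_left_comm]
        exact le_mul_of_one_le_right' (one_le_min_len_mul_jb (lev_eq m s k) hy)
    _ ≤ _ := setLIntegral_le_lintegral _ _
    _ ≤ _ := by
        have hmj : Measurable fun y : ℝ => n k (idx (lev m s k) x) y *
            jb ((y * 2 ^ lev m s k - idx (lev m s k) x) * 2 ^ (-(m : ℤ))) :=
          (h.meas _ _).mul (measurable_jb.comp (by fun_prop))
        rw [lintegral_const_mul _ hmj]
        gcongr
        exact h.integral_le k _

theorem tsum_len_natCast : ∑' n : ℕ, len n = 2 := by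
  have : ∀ n : ℕ, len n = (2⁻¹ : ℝ≥0∞) ^ n := by
    intro n
    unfold len
    rw [zpow_neg, zpow_natCast, ← inv_pow, ENNReal.ofReal_pow (by norm_num),
      ENNReal.ofReal_inv_of_pos (by norm_num)]
    simp
  simp_rw [this]
  rw [ENNReal.tsum_geometric, ENNReal.one_sub_inv_two, inv_inv]

/-- Only about `m` scales lie between the coarse and the fine level. -/
theorem tsum_min_len_le (m : ℕ) {s : ℕ} (hs : 1 ≤ s) (i : ℤ) :
    ∑' k : ℕ, min 1 (len (i - lev m s k)) * min 1 (len ((s * k : ℕ) - i)) ≤ m + 4 := by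
  -- With `n = s k - i` the summand depends on `n` alone, and `s ≥ 1` makes `k ↦ n` injective, so
  -- the sum may be taken over all integers `n`.
  set φ : ℤ → ℝ≥0∞ := fun n => min 1 (len (-n - m)) * min 1 (len n) with hφ
  have h1 : ∑' k : ℕ, min 1 (len (i - lev m s k)) * min 1 (len ((s * k : ℕ) - i)) ≤ ∑' n, φ n := by
    have hinj : Function.Injective (fun k : ℕ => (((s * k : ℕ) : ℤ) - i)) := by
      intro a b hab
      have : s * a = s * b := by simpa using hab
      exact Nat.eq_of_mul_eq_mul_left hs this
    refine le_trans (le_of_eq ?_) (ENNReal.tsum_comp_le_tsum_of_injective hinj φ)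
    refine tsum_congr fun k => ?_
    simp only [hφ]
    congr 3
    unfold lev; push_cast; ring
  refine h1.trans ?_
  rw [tsum_of_nat_of_neg_add_one ENNReal.summable ENNReal.summable]
  have h2 : ∑' n : ℕ, φ n ≤ 2 := by
    rw [← tsum_len_natCast]
    refine ENNReal.tsum_le_tsum fun n => ?_
    simp only [hφ]
    exact (mul_le_of_le_one_left' (min_le_left _ _)).trans (min_le_right _ _)
  -- For `-m ≤ n < 0` neither factor is small, which gives `m`; below `-m` the first factor decays
  -- geometrically.
  have h3 : ∑' n : ℕ, φ (-(n + 1)) ≤ m + 2 := by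
    rw [← ENNReal.summable.sum_add_tsum_nat_add' (k := m)]
    have ha : ∑ n ∈ Finset.range m, φ (-((n : ℕ) + 1)) ≤ m := by
      calc _ ≤ ∑ n ∈ Finset.range m, (1 : ℝ≥0∞) := by
            refine Finset.sum_le_sum fun n _ => ?_
            exact mul_le_one' (min_le_left _ _) (min_le_left _ _)
        _ = m := by simp
    have hb : ∑' n : ℕ, φ (-(((n + m : ℕ) : ℤ) + 1)) ≤ 2 := by
      rw [← tsum_len_natCast]
      refine ENNReal.tsum_le_tsum fun n => ?_
      simp only [hφ]
      refine (mul_le_of_le_one_right' (min_le_left _ _)).trans ((min_le_right _ _).trans ?_)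
      exact len_anti (by push_cast; lia)
    exact add_le_add ha hb
  calc _ ≤ (2 : ℝ≥0∞) + (m + 2) := add_le_add h2 h3
    _ = m + 4 := by ring

/-! ### Dyadic averages and stopping intervals -/

theorem idx_eq_ediv (i : ℤ) (d : ℕ) (x : ℝ) : idx i x = idx (i + d) x / 2 ^ d := by
  have h0 : (0 : ℝ) < 2 ^ d := by positivity
  have h1 := Int.floor_le (x * (2 : ℝ) ^ (i + d))
  have h2 := Int.lt_floor_add_one (x * (2 : ℝ) ^ (i + d))
  unfold idx
  set n := ⌊x * (2 : ℝ) ^ (i + d)⌋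
  have e : x * (2 : ℝ) ^ (i + d) = x * 2 ^ i * 2 ^ d := by
    rw [zpow_add₀ (by norm_num), zpow_natCast]; ring
  rw [e] at h1 h2
  have h3 := Int.ediv_mul_le n (b := 2 ^ d) (by positivity)
  have h4 := Int.lt_ediv_add_one_mul_self n (b := 2 ^ d) (by positivity)
  have h5 : n + 1 ≤ (n / 2 ^ d + 1) * 2 ^ d := h4
  have h3' : ((n / 2 ^ d : ℤ) : ℝ) * 2 ^ d ≤ n := by exact_mod_cast h3
  have h5' : (n : ℝ) + 1 ≤ (((n / 2 ^ d : ℤ) : ℝ) + 1) * 2 ^ d := by exact_mod_cast h5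
  rw [Int.floor_eq_iff]
  constructor
  · exact le_of_mul_le_mul_right (h3'.trans h1) h0
  · exact lt_of_mul_lt_mul_right (h2.trans_le h5') h0.le

theorem idx_eq_of_le {i' i : ℤ} (h : i' ≤ i) {x y : ℝ} (hxy : idx i x = idx i y) :
    idx i' x = idx i' y := by
  obtain ⟨d, rfl⟩ := Int.le.dest h
  rw [idx_eq_ediv i' d x, idx_eq_ediv i' d y, hxy]

/-- The average of `F` over the dyadic interval of level `i` that contains `y`. -/
noncomputable def cellAvg (F : ℝ → ℝ≥0∞) (i : ℤ) (y : ℝ) : ℝ≥0∞ :=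
  len (-i) * ∫⁻ z in {z | idx i z = idx i y}, F z

/-- The union of the maximal dyadic intervals with average larger than `t` that have level `i`. -/
def stopSet (F : ℝ → ℝ≥0∞) (t : ℝ≥0∞) (i : ℤ) : Set ℝ :=
  {y | t < cellAvg F i y ∧ ∀ i' < i, cellAvg F i' y ≤ t}

theorem measurable_cellAvg (F : ℝ → ℝ≥0∞) (i : ℤ) : Measurable (cellAvg F i) := by
  have : cellAvg F i = (fun n => len (-i) * ∫⁻ z in {z | idx i z = n}, F z) ∘ idx i := rfl
  rw [this]
  exact (measurable_of_countable _).comp (measurable_idx i)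

theorem measurableSet_stopSet (F : ℝ → ℝ≥0∞) (t : ℝ≥0∞) (i : ℤ) :
    MeasurableSet (stopSet F t i) := by
  have : stopSet F t i = {y | t < cellAvg F i y} ∩ ⋂ i' : ℤ, ⋂ _ : i' < i,
      {y | cellAvg F i' y ≤ t} := by
    ext y; simp [stopSet]
  rw [this]
  refine (measurableSet_lt measurable_const (measurable_cellAvg F i)).inter ?_
  exact MeasurableSet.iInter fun i' => MeasurableSet.iInter fun _ =>
    measurableSet_le (measurable_cellAvg F i') measurable_const

theorem cellAvg_congr (F : ℝ → ℝ≥0∞) {i' i : ℤ} (h : i' ≤ i) {x y : ℝ} (hxy : idx i x = idx i y) :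
    cellAvg F i' x = cellAvg F i' y := by
  unfold cellAvg
  rw [idx_eq_of_le h hxy]

theorem mem_stopSet_congr (F : ℝ → ℝ≥0∞) (t : ℝ≥0∞) {i' i : ℤ} (h : i' ≤ i) {x y : ℝ}
    (hxy : idx i x = idx i y) : x ∈ stopSet F t i' ↔ y ∈ stopSet F t i' := by
  have h1 : ∀ a ≤ i', cellAvg F a x = cellAvg F a y := fun a ha =>
    cellAvg_congr F (ha.trans h) hxy
  simp only [stopSet, Set.mem_ofPred_eq, h1 i' le_rfl]
  refine and_congr_right fun _ => forall₂_congr fun a ha => ?_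
  rw [h1 a ha.le]

theorem pairwise_disjoint_stopSet (F : ℝ → ℝ≥0∞) (t : ℝ≥0∞) :
    Pairwise (Function.onFun Disjoint (stopSet F t)) := by
  intro i i' h
  rw [Function.onFun, Set.disjoint_left]
  intro y hy hy'
  rcases lt_or_gt_of_ne h with h | h
  · exact absurd hy.1 (not_lt.2 (hy'.2 i h))
  · exact absurd hy'.1 (not_lt.2 (hy.2 i' h))

/-- Averaging preserves integrals over unions of dyadic intervals. -/
theorem setLIntegral_cellAvg (F : ℝ → ℝ≥0∞) (i : ℤ) {S : Set ℝ} (hS : MeasurableSet S)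
    (h : ∀ x y, idx i x = idx i y → x ∈ S → y ∈ S) :
    ∫⁻ y in S, cellAvg F i y = ∫⁻ y in S, F y := by
  rw [← lintegral_indicator hS, ← lintegral_indicator hS, lintegral_eq_tsum_idx i,
    lintegral_eq_tsum_idx i]
  refine tsum_congr fun n => ?_
  have hm := measurableSet_idx_eq i n
  by_cases hn : ∃ x ∈ S, idx i x = n
  · obtain ⟨x, hx, rfl⟩ := hn
    have hsub : ∀ y ∈ {y | idx i y = idx i x}, y ∈ S := fun y hy => h x y (Eq.symm hy) hx
    rw [setLIntegral_congr_fun (g := F) hm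
      (fun y hy => Set.indicator_of_mem (hsub y hy) F),
      setLIntegral_congr_fun (g := fun _ => cellAvg F i x) hm
      (fun y hy => by rw [Set.indicator_of_mem (hsub y hy)]; exact cellAvg_congr F le_rfl hy),
      setLIntegral_const, volume_idx_eq, cellAvg, mul_right_comm, len_neg_mul, one_mul]
  · have h0 : ∀ (G : ℝ → ℝ≥0∞), ∫⁻ y in {y | idx i y = n}, S.indicator G y = 0 := by
      intro G
      rw [setLIntegral_congr_fun (g := fun _ => 0) hm, lintegral_zero]
      intro y hy
      exact Set.indicator_of_notMem (fun hy' => hn ⟨y, hy', hy⟩) G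
    rw [h0, h0]

theorem mul_volume_stopSet_le (F : ℝ → ℝ≥0∞) (t : ℝ≥0∞) (i : ℤ) :
    t * volume (stopSet F t i) ≤ ∫⁻ y in stopSet F t i, F y := by
  rw [← setLIntegral_cellAvg F i (measurableSet_stopSet F t i)
    (fun x y hxy hx => (mem_stopSet_congr F t le_rfl hxy).1 hx), ← setLIntegral_const]
  exact setLIntegral_mono' (measurableSet_stopSet F t i) fun y hy => hy.1.le

theorem tsum_setLIntegral_stopSet_le (F G : ℝ → ℝ≥0∞) (t : ℝ≥0∞) :
    ∑' i, ∫⁻ y in stopSet F t i, G y ≤ ∫⁻ y, G y := by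
  rw [← lintegral_iUnion (measurableSet_stopSet F t) (pairwise_disjoint_stopSet F t)]
  exact setLIntegral_le_lintegral _ _

theorem cellAvg_le_two_mul (F : ℝ → ℝ≥0∞) (i : ℤ) (y : ℝ) :
    cellAvg F i y ≤ 2 * cellAvg F (i - 1) y := by
  unfold cellAvg
  rw [← mul_assoc]
  have : len (-i) = 2 * len (-(i - 1)) := by
    have h := len_neg_natCast 1
    rw [pow_one] at h
    rw [← h, ← len_add]
    congr 1
    push_cast; ring
  rw [this]
  have hsub : {z | idx i z = idx i y} ⊆ {z | idx (i - 1) z = idx (i - 1) y} :=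
    fun z hz => idx_eq_of_le (by lia) hz
  gcongr

/-- Averages of an integrable function over long intervals are small, uniformly in the position.
Hence there is a coarsest level at which the stopping condition can hold. -/
theorem exists_cellAvg_le {F : ℝ → ℝ≥0∞} (hF : ∫⁻ y, F y ≠ ⊤) {t : ℝ≥0∞} (ht : t ≠ 0) :
    ∃ i₀ : ℤ, ∀ i ≤ i₀, ∀ y, cellAvg F i y ≤ t := by
  obtain ⟨n, hn⟩ : ∃ n : ℕ, ∫⁻ y, F y ≤ n * t := by
    obtain ⟨n, hn⟩ := ENNReal.exists_nat_mul_gt ht hF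
    exact ⟨n, hn.le⟩
  refine ⟨-n, fun i hi y => ?_⟩
  calc _ ≤ len n * (n * t) := by
        unfold cellAvg
        gcongr
        · exact len_anti (by lia)
        · exact (setLIntegral_le_lintegral _ _).trans hn
    _ ≤ len n * (len (-(n : ℤ)) * t) := by
        gcongr
        rw [len_neg_natCast]
        exact_mod_cast Nat.lt_two_pow_self.le
    _ = t := by rw [← mul_assoc, len_mul_neg, one_mul]

/-- If the average exceeded `t`, the coarsest level where it does would put `y` into a stopping
interval of level at most `i`. -/
theorem cellAvg_le_of_notMem {F : ℝ → ℝ≥0∞} (hF : ∫⁻ y, F y ≠ ⊤) {t : ℝ≥0∞} (ht : t ≠ 0) {y : ℝ}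
    {i : ℤ} (h : ∀ i' ≤ i, y ∉ stopSet F t i') : cellAvg F i y ≤ t := by
  by_contra! hlt
  obtain ⟨i₀, hi₀⟩ := exists_cellAvg_le hF ht
  obtain ⟨a, ha, hmin⟩ := Int.exists_least_of_bdd (P := fun a => t < cellAvg F a y)
    ⟨i₀, fun z hz => by
      by_contra! hzi
      exact absurd hz (not_lt.2 (hi₀ z hzi.le y))⟩ ⟨i, hlt⟩
  refine h a (hmin i hlt) ⟨ha, fun i' hi' => ?_⟩
  by_contra! hc
  exact absurd (hmin i' hc) (by lia)

theorem cellAvg_le_of_mem_stopSet {F : ℝ → ℝ≥0∞} {t : ℝ≥0∞} {y : ℝ} {i : ℤ}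
    (h : y ∈ stopSet F t i) : cellAvg F i y ≤ 2 * t :=
  (cellAvg_le_two_mul F i y).trans (by gcongr; exact h.2 _ (by lia))

/-- The enlargement of the stopping intervals of level `i` by their two neighbours. -/
def starSet (F : ℝ → ℝ≥0∞) (t : ℝ≥0∞) (i : ℤ) : Set ℝ :=
  stopSet F t i ∪ (fun x => x + 2 ^ (-i)) ⁻¹' stopSet F t i
    ∪ (fun x => x + (-2 ^ (-i))) ⁻¹' stopSet F t i

theorem measurableSet_starSet (F : ℝ → ℝ≥0∞) (t : ℝ≥0∞) (i : ℤ) :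
    MeasurableSet (starSet F t i) := by
  have h := measurableSet_stopSet F t i
  exact (h.union (h.preimage (by fun_prop))).union (h.preimage (by fun_prop))

theorem volume_starSet_le (F : ℝ → ℝ≥0∞) (t : ℝ≥0∞) (i : ℤ) :
    volume (starSet F t i) ≤ 3 * volume (stopSet F t i) := by
  unfold starSet
  calc _ ≤ volume (stopSet F t i) + volume ((fun x => x + 2 ^ (-i)) ⁻¹' stopSet F t i)
        + volume ((fun x => x + (-2 ^ (-i))) ⁻¹' stopSet F t i) :=
        (measure_union_le _ _).trans (by gcongr; exact measure_union_le _ _)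
    _ = _ := by
        rw [measure_preimage_add_right, measure_preimage_add_right]; ring

/-- Points closer than the length of a cell lie in the same cell or in adjacent ones, and `starSet`
contains both neighbours. -/
theorem two_zpow_le_abs_sub {F : ℝ → ℝ≥0∞} {t : ℝ≥0∞} {i : ℤ} {x y : ℝ} (hx : x ∉ starSet F t i)
    (hy : y ∈ stopSet F t i) : (2 : ℝ) ^ (-i) ≤ |x - y| := by
  by_contra! h
  apply hx
  have h0 : (0 : ℝ) < 2 ^ i := by positivity
  have e : (2 : ℝ) ^ (-i) * 2 ^ i = 1 := by rw [zpow_neg]; field_simp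
  have h1 : |x * 2 ^ i - y * 2 ^ i| < 1 := by
    rw [← sub_mul, abs_mul, abs_of_pos h0, ← e]
    gcongr
  rw [abs_lt] at h1
  have hx1 := Int.floor_le (x * (2 : ℝ) ^ i)
  have hx2 := Int.lt_floor_add_one (x * (2 : ℝ) ^ i)
  have hy1 := Int.floor_le (y * (2 : ℝ) ^ i)
  have hy2 := Int.lt_floor_add_one (y * (2 : ℝ) ^ i)
  have hA : idx i x < idx i y + 2 := by
    have : (idx i x : ℝ) < idx i y + 2 := by unfold idx; linarith
    exact_mod_cast this
  have hB : idx i y < idx i x + 2 := by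
    have : (idx i y : ℝ) < idx i x + 2 := by unfold idx; linarith
    exact_mod_cast this
  have hC : idx i (x + 2 ^ (-i)) = idx i x + 1 := by
    unfold idx
    rw [add_mul, e]; exact Int.floor_add_one _
  have hD : idx i (x + (-2 ^ (-i))) = idx i x - 1 := by
    unfold idx
    rw [add_mul, neg_mul, e, ← sub_eq_add_neg]; exact Int.floor_sub_one _
  unfold starSet
  rcases (by lia : idx i y = idx i x ∨ idx i y = idx i x + 1 ∨ idx i y = idx i x - 1) with
    h | h | h
  · exact Or.inl (Or.inl ((mem_stopSet_congr F t le_rfl h).1 hy))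
  · exact Or.inl (Or.inr ((mem_stopSet_congr F t le_rfl (h.trans hC.symm)).1 hy))
  · exact Or.inr ((mem_stopSet_congr F t le_rfl (h.trans hD.symm)).1 hy)

theorem mul_volume_iUnion_starSet_le (F : ℝ → ℝ≥0∞) (t : ℝ≥0∞) :
    t * volume (⋃ i, starSet F t i) ≤ 3 * ∫⁻ y, F y := by
  calc _ ≤ t * ∑' i, 3 * volume (stopSet F t i) := by
        gcongr
        exact (measure_iUnion_le _).trans (ENNReal.tsum_le_tsum fun i => volume_starSet_le F t i)
    _ = 3 * ∑' i, t * volume (stopSet F t i) := by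
        rw [ENNReal.tsum_mul_left, ENNReal.tsum_mul_left]; ring
    _ ≤ 3 * ∑' i, ∫⁻ y in stopSet F t i, F y := by
        gcongr with i
        exact mul_volume_stopSet_le F t i
    _ ≤ _ := by gcongr; exact tsum_setLIntegral_stopSet_le F F t

/-! ### Weak type bounds for maximal operators with shifted kernels -/

theorem measurable_uncurry_comp_idx {g : ℤ → ℝ → ℝ≥0∞} (hg : ∀ v, Measurable (g v)) (j : ℤ) :
    Measurable (fun p : ℝ × ℝ => g (idx j p.1) p.2) := by
  have h1 : Measurable (fun p : ℤ × ℝ => g p.1 p.2) := measurable_from_prod_countable_right hg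
  exact h1.comp (((measurable_idx j).comp measurable_fst).prodMk measurable_snd)

/-- Away from the enlarged stopping intervals, a family of kernels loses only a factor `m`. -/
theorem KernelBound.lintegral_far_sum_le {m s : ℕ} {K : ℝ≥0∞} {n : ℕ → ℤ → ℝ → ℝ≥0∞}
    (h : KernelBound m s K n) (hs : 1 ≤ s) (F : ℝ → ℝ≥0∞) (t : ℝ≥0∞) {G : ℝ → ℝ≥0∞}
    (hG : Measurable G) :
    ∫⁻ x in (⋃ i, starSet F t i)ᶜ, ∑' (k : ℕ) (i : ℤ), min 1 (len (i - lev m s k)) *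
      ∫⁻ y in stopSet F t i, G y * n k (idx (lev m s k) x) y ≤ (m + 4) * K * ∫⁻ y, G y := by
  have hmeas : ∀ k : ℕ, Measurable (fun p : ℝ × ℝ => G p.2 * n k (idx (lev m s k) p.1) p.2) :=
    fun k => (hG.comp measurable_snd).mul (measurable_uncurry_comp_idx (h.meas k) _)
  have hmeas' : ∀ (k : ℕ) (i : ℤ), Measurable fun x =>
      min 1 (len (i - lev m s k)) * ∫⁻ y in stopSet F t i, G y * n k (idx (lev m s k) x) y :=
    fun k i => (Measurable.lintegral_prod_right' (hmeas k)).const_mul _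
  have hstar : MeasurableSet (⋃ i, starSet F t i)ᶜ :=
    (MeasurableSet.iUnion (measurableSet_starSet F t)).compl
  -- Fubini: for fixed `y` in a stopping interval of level `i`, every `x` outside the enlarged set
  -- is at distance at least `2^{-i}`, and `lintegral_far_le` applies.
  have key : ∀ (k : ℕ) (i : ℤ), ∫⁻ x in (⋃ i, starSet F t i)ᶜ,
      ∫⁻ y in stopSet F t i, G y * n k (idx (lev m s k) x) y
      ≤ min 1 (len ((s * k : ℕ) - i)) * (K * ∫⁻ y in stopSet F t i, G y) := by
    intro k i
    rw [lintegral_lintegral_swap (hmeas k).aemeasurable]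
    calc _ ≤ ∫⁻ y in stopSet F t i, G y * (min 1 (len ((s * k : ℕ) - i)) * K) := by
          refine setLIntegral_mono' (measurableSet_stopSet F t i) fun y hy => ?_
          have hmy : Measurable fun x => n k (idx (lev m s k) x) y :=
            (measurable_of_countable (fun v => n k v y)).comp (measurable_idx _)
          rw [lintegral_const_mul _ hmy]
          gcongr
          refine le_trans (lintegral_mono_set ?_) (h.lintegral_far_le k y i)
          intro x hx
          have hx' : x ∉ starSet F t i := fun hxi => hx (Set.mem_iUnion.2 ⟨i, hxi⟩)
          exact two_zpow_le_abs_sub hx' hy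
      _ = _ := by rw [lintegral_mul_const _ hG]; ring
  calc _ = ∑' (k : ℕ) (i : ℤ), min 1 (len (i - lev m s k)) * ∫⁻ x in (⋃ i, starSet F t i)ᶜ,
        ∫⁻ y in stopSet F t i, G y * n k (idx (lev m s k) x) y := by
        rw [lintegral_tsum fun k => (Measurable.tsum fun i => hmeas' k i).aemeasurable]
        refine tsum_congr fun k => ?_
        rw [lintegral_tsum fun i => (hmeas' k i).aemeasurable]
        refine tsum_congr fun i => ?_
        rw [lintegral_const_mul _ (Measurable.lintegral_prod_right' (hmeas k))]
    _ ≤ ∑' (k : ℕ) (i : ℤ), min 1 (len (i - lev m s k)) *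
          (min 1 (len ((s * k : ℕ) - i)) * (K * ∫⁻ y in stopSet F t i, G y)) := by
        gcongr with k i
        exact key k i
    _ = ∑' i : ℤ, (∑' k : ℕ, min 1 (len (i - lev m s k)) * min 1 (len ((s * k : ℕ) - i))) *
          (K * ∫⁻ y in stopSet F t i, G y) := by
        rw [ENNReal.tsum_comm]
        refine tsum_congr fun i => ?_
        rw [← ENNReal.tsum_mul_right]
        refine tsum_congr fun k => ?_
        ring
    _ ≤ ∑' i : ℤ, (m + 4) * (K * ∫⁻ y in stopSet F t i, G y) := by
        gcongr with i
        exact tsum_min_len_le m hs i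
    _ = (m + 4) * K * ∑' i : ℤ, ∫⁻ y in stopSet F t i, G y := by
        rw [ENNReal.tsum_mul_left, ENNReal.tsum_mul_left]; ring
    _ ≤ _ := by gcongr; exact tsum_setLIntegral_stopSet_le F G t

theorem le_mul_cellAvg {C : ℝ≥0∞} {j : ℤ} {g : ℝ → ℝ≥0∞} (hg : Measurable g)
    (h : ∀ y y', idx j y = idx j y' → g y ≤ C * g y') (y : ℝ) : g y ≤ C * cellAvg g j y := by
  have h1 : g y * len j ≤ C * ∫⁻ z in {z | idx j z = idx j y}, g z := by
    rw [← lintegral_const_mul _ hg, ← volume_idx_eq j (idx j y), ← setLIntegral_const]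
    exact setLIntegral_mono' (measurableSet_idx_eq _ _) fun z hz => h y z (Eq.symm hz)
  calc g y = len (-j) * (g y * len j) := by
        rw [mul_comm (g y), ← mul_assoc, len_neg_mul, one_mul]
    _ ≤ len (-j) * (C * ∫⁻ z in {z | idx j z = idx j y}, g z) := by gcongr
    _ = _ := by unfold cellAvg; ring

theorem cellAvg_mul_comp_idx {F : ℝ → ℝ≥0∞} (hF : Measurable F) (j : ℤ) (g : ℤ → ℝ≥0∞) (y : ℝ) :
    cellAvg (fun z => F z * g (idx j z)) j y = cellAvg F j y * g (idx j y) := by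
  unfold cellAvg
  rw [setLIntegral_congr_fun (g := fun z => F z * g (idx j y)) (measurableSet_idx_eq j _)
    (fun z hz => by simp only [show idx j z = idx j y from hz]), lintegral_mul_const _ hF]
  ring

/-- By doubling, `g` is dominated by a function constant on cells. Against such a function `F` may
be replaced by its cell averages, which are at most `t` on `S`. -/
theorem setLIntegral_mul_le_of_cellAvg_le {C t : ℝ≥0∞} {j : ℤ} {F g : ℝ → ℝ≥0∞}
    (hF : Measurable F) (hg : Measurable g)
    (h : ∀ y y', idx j y = idx j y' → g y ≤ C * g y') {S : Set ℝ} (hS : MeasurableSet S)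
    (hSj : ∀ x y, idx j x = idx j y → x ∈ S → y ∈ S) (hFS : ∀ y ∈ S, cellAvg F j y ≤ t) :
    ∫⁻ y in S, F y * g y ≤ C * t * ∫⁻ y, g y := by
  set γ : ℤ → ℝ≥0∞ := fun n => len (-j) * ∫⁻ z in {z | idx j z = n}, g z
  calc _ ≤ ∫⁻ y in S, C * (F y * γ (idx j y)) := by
        refine lintegral_mono fun y => ?_
        rw [mul_left_comm]
        exact mul_le_mul' le_rfl (le_mul_cellAvg hg h y)
    _ = C * ∫⁻ y in S, cellAvg (fun z => F z * γ (idx j z)) j y := by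
        rw [setLIntegral_cellAvg _ j hS hSj, lintegral_const_mul]
        exact hF.mul ((measurable_of_countable γ).comp (measurable_idx j))
    _ ≤ C * ∫⁻ y in S, t * cellAvg g j y := by
        gcongr 1
        refine setLIntegral_mono' hS fun y hy => ?_
        rw [cellAvg_mul_comp_idx hF]
        exact mul_le_mul' (hFS y hy) le_rfl
    _ = C * t * ∫⁻ y in S, g y := by
        rw [lintegral_const_mul _ (measurable_cellAvg g j), setLIntegral_cellAvg _ j hS hSj]
        ring
    _ ≤ _ := mul_le_mul' le_rfl (setLIntegral_le_lintegral _ _)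

/-- A maximal operator with doubling kernels is of weak type `(1, 1)`, with norm `O(m)`. -/
theorem KernelBound.weak_type {m s : ℕ} {K : ℝ≥0∞} {n : ℕ → ℤ → ℝ → ℝ≥0∞}
    (h : KernelBound m s K n) (hs : 1 ≤ s) {C : ℝ≥0∞}
    (hC : ∀ k v y y', idx (lev m s k) y = idx (lev m s k) y' → n k v y ≤ C * n k v y')
    (hK0 : K ≠ 0) (hK : K ≠ ⊤) {F : ℝ → ℝ≥0∞} (hFm : Measurable F) (hF : ∫⁻ y, F y ≠ ⊤)
    {t : ℝ≥0∞} (ht : t ≠ 0) :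
    t * volume {x | (C * (2 * t) * K + K * t) < ⨆ k, ∫⁻ y, F y * n k (idx (lev m s k) x) y}
      ≤ (m + 7) * ∫⁻ y, F y := by
  set Far : ℝ → ℝ≥0∞ := fun x => ∑' (k : ℕ) (i : ℤ), min 1 (len (i - lev m s k)) *
      ∫⁻ y in stopSet F t i, F y * n k (idx (lev m s k) x) y with hFar
  -- The far part is a sum over `k` instead of a supremum; it no longer depends on `k` and is
  -- integrated outside the enlarged stopping intervals.
  have hpt : ∀ x k, ∫⁻ y, F y * n k (idx (lev m s k) x) y ≤ C * (2 * t) * K + Far x := by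
    intro x k
    set j := lev m s k
    -- `U` consists of the stopping intervals strictly coarser than `j`. Off `U` the average at
    -- level `j - 1` is at most `t`, so the one at level `j` is at most `2 * t`.
    set U : Set ℝ := ⋃ i : ℤ, ⋃ _ : i < j, stopSet F t i with hU
    have hUm : MeasurableSet U :=
      MeasurableSet.iUnion fun i => MeasurableSet.iUnion fun _ => measurableSet_stopSet F t i
    have hUj : ∀ x y, idx j x = idx j y → x ∈ Uᶜ → y ∈ Uᶜ := by
      intro x y hxy hx hy
      apply hx
      simp only [hU, Set.mem_iUnion] at hy ⊢
      obtain ⟨i, hi, hy⟩ := hy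
      exact ⟨i, hi, (mem_stopSet_congr F t hi.le hxy).2 hy⟩
    rw [← lintegral_add_compl _ hUm, add_comm]
    refine add_le_add ?_ ?_
    · refine (setLIntegral_mul_le_of_cellAvg_le hFm (h.meas k _) (hC k _) hUm.compl hUj
        (t := 2 * t) ?_).trans ?_
      · intro y hy
        refine (cellAvg_le_two_mul F j y).trans ?_
        gcongr
        refine cellAvg_le_of_notMem hF ht fun i hi hyi => hy ?_
        simp only [hU, Set.mem_iUnion]
        exact ⟨i, by lia, hyi⟩
      · gcongr
        exact h.lintegral_le k _
    · refine le_trans ?_ (ENNReal.le_tsum k)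
      refine (lintegral_iUnion_le _ _).trans (ENNReal.tsum_le_tsum fun i => ?_)
      -- No cancellation is available here, and none is needed: for `i < j` the factor `min 1 (len
      -- (i - j))` equals 1.
      by_cases hi : i < j
      · have : len (i - j) ≥ 1 := by
          rw [← len_zero]; exact len_anti (by lia)
        rw [min_eq_left this, one_mul]
        simp [hi, j]
      · simp [hi]
  have hFarm : Measurable Far := by
    refine Measurable.tsum fun k => Measurable.tsum fun i => Measurable.const_mul ?_ _
    exact Measurable.lintegral_prod_right' (f := fun p : ℝ × ℝ =>
      F p.2 * n k (idx (lev m s k) p.1) p.2)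
      ((hFm.comp measurable_snd).mul (measurable_uncurry_comp_idx (h.meas k) _))
  set S : Set ℝ := ⋃ i, starSet F t i with hS
  have hSm : MeasurableSet S := MeasurableSet.iUnion (measurableSet_starSet F t)
  have hsub : {x | (C * (2 * t) * K + K * t) < ⨆ k, ∫⁻ y, F y * n k (idx (lev m s k) x) y}
      ⊆ S ∪ {x | K * t ≤ (Sᶜ).indicator Far x} := by
    intro x hx
    by_cases hxS : x ∈ S
    · exact Or.inl hxS
    · right
      rw [Set.mem_ofPred_eq, Set.indicator_of_mem (Set.mem_compl hxS)]
      obtain ⟨k, hk⟩ := lt_iSup_iff.1 (Set.mem_ofPred_eq ▸ hx)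
      by_contra! hlt
      exact absurd (hk.trans_le (hpt x k)) (not_lt.2 (by gcongr))
  have h2 : t * volume {x | K * t ≤ (Sᶜ).indicator Far x} ≤ (m + 4) * ∫⁻ y, F y := by
    have h3 := mul_meas_ge_le_lintegral₀ (hFarm.indicator hSm.compl).aemeasurable (μ := volume)
      (K * t)
    rw [lintegral_indicator hSm.compl] at h3
    have h4 := h3.trans (h.lintegral_far_sum_le hs F t hFm)
    rw [mul_assoc, mul_right_comm, mul_comm _ K] at h4
    exact (ENNReal.mul_le_mul_iff_right hK0 hK).1 h4
  calc _ ≤ t * (volume S + volume {x | K * t ≤ (Sᶜ).indicator Far x}) := by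
        gcongr
        exact (measure_mono hsub).trans (measure_union_le _ _)
    _ ≤ 3 * (∫⁻ y, F y) + (m + 4) * ∫⁻ y, F y := by
        rw [mul_add]
        exact add_le_add (mul_volume_iUnion_starSet_le F t) h2
    _ = _ := by ring

/-! ### The weights of the shifts and the major subset of `F₄` -/

/-- A majorant of the normalized wave packet coefficients of functions bounded by `1_F`. -/
noncomputable def amp (F : Set ℝ) (j : ℤ) (w : ℝ) : ℝ≥0∞ := ∫⁻ y in F, ker 10 j w y

/-- The integers `p ∼ 2^m`. -/
def shiftRange (m : ℕ) : Finset ℕ := Finset.Ico (2 ^ m) (2 ^ (m + 1))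

/-- The weight of the shift `p` coming from the coefficients of the first two functions. -/
noncomputable def weight (m : ℕ) (F₁ F₂ : Set ℝ) (k : ℕ) (u : ℤ) (p : ℕ) : ℝ≥0∞ :=
  len m * amp F₁ (lev m 1 k) (((u / 2 ^ k : ℤ) : ℝ) - p)
    * amp F₂ (lev m 2 k) ((u : ℝ) + (p : ℝ) ^ 2 / 2 ^ m)

/-- The average over the shifts of the majorants of the coefficients of the first function. -/
noncomputable def parentMass (m : ℕ) (F₁ : Set ℝ) (k : ℕ) (r : ℤ) : ℝ≥0∞ :=
  ∑ p ∈ shiftRange m, len m * amp F₁ (lev m 1 k) ((r : ℝ) - p)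

theorem sum_rho_add_natCast_le (P : Finset ℕ) (z : ℝ) : ∑ p ∈ P, rho 2 (z + p) ≤ bumpConst := by
  have hinj : Function.Injective (fun p : ℕ => -(p : ℤ)) := fun a b h => by simpa using h
  calc _ ≤ ∑' p : ℕ, rho 2 (z + p) := ENNReal.sum_le_tsum _
    _ = ∑' p : ℕ, (fun n : ℤ => rho 2 (z - n)) (-(p : ℤ)) := by
        refine tsum_congr fun p => ?_
        push_cast
        rw [sub_neg_eq_add]
    _ ≤ ∑' n : ℤ, rho 2 (z - n) := ENNReal.tsum_comp_le_tsum_of_injective hinj _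
    _ ≤ _ := tsum_rho_sub_le z

theorem lt_of_mem_shiftRange {m p : ℕ} (h : p ∈ shiftRange m) : (p : ℝ) ≤ 2 * 2 ^ m := by
  have := (Finset.mem_Ico.1 h).2.le
  have h2 : (p : ℝ) ≤ 2 ^ (m + 1) := by exact_mod_cast this
  rw [pow_succ] at h2; linarith

theorem abs_sq_shift_le {m p : ℕ} (h : p ∈ shiftRange m) :
    |-((p : ℝ) ^ 2 / 2 ^ m)| ≤ 8 * 2 ^ m := by
  have h1 := lt_of_mem_shiftRange h
  have h0 : (0 : ℝ) < 2 ^ m := by positivity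
  rw [abs_neg, abs_of_nonneg (by positivity), div_le_iff₀ h0]
  calc (p : ℝ) ^ 2 ≤ (2 * 2 ^ m) ^ 2 := by gcongr
    _ ≤ _ := by nlinarith

theorem abs_cube_shift_le {m p : ℕ} (h : p ∈ shiftRange m) :
    |(p : ℝ) ^ 3 / 2 ^ (2 * m)| ≤ 8 * 2 ^ m := by
  have h1 := lt_of_mem_shiftRange h
  rw [abs_of_nonneg (by positivity), div_le_iff₀ (by positivity)]
  calc (p : ℝ) ^ 3 ≤ (2 * 2 ^ m) ^ 3 := by gcongr
    _ = _ := by ring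

/-- At level `k` a shift by `p ≤ 2 * 2^m` intervals of level `m + k` is a displacement by at most 2.
Passing from `x` to `u` and from `u` to its parent costs the distance of the indices and bounded
errors. -/
theorem one_add_abs_coarse_le (m k p : ℕ) (hp : (p : ℝ) ≤ 2 * 2 ^ m) (x y : ℝ) (u : ℤ) :
    1 + |y * 2 ^ (k : ℤ) - idx k x| ≤ 36 * (1 + |(u : ℝ) - idx (lev m 2 k) x|) *
      (1 + |y * 2 ^ lev m 1 k - (((u / 2 ^ k : ℤ) : ℝ) - p)|) := by
  set r : ℝ := ((u / 2 ^ k : ℤ) : ℝ) with hr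
  set d : ℝ := (u : ℝ) - idx (lev m 2 k) x with hd
  set Z : ℝ := y * 2 ^ lev m 1 k - (r - p) with hZ
  have e1 : (2 : ℝ) ^ lev m 1 k = 2 ^ m * 2 ^ k := by
    unfold lev
    rw [zpow_add₀ (by norm_num)]; simp [← zpow_natCast]
  have e2 : (2 : ℝ) ^ lev m 2 k = 2 ^ m * (2 ^ k * 2 ^ k) := by
    unfold lev
    rw [zpow_add₀ (by norm_num), zpow_natCast]
    congr 1
    rw [← pow_add, ← zpow_natCast]; congr 1; push_cast; ring
  have hm : (1 : ℝ) ≤ 2 ^ m := one_le_pow₀ (by norm_num)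
  have hk : (1 : ℝ) ≤ 2 ^ k := one_le_pow₀ (by norm_num)
  have hk0 : (0 : ℝ) < 2 ^ k := by positivity
  have hm0 : (0 : ℝ) < 2 ^ m := by positivity
  have ha : |(u : ℝ) * (2 ^ k)⁻¹ - r| ≤ 1 := by
    have := abs_div_two_pow_sub_le u k
    rwa [zpow_neg, zpow_natCast] at this
  have hb : |x * (2 ^ m * (2 ^ k * 2 ^ k)) - idx (lev m 2 k) x| ≤ 1 := by
    have h1 := Int.floor_le (x * (2 : ℝ) ^ lev m 2 k)
    have h2 := (Int.lt_floor_add_one (x * (2 : ℝ) ^ lev m 2 k)).le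
    rw [← e2]; unfold idx
    rw [abs_le]; constructor <;> linarith
  have hc : |x * 2 ^ k - idx k x| ≤ 1 := by
    have h1 := Int.floor_le (x * (2 : ℝ) ^ (k : ℤ))
    have h2 := (Int.lt_floor_add_one (x * (2 : ℝ) ^ (k : ℤ))).le
    rw [← zpow_natCast]; unfold idx
    rw [abs_le]; constructor <;> linarith
  set b : ℝ := x * (2 ^ m * (2 ^ k * 2 ^ k)) - idx (lev m 2 k) x with hbdef
  have key : y * 2 ^ k - idx k x = Z * (2 ^ m)⁻¹ - p * (2 ^ m)⁻¹
      + ((r - (u : ℝ) * (2 ^ k)⁻¹) * (2 ^ m)⁻¹ + (d - b) * (2 ^ k)⁻¹ * (2 ^ m)⁻¹)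
      + (x * 2 ^ k - idx k x) := by
    rw [hZ, hd, hbdef, e1]
    field_simp
    ring
  have hmi : ((2 : ℝ) ^ m)⁻¹ ≤ 1 := inv_le_one_of_one_le₀ hm
  have hki : ((2 : ℝ) ^ k)⁻¹ ≤ 1 := inv_le_one_of_one_le₀ hk
  have hmi0 : 0 < ((2 : ℝ) ^ m)⁻¹ := by positivity
  have hki0 : 0 < ((2 : ℝ) ^ k)⁻¹ := by positivity
  have t1 : |Z * (2 ^ m)⁻¹| ≤ |Z| := by
    rw [abs_mul, abs_of_pos hmi0]; exact mul_le_of_le_one_right (abs_nonneg _) hmi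
  have t2 : |(p : ℝ) * (2 ^ m)⁻¹| ≤ 2 := by
    rw [abs_of_nonneg (by positivity), ← div_eq_mul_inv, div_le_iff₀ hm0]; exact hp
  have t3 : |(r - (u : ℝ) * (2 ^ k)⁻¹) * (2 ^ m)⁻¹| ≤ 1 := by
    rw [abs_mul, abs_of_pos hmi0, abs_sub_comm]; exact mul_le_one₀ ha hmi0.le hmi
  have t4 : |(d - b) * (2 ^ k)⁻¹ * (2 ^ m)⁻¹| ≤ |d| + 1 := by
    rw [abs_mul, abs_mul, abs_of_pos hmi0, abs_of_pos hki0]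
    have : |d - b| ≤ |d| + 1 := (abs_sub _ _).trans (by linarith)
    calc _ ≤ |d - b| * 1 * 1 := by gcongr
      _ ≤ _ := by linarith
  rw [zpow_natCast, key]
  have s1 := abs_add_le (Z * (2 ^ m)⁻¹ - p * (2 ^ m)⁻¹
      + ((r - (u : ℝ) * (2 ^ k)⁻¹) * (2 ^ m)⁻¹ + (d - b) * (2 ^ k)⁻¹ * (2 ^ m)⁻¹))
      (x * 2 ^ k - idx k x)
  have s2 := abs_add_le (Z * (2 ^ m)⁻¹ - p * (2 ^ m)⁻¹)
      ((r - (u : ℝ) * (2 ^ k)⁻¹) * (2 ^ m)⁻¹ + (d - b) * (2 ^ k)⁻¹ * (2 ^ m)⁻¹)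
  have s3 := abs_add_le ((r - (u : ℝ) * (2 ^ k)⁻¹) * (2 ^ m)⁻¹) ((d - b) * (2 ^ k)⁻¹ * (2 ^ m)⁻¹)
  have s4 := abs_sub (Z * (2 ^ m)⁻¹) (p * (2 ^ m)⁻¹)
  nlinarith [abs_nonneg Z, abs_nonneg d, mul_nonneg (abs_nonneg Z) (abs_nonneg d)]

/-- The kernels of the unshifted maximal function. -/
noncomputable def plainKernel (k : ℕ) (v : ℤ) (y : ℝ) : ℝ≥0∞ :=
  avgKernel 5 (lev 0 1 k) {0} 1 0 v y

theorem plainKernel_eq (k : ℕ) (v : ℤ) (y : ℝ) : plainKernel k v y = ker 5 k v y := by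
  simp [plainKernel, avgKernel, lev]

theorem plainKernel_bound : KernelBound 0 1 schurConst plainKernel := by
  refine ⟨fun k v => measurable_avgKernel _ _ _ _ _ _, fun k v => ?_, fun k y => ?_⟩
  · have := lintegral_avgKernel_jb_le (m := 0) (P := {0}) (θ := 0) (W := 1) (K := 1) (N := 5)
      (by simp) (by simp) le_rfl (lev 0 1 k) v
    rwa [mul_one] at this
  · have := tsum_avgKernel_jb_le (m := 0) (k := k) (by simp) (P := {0}) (θ := 0) (W := fun _ => 1)
      (K := 1) (N := 5) (by simp) (by simp) le_rfl (lev 0 1 k) y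
    rwa [mul_one] at this

/-- The `2^m` consecutive bumps of scale `2^{-m-k}`, each with weight `2^{-m}`, add up to one bump
of scale `2^{-k}`. So the unshifted maximal function at `x` is enough, at the price of a power of
the distance from `u` to `x`. -/
theorem parentMass_le (m : ℕ) {F₁ : Set ℝ} (hF₁ : MeasurableSet F₁) (k : ℕ) (x : ℝ) (u : ℤ) :
    parentMass m F₁ k (u / 2 ^ k) ≤ 36 ^ 5 * bumpConst * jb ((u : ℝ) - idx (lev m 2 k) x) ^ 5 *
      ∫⁻ y, F₁.indicator 1 y * plainKernel k (idx (lev 0 1 k) x) y := by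
  set d : ℝ := (u : ℝ) - idx (lev m 2 k) x
  have e : lev 0 1 k = (k : ℤ) := by simp [lev]
  have hlen : len m * len (-lev m 1 k) = len (-(k : ℤ)) := by
    rw [← len_add]; congr 1; unfold lev; push_cast; ring
  have key : ∀ y, ∑ p ∈ shiftRange m, len m * ker 10 (lev m 1 k) (((u / 2 ^ k : ℤ) : ℝ) - p) y ≤
      36 ^ 5 * bumpConst * jb d ^ 5 * plainKernel k (idx (lev 0 1 k) x) y := by
    intro y
    rw [plainKernel_eq, e]
    unfold ker
    set z := y * 2 ^ lev m 1 k - ((u / 2 ^ k : ℤ) : ℝ)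
    -- Of the decay of order 10, order 5 is transferred to the coarse scale and order 2 makes the
    -- sum over `p` converge.
    calc _ ≤ ∑ p ∈ shiftRange m, (36 ^ 5 * jb d ^ 5 * (len (-(k : ℤ)) *
          rho 5 (y * 2 ^ (k : ℤ) - idx k x))) * rho 2 (z + p) := by
          refine Finset.sum_le_sum fun p hp => ?_
          have h1 : rho 5 (y * 2 ^ lev m 1 k - (((u / 2 ^ k : ℤ) : ℝ) - p)) ≤
              36 ^ 5 * jb d ^ 5 * rho 5 (y * 2 ^ (k : ℤ) - idx k x) := by
            have := rho_le_mul (N := 5) (by positivity)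
              (one_add_abs_coarse_le m k p (lt_of_mem_shiftRange hp) x y u)
            rw [ENNReal.ofReal_mul (by norm_num), mul_pow] at this
            simpa [jb, d] using this
          rw [← mul_assoc, hlen]
          have h2 : z + p = y * 2 ^ lev m 1 k - (((u / 2 ^ k : ℤ) : ℝ) - p) := by
            simp only [z]; ring
          rw [h2]
          calc _ ≤ len (-(k : ℤ)) * rho (5 + 2) (y * 2 ^ lev m 1 k - (((u / 2 ^ k : ℤ) : ℝ) - p)) := by
                gcongr; exact rho_anti (by norm_num) _
            _ ≤ len (-(k : ℤ)) * ((36 ^ 5 * jb d ^ 5 * rho 5 (y * 2 ^ (k : ℤ) - idx k x)) *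
                  rho 2 (y * 2 ^ lev m 1 k - (((u / 2 ^ k : ℤ) : ℝ) - p))) := by
                rw [rho_add]; gcongr
            _ = _ := by ring
      _ ≤ (36 ^ 5 * jb d ^ 5 * (len (-(k : ℤ)) *
          rho 5 (y * 2 ^ (k : ℤ) - idx k x))) * bumpConst := by
          rw [← Finset.mul_sum]
          gcongr
          exact sum_rho_add_natCast_le _ _
      _ = _ := by ring
  unfold parentMass amp
  calc _ = ∫⁻ y in F₁, ∑ p ∈ shiftRange m,
        len m * ker 10 (lev m 1 k) (((u / 2 ^ k : ℤ) : ℝ) - p) y := by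
        rw [lintegral_finsetSum _ (fun p _ => (measurable_ker _ _ _).const_mul _)]
        refine Finset.sum_congr rfl fun p _ => ?_
        rw [lintegral_const_mul _ (measurable_ker _ _ _)]
    _ ≤ ∫⁻ y in F₁, 36 ^ 5 * bumpConst * jb d ^ 5 * plainKernel k (idx (lev 0 1 k) x) y :=
        lintegral_mono key
    _ = _ := by
        rw [lintegral_const_mul _ (plainKernel_bound.meas _ _), ← lintegral_indicator hF₁]
        congr 2
        ext y
        by_cases hy : y ∈ F₁ <;> simp [hy]

/-- The weights of the first function, normalized to have total mass at most one. -/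
noncomputable def unitWeight (m : ℕ) (F₁ : Set ℝ) (k : ℕ) (r : ℤ) (p : ℕ) : ℝ≥0∞ :=
  len m * amp F₁ (lev m 1 k) ((r : ℝ) - p) / parentMass m F₁ k r

theorem sum_unitWeight_le (m : ℕ) (F₁ : Set ℝ) (k : ℕ) (r : ℤ) :
    ∑ p ∈ shiftRange m, unitWeight m F₁ k r p ≤ 1 := by
  unfold unitWeight
  simp_rw [div_eq_mul_inv]
  rw [← Finset.sum_mul]
  -- An inequality only: when the mass vanishes, the quotient `0 / 0` is 0.
  exact ENNReal.div_self_le_one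

theorem amp_le (F : Set ℝ) (j : ℤ) (w : ℝ) : amp F j w ≤ bumpConst :=
  (setLIntegral_le_lintegral _ _).trans (lintegral_ker_le (by norm_num) j w)

theorem parentMass_ne_top (m : ℕ) (F₁ : Set ℝ) (k : ℕ) (r : ℤ) : parentMass m F₁ k r ≠ ⊤ := by
  unfold parentMass
  refine ENNReal.sum_ne_top.2 fun p _ => ENNReal.mul_ne_top (len_ne_top _) ?_
  exact ne_top_of_le_ne_top bumpConst_ne_top (amp_le _ _ _)

theorem parentMass_mul_unitWeight (m : ℕ) (F₁ : Set ℝ) (k : ℕ) (r : ℤ) {p : ℕ}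
    (hp : p ∈ shiftRange m) : parentMass m F₁ k r * unitWeight m F₁ k r p =
      len m * amp F₁ (lev m 1 k) ((r : ℝ) - p) := by
  unfold unitWeight
  by_cases h0 : parentMass m F₁ k r = 0
  · have : len m * amp F₁ (lev m 1 k) ((r : ℝ) - p) = 0 :=
      (Finset.sum_eq_zero_iff.1 h0) p hp
    rw [h0, this]; simp
  · exact ENNReal.mul_div_cancel h0 (parentMass_ne_top _ _ _ _)

/-- The kernels of the maximal function along the shifts of the second function. -/
noncomputable def shiftKernel (m : ℕ) (F₁ : Set ℝ) (k : ℕ) (v : ℤ) (y : ℝ) : ℝ≥0∞ :=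
  if m ≤ k then avgKernel 10 (lev m 2 k) (shiftRange m) (unitWeight m F₁ k (v / 2 ^ k))
    (fun p => -((p : ℝ) ^ 2 / 2 ^ m)) v y else 0

theorem shiftKernel_bound (m : ℕ) (F₁ : Set ℝ) :
    KernelBound m 2 schurConst (shiftKernel m F₁) := by
  refine ⟨fun k v => ?_, fun k v => ?_, fun k y => ?_⟩ <;> unfold shiftKernel <;>
    by_cases h : m ≤ k
  · simp only [h, if_true]; exact measurable_avgKernel _ _ _ _ _ _
  · simp only [h, if_false]; exact measurable_const
  · simp only [h, if_true]
    have := lintegral_avgKernel_jb_le (fun p hp => abs_sq_shift_le (m := m) hp)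
      (sum_unitWeight_le m F₁ k (v / 2 ^ k)) (N := 10) (by norm_num) (lev m 2 k) v
    rwa [mul_one] at this
  · simp [h]
  · simp only [h, if_true]
    have := tsum_avgKernel_jb_le h (fun p hp => abs_sq_shift_le (m := m) hp)
      (sum_unitWeight_le m F₁ k) (N := 10) (by norm_num) (lev m 2 k) y
    rwa [mul_one] at this
  · simp [h]

/-- Factoring out the mass from `F₁` leaves probability weights on the shifts. The remaining average
of `1_{F₂}` then has kernels with Schur bounds independent of `F₁`. -/
theorem sum_weight_eq {m k : ℕ} (hmk : m ≤ k) (F₁ : Set ℝ) {F₂ : Set ℝ} (hF₂ : MeasurableSet F₂)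
    (u : ℤ) : ∑ p ∈ shiftRange m, weight m F₁ F₂ k u p =
      parentMass m F₁ k (u / 2 ^ k) * ∫⁻ y, F₂.indicator 1 y * shiftKernel m F₁ k u y := by
  have h1 : ∫⁻ y, F₂.indicator 1 y * shiftKernel m F₁ k u y =
      ∑ p ∈ shiftRange m, unitWeight m F₁ k (u / 2 ^ k) p *
        amp F₂ (lev m 2 k) ((u : ℝ) + (p : ℝ) ^ 2 / 2 ^ m) := by
    calc _ = ∫⁻ y in F₂, shiftKernel m F₁ k u y := by
          rw [← lintegral_indicator hF₂]
          congr 1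
          ext y
          by_cases hy : y ∈ F₂ <;> simp [hy]
      _ = _ := by
          unfold shiftKernel avgKernel
          simp only [hmk, if_true]
          rw [lintegral_finsetSum _ (fun p _ => (measurable_ker _ _ _).const_mul _)]
          refine Finset.sum_congr rfl fun p _ => ?_
          rw [lintegral_const_mul _ (measurable_ker _ _ _), sub_neg_eq_add]
          rfl
  rw [h1, Finset.mul_sum]
  refine Finset.sum_congr rfl fun p hp => ?_
  rw [← mul_assoc, parentMass_mul_unitWeight _ _ _ _ hp]
  rfl

/-- The maximal function that controls the weights of the first function. -/
noncomputable def maxOne (F₁ : Set ℝ) (x : ℝ) : ℝ≥0∞ :=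
  ⨆ k, ∫⁻ y, F₁.indicator 1 y * plainKernel k (idx (lev 0 1 k) x) y

/-- The maximal function that controls the weights of the second function. -/
noncomputable def maxTwo (m : ℕ) (F₁ F₂ : Set ℝ) (x : ℝ) : ℝ≥0∞ :=
  ⨆ k, ∫⁻ y, F₂.indicator 1 y *
    ∑' v' : ℤ, rho 3 ((v' : ℝ) - idx (lev m 2 k) x) * shiftKernel m F₁ k v' y

/-- The exponent is `8 = 5 + 3`: five powers of the bracket move the `F₁` factor from `u` to `x`,
and three undo the smearing in `maxTwo`. -/
theorem sum_weight_le_max {m k : ℕ} (hmk : m ≤ k) {F₁ F₂ : Set ℝ} (hF₁ : MeasurableSet F₁)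
    (hF₂ : MeasurableSet F₂) (u : ℤ) (x : ℝ) :
    ∑ p ∈ shiftRange m, weight m F₁ F₂ k u p ≤
      36 ^ 5 * bumpConst * (maxOne F₁ x * maxTwo m F₁ F₂ x) *
        jb ((u : ℝ) - idx (lev m 2 k) x) ^ 8 := by
  set d : ℝ := (u : ℝ) - idx (lev m 2 k) x with hd
  have h1 : ∫⁻ y, F₂.indicator 1 y * shiftKernel m F₁ k u y ≤ jb d ^ 3 * maxTwo m F₁ F₂ x := by
    calc _ = jb d ^ 3 * (rho 3 d * ∫⁻ y, F₂.indicator 1 y * shiftKernel m F₁ k u y) := by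
          rw [← mul_assoc, jb_pow_mul_rho, one_mul]
      _ ≤ _ := by
          gcongr
          refine le_trans ?_ (le_iSup _ k)
          rw [← lintegral_const_mul' _ _ (rho_ne_top _ _)]
          refine lintegral_mono fun y => ?_
          rw [mul_left_comm]
          gcongr
          exact ENNReal.le_tsum (f := fun v' : ℤ =>
            rho 3 ((v' : ℝ) - idx (lev m 2 k) x) * shiftKernel m F₁ k v' y) u
  rw [sum_weight_eq hmk F₁ hF₂]
  calc _ ≤ (36 ^ 5 * bumpConst * jb d ^ 5 * maxOne F₁ x) * (jb d ^ 3 * maxTwo m F₁ F₂ x) := by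
        gcongr
        refine (parentMass_le m hF₁ k x u).trans ?_
        gcongr
        exact le_iSup (fun k => ∫⁻ y, F₁.indicator 1 y * plainKernel k (idx (lev 0 1 k) x) y) k
    _ = _ := by ring

theorem measurable_maxOne (F₁ : Set ℝ) : Measurable (maxOne F₁) :=
  Measurable.iSup fun k => (measurable_of_countable (fun v : ℤ =>
    ∫⁻ y, F₁.indicator 1 y * plainKernel k v y)).comp (measurable_idx _)

theorem measurable_maxTwo (m : ℕ) (F₁ F₂ : Set ℝ) : Measurable (maxTwo m F₁ F₂) :=
  Measurable.iSup fun k => (measurable_of_countable (fun v : ℤ => ∫⁻ y, F₂.indicator 1 y *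
    ∑' v' : ℤ, rho 3 ((v' : ℝ) - v) * shiftKernel m F₁ k v' y)).comp (measurable_idx _)

theorem schurConst_ne_zero : schurConst ≠ 0 := by
  unfold schurConst
  have := one_le_bumpConst
  exact mul_ne_zero (by norm_num) (pow_ne_zero _ (zero_lt_one.trans_le this).ne')

theorem lintegral_indicator_one_eq {F : Set ℝ} (hF : MeasurableSet F) :
    ∫⁻ y, F.indicator (1 : ℝ → ℝ≥0∞) y = volume F := by
  rw [lintegral_indicator hF]; simp

/-- `weak_type` with doubling constant `2^5`: the threshold is `65 = 2 * 2^5 + 1`, and the loss `m +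
7` becomes 7 because unshifted kernels have `m = 0`. -/
theorem mul_volume_maxOne_le {F₁ : Set ℝ} (hF₁ : MeasurableSet F₁) (h : volume F₁ ≠ ⊤)
    {t : ℝ≥0∞} (ht : t ≠ 0) :
    t * volume {x | 65 * schurConst * t < maxOne F₁ x} ≤ 7 * volume F₁ := by
  have := plainKernel_bound.weak_type le_rfl (C := 2 ^ 5)
    (fun k v y y' hy => avgKernel_le_of_idx_eq _ _ _ _ _ hy) schurConst_ne_zero schurConst_ne_top
    (F := F₁.indicator 1) (measurable_one.indicator hF₁)
    (by rwa [lintegral_indicator_one_eq hF₁]) ht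
  rw [lintegral_indicator_one_eq hF₁] at this
  convert this using 5
  · congr! 1
    ring
  · simp

/-- `weak_type` for the smeared kernels, which inherit the doubling constant `2^10` of the bumps;
the threshold is `2049 = 2 * 2^10 + 1`. -/
theorem mul_volume_maxTwo_le (m : ℕ) (F₁ : Set ℝ) {F₂ : Set ℝ} (hF₂ : MeasurableSet F₂)
    (h : volume F₂ ≠ ⊤) {t : ℝ≥0∞} (ht : t ≠ 0) :
    t * volume {x | 2049 * (bumpConst * schurConst) * t < maxTwo m F₁ F₂ x}
      ≤ (m + 7) * volume F₂ := by
  have hb : bumpConst ≠ 0 := (zero_lt_one.trans_le one_le_bumpConst).ne'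
  have := (shiftKernel_bound m F₁).smear.weak_type (by norm_num) (C := 2 ^ 10)
    (fun k v y y' hy => by
      rw [← ENNReal.tsum_mul_left]
      refine ENNReal.tsum_le_tsum fun v' => ?_
      rw [mul_left_comm]
      gcongr
      unfold shiftKernel
      split_ifs
      · exact avgKernel_le_of_idx_eq _ _ _ _ _ hy
      · simp) (mul_ne_zero hb schurConst_ne_zero) (ENNReal.mul_ne_top bumpConst_ne_top
        schurConst_ne_top) (F := F₂.indicator 1) (measurable_one.indicator hF₂)
    (by rwa [lintegral_indicator_one_eq hF₂]) ht
  rw [lintegral_indicator_one_eq hF₂] at this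
  convert this using 5
  congr! 1
  ring

/-- The constant in the bound for the weights near the reduced set `F₄'`. -/
noncomputable def weightConst : ℝ≥0∞ :=
  36 ^ 5 * bumpConst * (65 * schurConst * 28 * (2049 * (bumpConst * schurConst) * 4))

theorem weightConst_ne_top : weightConst ≠ ⊤ := by
  have h1 := bumpConst_ne_top
  have h2 := schurConst_ne_top
  unfold weightConst
  finiteness

/-- The reduction of `F₄` to a major subset on which the weights are under control. -/
theorem exists_major_subset (m : ℕ) {F₁ F₂ F₄ : Set ℝ} (hF₁ : MeasurableSet F₁)
    (hF₂ : MeasurableSet F₂) (hF₄ : MeasurableSet F₄) (h₁ : volume F₁ ≠ 0) (h₁' : volume F₁ ≠ ⊤)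
    (h₂ : volume F₂ ≠ 0) (h₂' : volume F₂ ≠ ⊤) (h₄ : volume F₄ ≠ 0) (h₄' : volume F₄ ≠ ⊤) :
    ∃ F₄' : Set ℝ, F₄' ⊆ F₄ ∧ MeasurableSet F₄' ∧ volume F₄ / 2 ≤ volume F₄' ∧
      ∀ x ∈ F₄', ∀ k, m ≤ k → ∀ u : ℤ, ∑ p ∈ shiftRange m, weight m F₁ F₂ k u p ≤
        weightConst * (m + 7) * (volume F₁ / volume F₄) * (volume F₂ / volume F₄) *
          jb ((u : ℝ) - idx (lev m 2 k) x) ^ 8 := by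
  -- The heights are four times the weak type constants, so each exceptional set takes at most a
  -- quarter of `F₄`.
  set t₁ : ℝ≥0∞ := 28 * (volume F₁ / volume F₄) with ht₁
  set t₂ : ℝ≥0∞ := 4 * (m + 7) * (volume F₂ / volume F₄) with ht₂
  set E₁ : Set ℝ := {x | 65 * schurConst * t₁ < maxOne F₁ x} with hE₁
  set E₂ : Set ℝ := {x | 2049 * (bumpConst * schurConst) * t₂ < maxTwo m F₁ F₂ x} with hE₂
  have hE₁m : MeasurableSet E₁ := measurableSet_lt measurable_const (measurable_maxOne F₁)
  have hE₂m : MeasurableSet E₂ := measurableSet_lt measurable_const (measurable_maxTwo m F₁ F₂)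
  have hv₁ : volume E₁ ≤ volume F₄ / 4 := by
    have h := mul_volume_maxOne_le hF₁ h₁' (t := t₁)
      (mul_ne_zero (by norm_num) (ENNReal.div_ne_zero.2 ⟨h₁, h₄'⟩))
    have e : t₁ * (volume F₄ / 4) = 7 * volume F₁ := by
      rw [ht₁, show (28 : ℝ≥0∞) = 7 * 4 by norm_num]
      calc _ = 7 * (volume F₁ / volume F₄ * volume F₄) * (4 * 4⁻¹) := by
            rw [ENNReal.div_eq_inv_mul (b := 4)]; ring
        _ = _ := by
            rw [ENNReal.div_mul_cancel h₄ h₄', ENNReal.mul_inv_cancel (by norm_num) (by norm_num),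
              mul_one]
    rw [← e] at h
    exact (ENNReal.mul_le_mul_iff_right (mul_ne_zero (by norm_num) (ENNReal.div_ne_zero.2 ⟨h₁, h₄'⟩))
      (ENNReal.mul_ne_top (by norm_num) (ENNReal.div_ne_top h₁' h₄))).1 h
  have hv₂ : volume E₂ ≤ volume F₄ / 4 := by
    have hne : t₂ ≠ 0 := mul_ne_zero (mul_ne_zero (by norm_num) (by simp))
      (ENNReal.div_ne_zero.2 ⟨h₂, h₄'⟩)
    have h := mul_volume_maxTwo_le m F₁ hF₂ h₂' hne
    have e : t₂ * (volume F₄ / 4) = (m + 7) * volume F₂ := by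
      rw [ht₂]
      calc _ = (m + 7) * (volume F₂ / volume F₄ * volume F₄) * (4 * 4⁻¹) := by
            rw [ENNReal.div_eq_inv_mul (b := 4)]; ring
        _ = _ := by
            rw [ENNReal.div_mul_cancel h₄ h₄', ENNReal.mul_inv_cancel (by norm_num) (by norm_num),
              mul_one]
    rw [← e] at h
    refine (ENNReal.mul_le_mul_iff_right hne ?_).1 h
    exact ENNReal.mul_ne_top (ENNReal.mul_ne_top (by norm_num) (by finiteness))
      (ENNReal.div_ne_top h₂' h₄)
  refine ⟨F₄ \ (E₁ ∪ E₂), Set.sdiff_subset, hF₄.diff (hE₁m.union hE₂m), ?_, ?_⟩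
  · have h1 : volume F₄ ≤ volume (F₄ \ (E₁ ∪ E₂)) + volume F₄ / 2 := by
      calc volume F₄ ≤ volume (F₄ \ (E₁ ∪ E₂)) + volume (E₁ ∪ E₂) := by
            refine (measure_mono ?_).trans (measure_union_le _ _)
            intro x hx
            by_cases h : x ∈ E₁ ∪ E₂
            · exact Or.inr h
            · exact Or.inl ⟨hx, h⟩
        _ ≤ volume (F₄ \ (E₁ ∪ E₂)) + (volume F₄ / 4 + volume F₄ / 4) := by
            gcongr
            exact (measure_union_le _ _).trans (add_le_add hv₁ hv₂)
        _ = _ := by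
            congr 1
            have h4 : (4 : ℝ≥0∞)⁻¹ + 4⁻¹ = 2⁻¹ := by
              have : (4 : ℝ≥0∞)⁻¹ = 2⁻¹ * 2⁻¹ := by
                rw [← ENNReal.mul_inv (by norm_num) (by norm_num)]; norm_num
              rw [this, ← mul_add, ENNReal.inv_two_add_inv_two, mul_one]
            rw [div_eq_mul_inv, div_eq_mul_inv, ← mul_add, h4]
    have h2 : volume F₄ / 2 ≠ ⊤ := ENNReal.div_ne_top h₄' (by norm_num)
    nth_rw 1 [← ENNReal.add_halves (volume F₄)] at h1
    exact (ENNReal.add_le_add_iff_right h2).1 h1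
  · intro x hx k hk u
    have hx1 : maxOne F₁ x ≤ 65 * schurConst * t₁ := not_lt.1 fun h => hx.2 (Or.inl h)
    have hx2 : maxTwo m F₁ F₂ x ≤ 2049 * (bumpConst * schurConst) * t₂ :=
      not_lt.1 fun h => hx.2 (Or.inr h)
    refine (sum_weight_le_max hk hF₁ hF₂ u x).trans (mul_le_mul' ?_ le_rfl)
    calc _ ≤ 36 ^ 5 * bumpConst *
          (65 * schurConst * t₁ * (2049 * (bumpConst * schurConst) * t₂)) := by gcongr
      _ = _ := by rw [ht₁, ht₂, weightConst]; ring

/-! ### Frequency annuli and almost orthogonality -/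

/-- The frequency annulus of the wave packets of scale `2^{-j}`. -/
def annulus (A : ℝ) (j : ℕ) : Set ℝ := {ξ | A⁻¹ * 2 ^ j ≤ |ξ| ∧ |ξ| ≤ A * 2 ^ j}

theorem measurableSet_annulus (A : ℝ) (j : ℕ) : MeasurableSet (annulus A j) :=
  (measurableSet_le (f := fun _ => A⁻¹ * 2 ^ j) (g := fun ξ : ℝ => |ξ|) measurable_const
    (by fun_prop)).inter (measurableSet_le (f := fun ξ : ℝ => |ξ|) (by fun_prop) measurable_const)

/-- If `a` is the first scale whose annulus contains `ξ`, any other scale `k` has `2^{3(k-a)} ≤ A^2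
< 2^N`. The point `ξ = 0` is left out because for `A = 0` every annulus contains it. -/
theorem exists_annulus_overlap (A : ℝ) : ∃ N : ℕ, ∀ (m : ℕ) (ξ : ℝ), ξ ≠ 0 →
    ∑' k : ℕ, (annulus A (m + 3 * k)).indicator (1 : ℝ → ℝ≥0∞) ξ ≤ N := by
  obtain ⟨N, hN⟩ := pow_unbounded_of_one_lt (A ^ 2) (one_lt_two : (1 : ℝ) < 2)
  refine ⟨N + 1, fun m ξ hξ => ?_⟩
  by_cases hex : ∃ k, ξ ∈ annulus A (m + 3 * k)
  · classical
    set a := Nat.find hex with ha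
    have hA : 0 < A := by
      obtain ⟨k, hk⟩ := hex
      have : 0 < A * 2 ^ (m + 3 * k) := (abs_pos.2 hξ).trans_le hk.2
      exact pos_of_mul_pos_left this (by positivity)
    have hle : ∀ k, ξ ∈ annulus A (m + 3 * k) → a ≤ k ∧ k ≤ a + N := by
      intro k hk
      have hak : a ≤ k := Nat.find_min' hex hk
      refine ⟨hak, ?_⟩
      by_contra! hlt
      have h1 := hk.1.trans (Nat.find_spec hex).2
      rw [← ha] at h1
      have h2 : (2 : ℝ) ^ (m + 3 * k) ≤ A ^ 2 * 2 ^ (m + 3 * a) := by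
        rw [inv_mul_le_iff₀ hA] at h1
        linarith
      have h3 : (2 : ℝ) ^ N * 2 ^ (m + 3 * a) ≤ 2 ^ (m + 3 * k) := by
        rw [← pow_add]
        exact pow_le_pow_right₀ (by norm_num) (by lia)
      have h4 : (0 : ℝ) < 2 ^ (m + 3 * a) := by positivity
      nlinarith
    calc _ ≤ ∑' k : ℕ, ((Finset.Icc a (a + N) : Finset ℕ) : Set ℕ).indicator (1 : ℕ → ℝ≥0∞) k := by
          refine ENNReal.tsum_le_tsum fun k => ?_
          by_cases hk : ξ ∈ annulus A (m + 3 * k)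
          · rw [Set.indicator_of_mem hk, Set.indicator_of_mem]
            · simp
            · simpa using hle k hk
          · rw [Set.indicator_of_notMem hk]; exact zero_le
      _ = ∑ k ∈ Finset.Icc a (a + N), 1 := by
          rw [← sum_eq_tsum_indicator]; simp
      _ ≤ _ := by
          simp only [Finset.sum_const, Nat.card_Icc, nsmul_eq_mul, mul_one]
          rw [show a + N + 1 - a = N + 1 by lia]
  · have : ∀ k, (annulus A (m + 3 * k)).indicator (1 : ℝ → ℝ≥0∞) ξ = 0 := fun k =>
      Set.indicator_of_notMem (fun hk => hex ⟨k, hk⟩) _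
    simp [this]

theorem IsWavePacket.norm_iteratedDeriv_le {A : ℝ} {D : ℕ → ℕ → ℝ} {j : ℕ} {w : ℝ} {φ : ℝ → ℂ}
    (h : IsWavePacket A D j w φ) (n N : ℕ) (x : ℝ) :
    ‖iteratedDeriv n φ x‖ ≤ D n N * (2 : ℝ) ^ ((j : ℝ) * (n + 1 / 2)) *
      ((1 + |2 ^ j * x - w|) ^ N)⁻¹ := by
  have h1 := h.decay n N x
  rw [← div_eq_mul_inv, le_div_iff₀ (by positivity)]
  linarith

/-- A wave packet as a Schwartz function. -/
noncomputable def IsWavePacket.toSchwartz {A : ℝ} {D : ℕ → ℕ → ℝ} {j : ℕ} {w : ℝ} {φ : ℝ → ℂ}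
    (h : IsWavePacket A D j w φ) : SchwartzMap ℝ ℂ where
  toFun := φ
  smooth' := h.contDiff
  decay' := by
    intro k n
    refine ⟨(1 + |w|) ^ k * (D n k * (2 : ℝ) ^ ((j : ℝ) * (n + 1 / 2))), fun x => ?_⟩
    rw [norm_iteratedFDeriv_eq_norm_iteratedDeriv]
    have h1 : ‖x‖ ≤ (1 + |w|) * (1 + |2 ^ j * x - w|) := by
      rw [Real.norm_eq_abs]
      have h2 : |x| ≤ |2 ^ j * x| := by
        rw [abs_mul, abs_of_pos (by positivity : (0 : ℝ) < 2 ^ j)]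
        exact le_mul_of_one_le_left (abs_nonneg _) (one_le_pow₀ (by norm_num))
      have h3 : |2 ^ j * x| ≤ |2 ^ j * x - w| + |w| := by
        have := abs_add_le (2 ^ j * x - w) w
        simpa using this
      nlinarith [abs_nonneg w, abs_nonneg (2 ^ j * x - w),
        mul_nonneg (abs_nonneg w) (abs_nonneg (2 ^ j * x - w))]
    calc _ ≤ ((1 + |w|) * (1 + |2 ^ j * x - w|)) ^ k * ‖iteratedDeriv n φ x‖ := by gcongr
      _ = (1 + |w|) ^ k * ((1 + |2 ^ j * x - w|) ^ k * ‖iteratedDeriv n φ x‖) := by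
          rw [mul_pow]; ring
      _ ≤ _ := by
          exact mul_le_mul_of_nonneg_left (h.decay n k x) (by positivity)

theorem IsWavePacket.coe_toSchwartz {A : ℝ} {D : ℕ → ℕ → ℝ} {j : ℕ} {w : ℝ} {φ : ℝ → ℂ}
    (h : IsWavePacket A D j w φ) : ⇑h.toSchwartz = φ := rfl

theorem inner_toLp_eq (φ : SchwartzMap ℝ ℂ) (f : Lp (α := ℝ) ℂ 2 volume) :
    inner ℂ (φ.toLp 2) f = ∫ x, f x * conj (φ x) := by
  rw [L2.inner_def]
  refine integral_congr_ae ?_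
  filter_upwards [φ.coeFn_toLp 2 volume] with x hx
  rw [hx]
  simp [RCLike.inner_apply]

theorem lintegral_enorm_sq_eq (f : Lp (α := ℝ) ℂ 2 volume) : ∫⁻ x, ‖f x‖ₑ ^ 2 = ‖f‖ₑ ^ 2 := by
  rw [Lp.enorm_def, eLpNorm_eq_lintegral_rpow_enorm_toReal (by norm_num) (by norm_num)]
  rw [← ENNReal.rpow_natCast, ← ENNReal.rpow_mul]
  simp

/-- Projections to frequency annuli reproduce all coefficients and are almost orthogonal. -/
theorem exists_frequency_projections (A : ℝ) : ∃ N : ℕ, ∀ (m : ℕ) (f : ℝ → ℂ), MemLp f 2 →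
    ∃ g : ℕ → ℝ → ℂ, (∀ k, Measurable (g k)) ∧
      ∑' k, ∫⁻ x, ‖g k x‖ₑ ^ 2 ≤ N * ∫⁻ x, ‖f x‖ₑ ^ 2 ∧
      ∀ (k : ℕ) (D : ℕ → ℕ → ℝ) (w : ℝ) (φ : ℝ → ℂ), IsWavePacket A D (m + 3 * k) w φ →
        ∫ x, f x * conj (φ x) = ∫ x, g k x * conj (φ x) := by
  obtain ⟨N, hN⟩ := exists_annulus_overlap A
  refine ⟨N, fun m f hf => ?_⟩
  set fL : Lp (α := ℝ) ℂ 2 volume := hf.toLp f with hfL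
  set E : ℕ → Set ℝ := fun k => annulus A (m + 3 * k) with hE
  have hEm : ∀ k, MeasurableSet (E k) := fun k => measurableSet_annulus _ _
  have hmem : ∀ k, MemLp ((E k).indicator (𝓕 fL : Lp (α := ℝ) ℂ 2 volume)) 2 :=
    fun k => (Lp.memLp (𝓕 fL)).indicator (hEm k)
  set hL : ℕ → Lp (α := ℝ) ℂ 2 volume := fun k => (hmem k).toLp _ with hhL
  set gL : ℕ → Lp (α := ℝ) ℂ 2 volume := fun k => 𝓕⁻ (hL k) with hgL
  have hsm : ∀ k, AEStronglyMeasurable (gL k) volume := fun k => (Lp.memLp (gL k)).1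
  refine ⟨fun k => (hsm k).mk _, fun k => (hsm k).stronglyMeasurable_mk.measurable, ?_, ?_⟩
  · have h1 : ∀ k, ∫⁻ x, ‖(hsm k).mk _ x‖ₑ ^ 2 =
        ∫⁻ x, (E k).indicator 1 x * ‖(𝓕 fL : Lp (α := ℝ) ℂ 2 volume) x‖ₑ ^ 2 := by
      intro k
      calc _ = ∫⁻ x, ‖gL k x‖ₑ ^ 2 := by
            refine lintegral_congr_ae ?_
            filter_upwards [(hsm k).ae_eq_mk] with x hx
            rw [hx]
        _ = ‖𝓕 (gL k)‖ₑ ^ 2 := by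
            rw [lintegral_enorm_sq_eq, ← ofReal_norm, ← ofReal_norm, Lp.norm_fourier_eq]
        _ = ∫⁻ x, ‖hL k x‖ₑ ^ 2 := by
            rw [lintegral_enorm_sq_eq, hgL, FourierTransform.fourier_fourierInv_eq]
        _ = _ := by
            refine lintegral_congr_ae ?_
            filter_upwards [(hmem k).coeFn_toLp] with x hx
            rw [hhL, hx]
            by_cases hxE : x ∈ E k <;> simp [hxE]
    have hFm : AEMeasurable (fun x => ‖(𝓕 fL : Lp (α := ℝ) ℂ 2 volume) x‖ₑ ^ 2) volume :=
      ((Lp.memLp (𝓕 fL)).1.enorm).pow_const 2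
    calc _ = ∑' k, ∫⁻ x, (E k).indicator 1 x * ‖(𝓕 fL : Lp (α := ℝ) ℂ 2 volume) x‖ₑ ^ 2 :=
          tsum_congr h1
      _ = ∫⁻ x, ∑' k, (E k).indicator 1 x * ‖(𝓕 fL : Lp (α := ℝ) ℂ 2 volume) x‖ₑ ^ 2 := by
          rw [lintegral_tsum]
          exact fun k => (measurable_one.indicator (hEm k)).aemeasurable.mul hFm
      _ ≤ ∫⁻ x, N * ‖(𝓕 fL : Lp (α := ℝ) ℂ 2 volume) x‖ₑ ^ 2 := by
          refine lintegral_mono_ae ?_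
          have h0 : ∀ᵐ x : ℝ, x ≠ 0 := by simp [ae_iff]
          filter_upwards [h0] with x hx
          rw [ENNReal.tsum_mul_right]
          gcongr
          exact hN m x hx
      _ = N * ∫⁻ x, ‖f x‖ₑ ^ 2 := by
          rw [lintegral_const_mul'' _ hFm, lintegral_enorm_sq_eq, ← ofReal_norm, Lp.norm_fourier_eq,
            ofReal_norm, ← lintegral_enorm_sq_eq]
          congr 1
          refine lintegral_congr_ae ?_
          filter_upwards [hf.coeFn_toLp] with x hx
          rw [hfL, hx]
  · intro k D w φ hφ
    -- The transform of the packet lives on `E k`, so by Plancherel cutting the transform of `f` to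
    -- `E k` does not change the pairing.
    have hsupp : ∀ ξ, ξ ∉ E k → 𝓕 hφ.toSchwartz ξ = 0 := by
      intro ξ hξ
      by_contra hne
      rw [SchwartzMap.fourier_coe] at hne
      exact hξ (hφ.fourier_support ξ hne)
    have h1 : inner ℂ (hφ.toSchwartz.toLp 2) fL = inner ℂ (hφ.toSchwartz.toLp 2) (gL k) := by
      rw [← Lp.inner_fourier_eq, ← Lp.inner_fourier_eq _ (gL k), SchwartzMap.toLp_fourier_eq, hgL,
        FourierTransform.fourier_fourierInv_eq, inner_toLp_eq, inner_toLp_eq]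
      refine integral_congr_ae ?_
      filter_upwards [(hmem k).coeFn_toLp] with x hx
      rw [hhL, hx]
      by_cases hxE : x ∈ E k
      · simp [hxE]
      · simp [hxE, hsupp x hxE]
    rw [inner_toLp_eq, inner_toLp_eq, hφ.coe_toSchwartz] at h1
    calc _ = ∫ x, fL x * conj (φ x) := by
          refine integral_congr_ae ?_
          filter_upwards [hf.coeFn_toLp] with x hx
          rw [hfL, hx]
      _ = _ := h1
      _ = _ := by
          refine integral_congr_ae ?_
          filter_upwards [(hsm k).ae_eq_mk] with x hx
          rw [hx]

/-! ### Size and cancellation of wave packet coefficients -/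

/-- The height `2^{j/2}` of an `L²`-normalized wave packet of scale `2^{-j}`. -/
noncomputable def height (j : ℕ) : ℝ≥0∞ := ENNReal.ofReal √(2 ^ j)

theorem height_mul_self (j : ℕ) : height j * height j = len (-(j : ℤ)) := by
  unfold height
  rw [← ENNReal.ofReal_mul (by positivity), Real.mul_self_sqrt (by positivity), len, neg_neg,
    zpow_natCast]

/-- The normalized wave packet coefficient with values in `[0, ∞]`. -/
noncomputable def ecoeff (Φ : ℕ → ℝ → ℝ → ℂ) (f : ℝ → ℂ) (j : ℕ) (w : ℝ) : ℝ≥0∞ :=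
  ‖∫ x : ℝ, f x * conj (Φ j w x)‖ₑ * height j

theorem ofReal_coeff (Φ : ℕ → ℝ → ℝ → ℂ) (f : ℝ → ℂ) (j : ℕ) (w : ℝ) :
    ENNReal.ofReal (coeff Φ f j w) = ecoeff Φ f j w := by
  unfold coeff ecoeff height
  rw [Real.sqrt_inv, div_inv_eq_mul, ENNReal.ofReal_mul (norm_nonneg _), ofReal_norm]

/-- The constant that governs the size and the first derivative of the wave packets. -/
noncomputable def packetConst (D : ℕ → ℕ → ℝ) : ℝ≥0∞ :=
  1 + ENNReal.ofReal (D 0 10) + 2 ^ 10 * ENNReal.ofReal (D 1 10)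

theorem packetConst_ne_top (D : ℕ → ℕ → ℝ) : packetConst D ≠ ⊤ := by
  unfold packetConst; finiteness

section WavePacket

variable {A : ℝ} {D : ℕ → ℕ → ℝ} {j : ℕ} {w : ℝ} {φ : ℝ → ℂ}

theorem two_rpow_half_eq (j : ℕ) : (2 : ℝ) ^ ((j : ℝ) * (1 / 2)) = √(2 ^ j) := by
  rw [Real.sqrt_eq_rpow, ← Real.rpow_natCast, ← Real.rpow_mul (by norm_num)]

theorem IsWavePacket.D_zero_nonneg (h : IsWavePacket A D j w φ) : 0 ≤ D 0 10 := by
  have h1 := h.decay 0 10 0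
  have h2 : (0 : ℝ) ≤ D 0 10 * (2 : ℝ) ^ ((j : ℝ) * ((0 : ℕ) + 1 / 2)) :=
    le_trans (by positivity) h1
  exact nonneg_of_mul_nonneg_left h2 (by positivity)

theorem IsWavePacket.D_one_nonneg (h : IsWavePacket A D j w φ) : 0 ≤ D 1 10 := by
  have h1 := h.decay 1 10 0
  have h2 : (0 : ℝ) ≤ D 1 10 * (2 : ℝ) ^ ((j : ℝ) * ((1 : ℕ) + 1 / 2)) :=
    le_trans (by positivity) h1
  exact nonneg_of_mul_nonneg_left h2 (by positivity)

theorem IsWavePacket.enorm_le (h : IsWavePacket A D j w φ) (x : ℝ) :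
    ‖φ x‖ₑ ≤ ENNReal.ofReal (D 0 10) * height j * rho 10 (x * 2 ^ (j : ℤ) - w) := by
  have h1 := h.norm_iteratedDeriv_le 0 10 x
  rw [iteratedDeriv_zero, Nat.cast_zero, zero_add, two_rpow_half_eq] at h1
  unfold height rho
  have hD := h.D_zero_nonneg
  rw [← ENNReal.ofReal_mul hD, ← ENNReal.ofReal_mul (by positivity), ← ofReal_norm, zpow_natCast,
    mul_comm x]
  exact ENNReal.ofReal_le_ofReal h1

theorem IsWavePacket.norm_deriv_le (h : IsWavePacket A D j w φ) (x : ℝ) :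
    ‖deriv φ x‖ ≤ D 1 10 * (2 ^ j * √(2 ^ j)) * ((1 + |x * 2 ^ j - w|) ^ 10)⁻¹ := by
  have h1 := h.norm_iteratedDeriv_le 1 10 x
  rw [iteratedDeriv_one] at h1
  have : (2 : ℝ) ^ ((j : ℝ) * ((1 : ℕ) + 1 / 2)) = 2 ^ j * √(2 ^ j) := by
    rw [← two_rpow_half_eq, mul_add, Real.rpow_add (by norm_num), Nat.cast_one, mul_one,
      Real.rpow_natCast]
  rwa [this, mul_comm (2 ^ j) x] at h1

theorem IsWavePacket.enorm_mul_height_le (h : IsWavePacket A D j w φ) (x : ℝ) :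
    ‖φ x‖ₑ * height j ≤ packetConst D * ker 10 j w x := by
  calc _ ≤ ENNReal.ofReal (D 0 10) * height j * rho 10 (x * 2 ^ (j : ℤ) - w) * height j := by
        gcongr; exact h.enorm_le x
    _ = ENNReal.ofReal (D 0 10) * (height j * height j * rho 10 (x * 2 ^ (j : ℤ) - w)) := by ring
    _ ≤ _ := by
        rw [height_mul_self]
        unfold ker
        gcongr
        unfold packetConst
        exact le_add_right le_add_self

theorem IsWavePacket.continuous (h : IsWavePacket A D j w φ) : Continuous φ := h.contDiff.continuous

theorem IsWavePacket.enorm_le_const (h : IsWavePacket A D j w φ) (x : ℝ) :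
    ‖φ x‖ₑ ≤ ENNReal.ofReal (D 0 10) * height j :=
  (h.enorm_le x).trans (mul_le_of_le_one_right' (rho_le_one _ _))

theorem IsWavePacket.integrable_mul_conj (h : IsWavePacket A D j w φ) {f : ℝ → ℂ}
    (hf : Integrable f) : Integrable fun x => f x * conj (φ x) := by
  refine hf.mul_bdd (c := (ENNReal.ofReal (D 0 10) * height j).toReal) ?_ ?_
  · exact (Complex.continuous_conj.comp h.continuous).aestronglyMeasurable
  · refine Filter.Eventually.of_forall fun x => ?_
    have hne : ENNReal.ofReal (D 0 10) * height j ≠ ⊤ := by unfold height; finiteness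
    rw [RCLike.norm_conj, ← toReal_enorm]
    exact ENNReal.toReal_mono hne (h.enorm_le_const x)

theorem IsWavePacket.enorm_setIntegral_le (h : IsWavePacket A D j w φ) (f : ℝ → ℂ) (S : Set ℝ) :
    ‖∫ x in S, f x * conj (φ x)‖ₑ * height j ≤
      packetConst D * ∫⁻ y in S, ‖f y‖ₑ * ker 10 j w y := by
  have hP := packetConst_ne_top D
  have hh : height j ≠ ⊤ := ENNReal.ofReal_ne_top
  calc _ ≤ (∫⁻ y in S, ‖f y * conj (φ y)‖ₑ) * height j := by
        gcongr; exact enorm_integral_le_lintegral_enorm _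
    _ = ∫⁻ y in S, ‖f y * conj (φ y)‖ₑ * height j := (lintegral_mul_const' _ _ hh).symm
    _ ≤ ∫⁻ y in S, packetConst D * (‖f y‖ₑ * ker 10 j w y) := by
        refine lintegral_mono fun y => ?_
        rw [enorm_mul, mul_assoc, mul_left_comm (packetConst D)]
        have : ‖conj (φ y)‖ₑ = ‖φ y‖ₑ := by simp [← ofReal_norm]
        rw [this]
        exact mul_le_mul' le_rfl (h.enorm_mul_height_le y)
    _ = _ := lintegral_const_mul' _ _ hP

/-- The coefficients of mean zero functions on short intervals are small. -/
theorem IsWavePacket.enorm_setIntegral_le_of_mean_zero (h : IsWavePacket A D j w φ) {f : ℝ → ℂ}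
    (hf : Integrable f) {S : Set ℝ} (hS : MeasurableSet S) {i n : ℤ}
    (hSi : S ⊆ {x | idx i x = n}) (h0 : ∫ x in S, f x = 0) :
    ‖∫ x in S, f x * conj (φ x)‖ₑ * height j ≤
      packetConst D * (min 1 (len (i - j)) * ∫⁻ y in S, ‖f y‖ₑ * ker 10 j w y) := by
  -- Cancellation helps only on intervals shorter than the scale of the packet; on longer ones the
  -- minimum is 1 and the trivial bound suffices.
  rcases le_or_gt (j : ℤ) i with hij | hij
  swap
  · have : (1 : ℝ≥0∞) ≤ len (i - j) := by rw [← len_zero]; exact len_anti (by lia)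
    rw [min_eq_left this, one_mul]
    exact h.enorm_setIntegral_le f S
  have hle : len (i - j) ≤ 1 := by rw [← len_zero]; exact len_anti (by lia)
  rw [min_eq_right hle]
  rcases S.eq_empty_or_nonempty with rfl | ⟨y₀, hy₀⟩
  · simp
  have hP := packetConst_ne_top D
  have hh : height j ≠ ⊤ := ENNReal.ofReal_ne_top
  have hcell : {x | idx i x = n} =
      Set.Ico ((n : ℝ) * 2 ^ (-i)) (((n : ℝ) + 1) * 2 ^ (-i)) := by
    ext x; exact idx_eq_iff
  have hdiff : ∀ y ∈ S, ‖φ y - φ y₀‖ₑ * height j ≤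
      packetConst D * (len (i - j) * ker 10 j w y) := by
    intro y hy
    have hD1 := h.D_one_nonneg
    set B : ℝ := D 1 10 * (2 ^ j * √(2 ^ j)) * (2 ^ 10 * ((1 + |y * 2 ^ j - w|) ^ 10)⁻¹) with hB
    have hBd : ∀ z ∈ {x | idx i x = n}, ‖deriv φ z‖ ≤ B := by
      intro z hz
      refine (h.norm_deriv_le z).trans ?_
      rw [hB]
      gcongr
      -- As `j ≤ i`, the cell of level `i` lies in one cell of level `j`. The brackets at `z` and
      -- `y` agree up to a factor 2, hence the `2^10` in `B`.
      have hzy : idx j z = idx j y := idx_eq_of_le hij ((hSi hy).symm ▸ hz : idx i z = idx i y)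
      have h1 : |z * (2 : ℝ) ^ (j : ℤ) - y * 2 ^ (j : ℤ)| < 1 :=
        Int.abs_sub_lt_one_of_floor_eq_floor hzy
      rw [zpow_natCast] at h1
      have h2 : |y * 2 ^ j - w| ≤ |z * 2 ^ j - w| + 1 := by
        have := abs_sub (z * 2 ^ j - w) (z * 2 ^ j - y * 2 ^ j)
        rw [show z * 2 ^ j - w - (z * 2 ^ j - y * 2 ^ j) = y * 2 ^ j - w by ring] at this
        linarith
      rw [inv_le_iff_one_le_mul₀ (by positivity), mul_assoc, mul_comm, mul_assoc, inv_mul_eq_div,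
        one_le_div (by positivity), ← mul_pow]
      gcongr
      linarith [abs_nonneg (z * 2 ^ j - w)]
    have h3 : ‖φ y - φ y₀‖ ≤ B * ‖y - y₀‖ := by
      refine Convex.norm_image_sub_le_of_norm_deriv_le (s := {x | idx i x = n})
        (fun z _ => (h.contDiff.differentiable (by simp)).differentiableAt) hBd ?_ (hSi hy₀) (hSi hy)
      rw [hcell]; exact convex_Ico _ _
    have h4 : ‖y - y₀‖ ≤ 2 ^ (-i) := by
      have hy1 := hSi hy
      have hy2 := hSi hy₀
      rw [hcell] at hy1 hy2
      rw [Real.norm_eq_abs, abs_le]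
      have e : ((n : ℝ) + 1) * 2 ^ (-i) = n * 2 ^ (-i) + 2 ^ (-i) := by ring
      rw [e] at hy1 hy2
      constructor <;> linarith [hy1.1, hy1.2, hy2.1, hy2.2]
    have h5 : ‖φ y - φ y₀‖ₑ ≤ ENNReal.ofReal (B * 2 ^ (-i)) := by
      rw [← ofReal_norm]
      refine ENNReal.ofReal_le_ofReal (h3.trans ?_)
      gcongr
    calc _ ≤ ENNReal.ofReal (B * 2 ^ (-i)) * height j := by gcongr
      _ = 2 ^ 10 * ENNReal.ofReal (D 1 10) * (len (i - j) * ker 10 j w y) := by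
          have e1 : len (i - j) * ker 10 j w y =
              len i * len (-(j : ℤ)) * (height j * height j) * rho 10 (y * 2 ^ (j : ℤ) - w) := by
            unfold ker
            rw [sub_eq_add_neg, len_add, height_mul_self]; ring
          have e2 : ENNReal.ofReal (B * 2 ^ (-i)) = ENNReal.ofReal (D 1 10) *
              (len (-(j : ℤ)) * height j) * (2 ^ 10 * rho 10 (y * 2 ^ (j : ℤ) - w)) * len i := by
            rw [hB]
            unfold height rho len
            rw [ENNReal.ofReal_mul (by positivity), ENNReal.ofReal_mul (by positivity),
              ENNReal.ofReal_mul hD1, ENNReal.ofReal_mul (by positivity),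
              ENNReal.ofReal_mul (by positivity)]
            simp
          rw [e1, e2]; ring
      _ ≤ _ := by
          gcongr
          unfold packetConst
          exact le_add_self
  -- Mean zero permits subtracting the value of the packet at `y₀`. The difference gains the ratio
  -- `2^{j-i}` of the two lengths.
  have heq : ∫ x in S, f x * conj (φ x) = ∫ x in S, f x * conj (φ x - φ y₀) := by
    have h1 : ∫ x in S, f x * conj (φ y₀) = 0 := by
      rw [integral_mul_const, h0, zero_mul]
    rw [← sub_zero (∫ x in S, f x * conj (φ x)), ← h1, ← integral_sub
      (h.integrable_mul_conj hf).integrableOn (hf.mul_const _).integrableOn]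
    congr 1
    ext x
    rw [map_sub]; ring
  rw [heq]
  calc _ ≤ (∫⁻ y in S, ‖f y * conj (φ y - φ y₀)‖ₑ) * height j := by
        gcongr; exact enorm_integral_le_lintegral_enorm _
    _ = ∫⁻ y in S, ‖f y * conj (φ y - φ y₀)‖ₑ * height j := (lintegral_mul_const' _ _ hh).symm
    _ ≤ ∫⁻ y in S, packetConst D * len (i - j) * (‖f y‖ₑ * ker 10 j w y) := by
        refine setLIntegral_mono' hS fun y hy => ?_
        rw [enorm_mul, mul_assoc, mul_left_comm (packetConst D * _), mul_assoc (packetConst D)]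
        have : ‖conj (φ y - φ y₀)‖ₑ = ‖φ y - φ y₀‖ₑ := by
          rw [← ofReal_norm, RCLike.norm_conj, ofReal_norm]
        rw [this]
        exact mul_le_mul' le_rfl (hdiff y hy)
    _ = _ := by
        rw [lintegral_const_mul' _ _ (ENNReal.mul_ne_top hP (len_ne_top _)), mul_assoc]

end WavePacket

/-! ### Weighted Cauchy–Schwarz, and moments of sums over scales -/

theorem sq_lintegral_mul_le {α : Type*} [MeasurableSpace α] {μ : Measure α} {f k : α → ℝ≥0∞}
    (hf : AEMeasurable f μ) (hk : AEMeasurable k μ) :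
    (∫⁻ x, f x * k x ∂μ) ^ 2 ≤ (∫⁻ x, f x ^ 2 * k x ∂μ) * ∫⁻ x, k x ∂μ := by
  have h := ENNReal.lintegral_mul_le_Lp_mul_Lq μ Real.HolderConjugate.two_two
    (f := fun x => f x * k x ^ (1 / 2 : ℝ)) (g := fun x => k x ^ (1 / 2 : ℝ))
    (hf.mul (hk.pow_const _)) (hk.pow_const _)
  have e1 : ∀ x, k x ^ (1 / 2 : ℝ) * k x ^ (1 / 2 : ℝ) = k x := fun x => by
    rw [← ENNReal.rpow_add_of_nonneg _ _ (by norm_num) (by norm_num)]; norm_num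
  have e2 : ∀ x, (k x ^ (1 / 2 : ℝ)) ^ (2 : ℝ) = k x := fun x => by
    rw [← ENNReal.rpow_mul]; norm_num
  have e3 : ∀ a : ℝ≥0∞, (a ^ (1 / 2 : ℝ)) ^ 2 = a := fun a => by
    rw [← ENNReal.rpow_natCast, ← ENNReal.rpow_mul]; norm_num
  simp only [Pi.mul_apply, mul_assoc, e1, ENNReal.mul_rpow_of_nonneg _ _ (zero_le_two (α := ℝ)), e2,
    ENNReal.rpow_two] at h
  calc _ ≤ _ := pow_le_pow_left' h 2
    _ = _ := by rw [mul_pow, e3, e3]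

theorem sq_sum_mul_le {ι : Type*} (P : Finset ι) (f k : ι → ℝ≥0∞) :
    (∑ p ∈ P, f p * k p) ^ 2 ≤ (∑ p ∈ P, f p ^ 2 * k p) * ∑ p ∈ P, k p := by
  let _ : MeasurableSpace ι := ⊤
  have := sq_lintegral_mul_le (μ := Measure.count.restrict (P : Set ι)) (f := f) (k := k)
    (by fun_prop) (by fun_prop)
  simpa [lintegral_finset] using this

section JohnNirenberg

/-- The mean value bound for `x ↦ x^(q+1)` between `t` and `a + t`, written without subtraction. -/
theorem add_pow_succ_le (a t : ℝ≥0∞) (q : ℕ) :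
    (a + t) ^ (q + 1) ≤ (q + 1) * (a * (a + t) ^ q) + t ^ (q + 1) := by
  induction q with
  | zero => simp
  | succ q ih =>
    calc (a + t) ^ (q + 1 + 1) = a * (a + t) ^ (q + 1) + t * (a + t) ^ (q + 1) := by ring
      _ ≤ a * (a + t) ^ (q + 1) + t * ((q + 1) * (a * (a + t) ^ q) + t ^ (q + 1)) := by gcongr
      _ = a * (a + t) ^ (q + 1) + (q + 1) * (a * (a + t) ^ q * t) + t ^ (q + 1 + 1) := by ring
      _ ≤ a * (a + t) ^ (q + 1) + (q + 1) * (a * (a + t) ^ q * (a + t)) + t ^ (q + 1 + 1) := by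
          gcongr; exact le_add_self
      _ = _ := by push_cast; ring

/-- Telescoping of the `(q+1)`-st powers of the tails. It isolates the coarsest scale of each
product, so that all finer ones are grouped in a tail. -/
theorem tsum_pow_succ_le {a : ℕ → ℝ≥0∞} (ha : ∑' k, a k ≠ ⊤) (q : ℕ) :
    (∑' k, a k) ^ (q + 1) ≤ (q + 1) * ∑' k, a k * (∑' i, a (i + k)) ^ q := by
  set tail : ℕ → ℝ≥0∞ := fun k => ∑' i, a (i + k) with htail
  have hrec : ∀ k, tail k = a k + tail (k + 1) := by
    intro k
    simp only [htail]
    rw [tsum_eq_zero_add' (f := fun i => a (i + k)) ENNReal.summable]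
    simp only [zero_add]
    congr 1
    refine tsum_congr fun i => ?_
    congr 1; lia
  have hfin : ∀ N : ℕ, tail 0 ^ (q + 1) ≤
      (q + 1) * ∑ k ∈ Finset.range N, a k * tail k ^ q + tail N ^ (q + 1) := by
    intro N
    induction N with
    | zero => simp
    | succ N ih =>
      refine ih.trans ?_
      rw [Finset.sum_range_succ, mul_add, add_assoc]
      gcongr
      have := add_pow_succ_le (a N) (tail (N + 1)) q
      rwa [← hrec] at this
  -- Finiteness of the sum is used here: the tails tend to 0, so the boundary term of the
  -- telescoping disappears.
  have hlim : Filter.Tendsto (fun N => (q + 1 : ℝ≥0∞) * ∑' k, a k * tail k ^ q + tail N ^ (q + 1))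
      Filter.atTop (nhds ((q + 1) * ∑' k, a k * tail k ^ q + 0)) := by
    refine Filter.Tendsto.add tendsto_const_nhds ?_
    have h1 := ENNReal.tendsto_sum_nat_add a ha
    have h2 := ((ENNReal.continuous_pow (q + 1)).tendsto 0).comp h1
    simpa [Function.comp_def] using h2
  rw [add_zero] at hlim
  have h0 : ∑' k, a k = tail 0 := by simp [htail]
  rw [h0]
  refine ge_of_tendsto' hlim fun N => (hfin N).trans ?_
  gcongr
  exact ENNReal.sum_le_tsum _

variable {m s : ℕ} {b : ℕ → ℤ → ℝ≥0∞} {Γ : ℝ≥0∞}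

/-- The part of a sum over scales with scale parameter at least `k₀`. -/
noncomputable def tailSum (m s : ℕ) (b : ℕ → ℤ → ℝ≥0∞) (k₀ : ℕ) (x : ℝ) : ℝ≥0∞ :=
  ∑' k, b (k + k₀) (idx (lev m s (k + k₀)) x)

theorem measurable_comp_idx (h : ℤ → ℝ≥0∞) (j : ℤ) : Measurable fun x => h (idx j x) :=
  (measurable_of_countable h).comp (measurable_idx j)

theorem measurable_tailSum (k₀ : ℕ) : Measurable (tailSum m s b k₀) :=
  Measurable.tsum fun _ => measurable_comp_idx _ _

/-- A function constant on cells sees `g` only through its cell averages, which are at most `c`. -/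
theorem setLIntegral_comp_idx_mul_le {j : ℤ} {h : ℤ → ℝ≥0∞} {g : ℝ → ℝ≥0∞} (hg : Measurable g)
    {c : ℝ≥0∞} (hc : ∀ v, ∫⁻ x in {x | idx j x = v}, g x ≤ c * len j) {S : Set ℝ}
    (hS : MeasurableSet S) (hSj : ∀ x y, idx j x = idx j y → x ∈ S → y ∈ S) :
    ∫⁻ x in S, h (idx j x) * g x ≤ c * ∫⁻ x in S, h (idx j x) := by
  calc _ = ∫⁻ x in S, cellAvg (fun z => g z * h (idx j z)) j x := by
        rw [setLIntegral_cellAvg _ j hS hSj]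
        simp_rw [mul_comm]
    _ ≤ ∫⁻ x in S, c * h (idx j x) := by
        refine lintegral_mono fun x => ?_
        rw [cellAvg_mul_comp_idx hg]
        gcongr
        unfold cellAvg
        calc _ ≤ len (-j) * (c * len j) := by gcongr; exact hc _
          _ = c * (len (-j) * len j) := by ring
          _ = c := by rw [len_neg_mul, mul_one]
    _ = _ := lintegral_const_mul _ (measurable_comp_idx _ _)

theorem lev_mono (m s : ℕ) {k k' : ℕ} (h : k ≤ k') : lev m s k ≤ lev m s k' := by
  unfold lev
  have : (s : ℤ) * k ≤ s * k' := by gcongr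
  lia

/-- The term of scale `k` is constant on cells of level `lev m s k`, while the tail attached to it
has controlled `q`-th moment on each such cell. The `(q+1)`-st moment thus reduces to the first. -/
theorem setLIntegral_tailSum_pow_le {q : ℕ} {c : ℝ≥0∞}
    (hc : ∀ k v, ∫⁻ x in {x | idx (lev m s k) x = v}, tailSum m s b k x ^ q ≤ c * len (lev m s k))
    (k₀ : ℕ) (hfin : ∀ᵐ x, tailSum m s b k₀ x ≠ ⊤) {S : Set ℝ} (hS : MeasurableSet S)
    (hSj : ∀ x y, idx (lev m s k₀) x = idx (lev m s k₀) y → x ∈ S → y ∈ S) :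
    ∫⁻ x in S, tailSum m s b k₀ x ^ (q + 1) ≤ (q + 1) * c * ∫⁻ x in S, tailSum m s b k₀ x := by
  have hm : ∀ k, Measurable fun x => b (k + k₀) (idx (lev m s (k + k₀)) x) *
      tailSum m s b (k + k₀) x ^ q := fun k =>
    (measurable_comp_idx _ _).mul ((measurable_tailSum _).pow_const q)
  calc _ ≤ ∫⁻ x in S, (q + 1) * ∑' k, b (k + k₀) (idx (lev m s (k + k₀)) x) *
        tailSum m s b (k + k₀) x ^ q := by
        refine lintegral_mono_ae ?_
        filter_upwards [ae_restrict_of_ae hfin] with x hx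
        refine (tsum_pow_succ_le hx q).trans (le_of_eq ?_)
        congr 1
        refine tsum_congr fun k => ?_
        congr 2
        unfold tailSum
        refine tsum_congr fun i => ?_
        rw [add_assoc]
    _ = (q + 1) * ∑' k, ∫⁻ x in S, b (k + k₀) (idx (lev m s (k + k₀)) x) *
        tailSum m s b (k + k₀) x ^ q := by
        rw [lintegral_const_mul _ (Measurable.tsum hm), lintegral_tsum fun k => (hm k).aemeasurable]
    _ ≤ (q + 1) * ∑' k, c * ∫⁻ x in S, b (k + k₀) (idx (lev m s (k + k₀)) x) := by
        gcongr with k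
        refine setLIntegral_comp_idx_mul_le ((measurable_tailSum _).pow_const q)
          (hc (k + k₀)) hS fun x y hxy => hSj x y ?_
        exact idx_eq_of_le (lev_mono m s (by lia)) hxy
    _ = _ := by
        rw [ENNReal.tsum_mul_left, ← lintegral_tsum fun k => (measurable_comp_idx _ _).aemeasurable]
        unfold tailSum
        ring

theorem setLIntegral_tailSum_pow_le_factorial
    (hΓ : ∀ k v, ∫⁻ x in {x | idx (lev m s k) x = v}, tailSum m s b k x ≤ Γ * len (lev m s k))
    (hfin : ∀ k, ∀ᵐ x, tailSum m s b k x ≠ ⊤) (q k : ℕ) (v : ℤ) :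
    ∫⁻ x in {x | idx (lev m s k) x = v}, tailSum m s b k x ^ q ≤
      q.factorial * Γ ^ q * len (lev m s k) := by
  induction q generalizing k v with
  | zero => simp [volume_idx_eq]
  | succ q ih =>
    refine (setLIntegral_tailSum_pow_le ih k (hfin k) (measurableSet_idx_eq _ v)
      (fun x y hxy hx => hxy.symm.trans hx)).trans ?_
    calc _ ≤ (q + 1) * (q.factorial * Γ ^ q) * (Γ * len (lev m s k)) := by
          gcongr; exact hΓ k v
      _ = _ := by rw [Nat.factorial_succ]; push_cast; ring

/-- A Carleson condition bounds all moments of a sum over scales by its first moment. -/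
theorem lintegral_tailSum_pow_le
    (hΓ : ∀ k v, ∫⁻ x in {x | idx (lev m s k) x = v}, tailSum m s b k x ≤ Γ * len (lev m s k))
    (hfin : ∀ k, ∀ᵐ x, tailSum m s b k x ≠ ⊤) (q : ℕ) :
    ∫⁻ x, tailSum m s b 0 x ^ (q + 1) ≤
      (q + 1).factorial * Γ ^ q * ∫⁻ x, tailSum m s b 0 x := by
  have := setLIntegral_tailSum_pow_le
    (setLIntegral_tailSum_pow_le_factorial hΓ hfin q) 0 (hfin 0) MeasurableSet.univ
    (fun _ _ _ _ => Set.mem_univ _)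
  rw [Measure.restrict_univ] at this
  refine this.trans (le_of_eq ?_)
  rw [Nat.factorial_succ]; push_cast; ring

end JohnNirenberg

/-! ### The weighted operator on `f₄` and its `L²` bound -/

section Operator

/-- Weights of the shifts with total mass at most `K` over each dyadic interval. -/
structure AdmissibleWeight (m : ℕ) (K : ℝ≥0∞) (W : ℕ → ℤ → ℕ → ℝ≥0∞) : Prop where
  sum_le : ∀ k u, ∑ p ∈ shiftRange m, W k u p ≤ K
  eq_zero : ∀ k u p, k < m → W k u p = 0

/-- The weighted average over the shifts of the coefficients of the third function. -/
noncomputable def scaleOp (Φ : ℕ → ℝ → ℝ → ℂ) (m : ℕ) (W : ℕ → ℤ → ℕ → ℝ≥0∞) (f : ℝ → ℂ) (k : ℕ)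
    (v : ℤ) : ℝ≥0∞ :=
  ∑ p ∈ shiftRange m, W k (v / 2 ^ k) p *
    ecoeff Φ f (m + 3 * k) ((v : ℝ) - (p : ℝ) ^ 3 / 2 ^ (2 * m))

/-- The kernel that dominates `scaleOp`. -/
noncomputable def scaleKer (m : ℕ) (W : ℕ → ℤ → ℕ → ℝ≥0∞) (k : ℕ) (v : ℤ) (y : ℝ) : ℝ≥0∞ :=
  avgKernel 10 (lev m 3 k) (shiftRange m) (W k (v / 2 ^ k)) (fun p => (p : ℝ) ^ 3 / 2 ^ (2 * m)) v y

theorem natCast_level (m k : ℕ) : ((m + 3 * k : ℕ) : ℤ) = lev m 3 k := by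
  unfold lev; push_cast; ring

variable {m : ℕ} {K : ℝ≥0∞} {W : ℕ → ℤ → ℕ → ℝ≥0∞} {A : ℝ} {D : ℕ → ℕ → ℝ} {Φ : ℕ → ℝ → ℝ → ℂ}

/-- The Schur sum over `v` needs `m ≤ k`, since the shifts must be short compared with the parents;
for `k < m` the weights vanish by assumption. -/
theorem AdmissibleWeight.kernelBound (hW : AdmissibleWeight m K W) :
    KernelBound m 3 (schurConst * K) (scaleKer m W) := by
  refine ⟨fun k v => measurable_avgKernel _ _ _ _ _ _, fun k v => ?_, fun k y => ?_⟩
  · exact lintegral_avgKernel_jb_le (fun p hp => abs_cube_shift_le hp) (hW.sum_le k _)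
      (by norm_num) _ _
  · by_cases h : m ≤ k
    · exact tsum_avgKernel_jb_le h (fun p hp => abs_cube_shift_le hp) (hW.sum_le k)
        (by norm_num) _ _
    · have : ∀ v, scaleKer m W k v y = 0 := by
        intro v
        unfold scaleKer avgKernel
        exact Finset.sum_eq_zero fun p _ => by rw [hW.eq_zero k _ p (by lia), zero_mul]
      simp [this]

theorem ecoeff_le (hΦ : ∀ j w, IsWavePacket A D j w (Φ j w)) (f : ℝ → ℂ) (j : ℕ) (w : ℝ) :
    ecoeff Φ f j w ≤ packetConst D * ∫⁻ y, ‖f y‖ₑ * ker 10 j w y := by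
  have := (hΦ j w).enorm_setIntegral_le f Set.univ
  rwa [Measure.restrict_univ] at this

theorem lintegral_mul_scaleKer {G : ℝ → ℝ≥0∞} (hG : Measurable G) (k : ℕ) (v : ℤ) (S : Set ℝ) :
    ∫⁻ y in S, G y * scaleKer m W k v y = ∑ p ∈ shiftRange m, W k (v / 2 ^ k) p *
      ∫⁻ y in S, G y * ker 10 (lev m 3 k) ((v : ℝ) - (p : ℝ) ^ 3 / 2 ^ (2 * m)) y := by
  unfold scaleKer avgKernel
  simp_rw [Finset.mul_sum, mul_left_comm (G _)]
  have hm : ∀ p : ℕ, Measurable fun y =>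
      G y * ker 10 (lev m 3 k) ((v : ℝ) - (p : ℝ) ^ 3 / 2 ^ (2 * m)) y :=
    fun p => hG.mul (measurable_ker _ _ _)
  rw [lintegral_finsetSum _ (fun p _ => (hm p).const_mul _)]
  exact Finset.sum_congr rfl fun p _ => lintegral_const_mul _ (hm p)

theorem scaleOp_le_lintegral (hΦ : ∀ j w, IsWavePacket A D j w (Φ j w)) {f : ℝ → ℂ}
    (hf : Measurable f) (k : ℕ) (v : ℤ) :
    scaleOp Φ m W f k v ≤ packetConst D * ∫⁻ y, ‖f y‖ₑ * scaleKer m W k v y := by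
  have h := lintegral_mul_scaleKer (m := m) (W := W) hf.enorm k v Set.univ
  rw [Measure.restrict_univ] at h
  rw [h, Finset.mul_sum]
  refine Finset.sum_le_sum fun p _ => ?_
  rw [mul_left_comm]
  gcongr
  have := ecoeff_le hΦ f (m + 3 * k) ((v : ℝ) - (p : ℝ) ^ 3 / 2 ^ (2 * m))
  rwa [natCast_level] at this

theorem scaleOp_add_le (hΦ : ∀ j w, IsWavePacket A D j w (Φ j w)) {f g : ℝ → ℂ}
    (hf : Integrable f) (hg : Integrable g) (k : ℕ) (v : ℤ) :
    scaleOp Φ m W (f + g) k v ≤ scaleOp Φ m W f k v + scaleOp Φ m W g k v := by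
  unfold scaleOp
  rw [← Finset.sum_add_distrib]
  refine Finset.sum_le_sum fun p _ => ?_
  rw [← mul_add]
  gcongr
  unfold ecoeff
  set φ := Φ (m + 3 * k) ((v : ℝ) - (p : ℝ) ^ 3 / 2 ^ (2 * m))
  have hφ : IsWavePacket A D (m + 3 * k) ((v : ℝ) - (p : ℝ) ^ 3 / 2 ^ (2 * m)) φ := hΦ _ _
  rw [← add_mul]
  gcongr
  have : ∫ x, (f + g) x * conj (φ x) = (∫ x, f x * conj (φ x)) + ∫ x, g x * conj (φ x) := by
    rw [← integral_add (hφ.integrable_mul_conj hf) (hφ.integrable_mul_conj hg)]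
    congr 1
    ext x
    simp [add_mul]
  rw [this]
  exact enorm_add_le _ _

/-- At scale `k`, `f` may be replaced by its frequency projection `g k`. Cauchy–Schwarz in the space
variable and in `p`, then Schur's test, bound the scale by `K² ‖g k‖₂²`; almost orthogonality sums
over `k`. No cancellation between different `p` is used. -/
theorem exists_scaleOp_l2_bound (A : ℝ) (D : ℕ → ℕ → ℝ) : ∃ C : ℝ≥0∞, C ≠ ⊤ ∧
    ∀ (Φ : ℕ → ℝ → ℝ → ℂ) (_ : ∀ j w, IsWavePacket A D j w (Φ j w)) (m : ℕ) (K : ℝ≥0∞)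
      (W : ℕ → ℤ → ℕ → ℝ≥0∞) (_ : AdmissibleWeight m K W) (f : ℝ → ℂ), MemLp f 2 →
      ∫⁻ x, ∑' k, scaleOp Φ m W f k (idx (lev m 3 k) x) ^ 2 ≤ C * K ^ 2 * ∫⁻ x, ‖f x‖ₑ ^ 2 := by
  obtain ⟨N, hN⟩ := exists_frequency_projections A
  refine ⟨packetConst D ^ 2 * bumpConst * schurConst * N, ?_, ?_⟩
  · have h1 := packetConst_ne_top D
    have h2 := bumpConst_ne_top
    have h3 := schurConst_ne_top
    finiteness
  intro Φ hΦ m K W hW f hf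
  obtain ⟨g, hgm, hgsum, hg⟩ := hN m f hf
  have hpt : ∀ k v, scaleOp Φ m W f k v ^ 2 ≤
      K * (packetConst D ^ 2 * bumpConst) * ∫⁻ y, ‖g k y‖ₑ ^ 2 * scaleKer m W k v y := by
    intro k v
    have hco : ∀ w, ecoeff Φ f (m + 3 * k) w ^ 2 ≤
        packetConst D ^ 2 * bumpConst * ∫⁻ y, ‖g k y‖ₑ ^ 2 * ker 10 (lev m 3 k) w y := by
      intro w
      have e : ecoeff Φ f (m + 3 * k) w = ecoeff Φ (g k) (m + 3 * k) w := by
        unfold ecoeff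
        rw [hg k D w _ (hΦ _ w)]
      rw [e]
      calc _ ≤ (packetConst D * ∫⁻ y, ‖g k y‖ₑ * ker 10 (m + 3 * k : ℕ) w y) ^ 2 := by
            gcongr; exact ecoeff_le hΦ _ _ _
        _ ≤ packetConst D ^ 2 * ((∫⁻ y, ‖g k y‖ₑ ^ 2 * ker 10 (m + 3 * k : ℕ) w y) *
              ∫⁻ y, ker 10 (m + 3 * k : ℕ) w y) := by
            rw [mul_pow]
            gcongr
            exact sq_lintegral_mul_le (hgm k).enorm.aemeasurable (measurable_ker _ _ _).aemeasurable
        _ ≤ packetConst D ^ 2 * ((∫⁻ y, ‖g k y‖ₑ ^ 2 * ker 10 (m + 3 * k : ℕ) w y) *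
              bumpConst) := by
            gcongr; exact lintegral_ker_le (by norm_num) _ _
        _ = _ := by rw [natCast_level]; ring
    have h := lintegral_mul_scaleKer (m := m) (W := W) ((hgm k).enorm.pow_const 2) k v Set.univ
    rw [Measure.restrict_univ] at h
    rw [h]
    unfold scaleOp
    simp_rw [mul_comm (W k (v / 2 ^ k) _)]
    refine (sq_sum_mul_le _ _ _).trans ?_
    rw [mul_comm (∑ p ∈ _, _), mul_assoc K]
    refine mul_le_mul' (hW.sum_le k _) ?_
    rw [Finset.mul_sum]
    refine Finset.sum_le_sum fun p _ => ?_
    rw [← mul_assoc]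
    exact mul_le_mul' (hco _) le_rfl
  have hk : ∀ k, ∫⁻ x, scaleOp Φ m W f k (idx (lev m 3 k) x) ^ 2 ≤
      K * (packetConst D ^ 2 * bumpConst) * (schurConst * K) * ∫⁻ y, ‖g k y‖ₑ ^ 2 := by
    intro k
    rw [lintegral_comp_idx (lev m 3 k) (fun v => scaleOp Φ m W f k v ^ 2)]
    have hmk : ∀ v : ℤ, Measurable fun y => ‖g k y‖ₑ ^ 2 * scaleKer m W k v y :=
      fun v => ((hgm k).enorm.pow_const 2).mul (hW.kernelBound.meas k v)
    calc _ ≤ len (lev m 3 k) * ∑' v, K * (packetConst D ^ 2 * bumpConst) *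
          ∫⁻ y, ‖g k y‖ₑ ^ 2 * scaleKer m W k v y := by
          gcongr with v
          exact hpt k v
      _ = K * (packetConst D ^ 2 * bumpConst) * ∫⁻ y, ‖g k y‖ₑ ^ 2 *
            (len (lev m 3 k) * ∑' v, scaleKer m W k v y) := by
          rw [ENNReal.tsum_mul_left, ← lintegral_tsum fun v => (hmk v).aemeasurable]
          simp_rw [mul_left_comm _ (len (lev m 3 k))]
          rw [lintegral_const_mul' _ _ (len_ne_top _), mul_left_comm]
          congr 3
          ext y
          rw [ENNReal.tsum_mul_left]
      _ ≤ K * (packetConst D ^ 2 * bumpConst) * ∫⁻ y, ‖g k y‖ₑ ^ 2 * (schurConst * K) := by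
          gcongr 1
          exact lintegral_mono fun y => mul_le_mul' le_rfl (hW.kernelBound.tsum_le k y)
      _ = _ := by rw [lintegral_mul_const _ ((hgm k).enorm.pow_const 2)]; ring
  calc _ = ∑' k, ∫⁻ x, scaleOp Φ m W f k (idx (lev m 3 k) x) ^ 2 :=
        lintegral_tsum fun k =>
          (measurable_comp_idx (fun v => scaleOp Φ m W f k v ^ 2) _).aemeasurable
    _ ≤ ∑' k, K * (packetConst D ^ 2 * bumpConst) * (schurConst * K) * ∫⁻ y, ‖g k y‖ₑ ^ 2 :=
        ENNReal.tsum_le_tsum hk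
    _ ≤ K * (packetConst D ^ 2 * bumpConst) * (schurConst * K) * (N * ∫⁻ x, ‖f x‖ₑ ^ 2) := by
        rw [ENNReal.tsum_mul_left]
        gcongr
    _ = _ := by ring

end Operator

/-! ### The Carleson condition -/

theorem add_sq_le_four (a b : ℝ≥0∞) : (a + b) ^ 2 ≤ 4 * a ^ 2 + 4 * b ^ 2 := by
  rcases le_total a b with h | h
  · calc (a + b) ^ 2 ≤ (b + b) ^ 2 := by gcongr
      _ = 4 * b ^ 2 := by ring
      _ ≤ _ := le_add_self
  · calc (a + b) ^ 2 ≤ (a + a) ^ 2 := by gcongr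
      _ = 4 * a ^ 2 := by ring
      _ ≤ _ := le_self_add

theorem memLp_two_of_integrable_of_bound {f : ℝ → ℂ} (hf : Integrable f) {B : ℝ}
    (hB : ∀ᵐ x, ‖f x‖ ≤ B) : MemLp f 2 := by
  rw [memLp_two_iff_integrable_sq_norm hf.1]
  refine (hf.norm.const_mul B).mono' (hf.1.norm.pow 2) ?_
  filter_upwards [hB] with x hx
  rw [Real.norm_eq_abs, abs_of_nonneg (by positivity), pow_two]
  gcongr

theorem tailSum_le_zero (m s : ℕ) (b : ℕ → ℤ → ℝ≥0∞) (k : ℕ) (x : ℝ) :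
    tailSum m s b k x ≤ tailSum m s b 0 x :=
  ENNReal.tsum_comp_le_tsum_of_injective (add_left_injective k)
    (fun k => b (k + 0) (idx (lev m s (k + 0)) x))

/-- The squares of the coefficients of the operator at all scales. -/
noncomputable def scaleSq (Φ : ℕ → ℝ → ℝ → ℂ) (m : ℕ) (W : ℕ → ℤ → ℕ → ℝ≥0∞) (f : ℝ → ℂ) (k : ℕ)
    (v : ℤ) : ℝ≥0∞ := scaleOp Φ m W f k v ^ 2

variable {m : ℕ} {K : ℝ≥0∞} {W : ℕ → ℤ → ℕ → ℝ≥0∞} {A : ℝ} {D : ℕ → ℕ → ℝ} {Φ : ℕ → ℝ → ℝ → ℂ}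

theorem two_zpow_le_abs_sub_of_notMem {i v : ℤ} {x y : ℝ} (hx : idx i x = v)
    (hy : y ∉ Set.Ioo (((v : ℝ) - 1) * 2 ^ (-i)) (((v : ℝ) + 2) * 2 ^ (-i))) :
    (2 : ℝ) ^ (-i) ≤ |x - y| := by
  by_contra! hlt
  rw [abs_lt] at hlt
  have h1 := idx_eq_iff.1 hx
  refine hy ⟨?_, ?_⟩
  · have : ((v : ℝ) - 1) * 2 ^ (-i) = v * 2 ^ (-i) - 2 ^ (-i) := by ring
    linarith [h1.1]
  · have : ((v : ℝ) + 2) * 2 ^ (-i) = (v + 1) * 2 ^ (-i) + 2 ^ (-i) := by ring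
    linarith [h1.2]

/-- For a function supported away from `x`, the off-diagonal decay of the kernel replaces
orthogonality. -/
theorem scaleOp_far_le (hΦ : ∀ j w, IsWavePacket A D j w (Φ j w)) (hW : AdmissibleWeight m K W)
    {f : ℝ → ℂ} (hf : Measurable f) (hf1 : ∀ y, ‖f y‖ₑ ≤ 1) {i : ℤ} {x : ℝ}
    (hx : ∀ y, f y ≠ 0 → (2 : ℝ) ^ (-i) ≤ |x - y|) (k : ℕ) :
    scaleOp Φ m W f k (idx (lev m 3 k) x) ≤
      packetConst D * (min 1 (len ((3 * k : ℕ) - i)) * (schurConst * K)) := by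
  refine (scaleOp_le_lintegral hΦ hf k _).trans ?_
  gcongr
  refine le_trans ?_ (hW.kernelBound.lintegral_y_far_le k x i)
  have hS : MeasurableSet {y : ℝ | (2 : ℝ) ^ (-i) ≤ |x - y|} :=
    measurableSet_le measurable_const (by fun_prop)
  rw [← lintegral_indicator hS]
  refine lintegral_mono fun y => ?_
  by_cases hy : f y = 0
  · simp [hy]
  · rw [Set.indicator_of_mem (show y ∈ {y : ℝ | (2 : ℝ) ^ (-i) ≤ |x - y|} from hx y hy)]
    exact mul_le_of_le_one_left' (hf1 y)

/-- From the scale `k₀` on, the first factor in `tsum_min_len_le` is 1 at `i = lev m 3 k₀`, so the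
count of scales made there applies. -/
theorem tsum_min_len_tail_le (m k₀ : ℕ) :
    ∑' k : ℕ, min 1 (len ((3 * (k + k₀) : ℕ) - lev m 3 k₀)) ≤ m + 4 := by
  refine le_trans (ENNReal.tsum_le_tsum fun k => ?_) ((ENNReal.tsum_comp_le_tsum_of_injective
    (add_left_injective k₀) (fun k : ℕ => min 1 (len (lev m 3 k₀ - lev m 3 k)) *
      min 1 (len ((3 * k : ℕ) - lev m 3 k₀)))).trans (tsum_min_len_le m (by norm_num) _))
  have : (1 : ℝ≥0∞) ≤ len (lev m 3 k₀ - lev m 3 (k + k₀)) := by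
    rw [← len_zero]
    exact len_anti (by have := lev_mono m 3 (show k₀ ≤ k + k₀ by lia); lia)
  simp only [min_eq_left this, one_mul, le_refl]

/-- The Carleson condition for the squares of the coefficients. -/
theorem exists_carleson_bound (A : ℝ) (D : ℕ → ℕ → ℝ) : ∃ C : ℝ≥0∞, C ≠ ⊤ ∧
    ∀ (Φ : ℕ → ℝ → ℝ → ℂ) (_ : ∀ j w, IsWavePacket A D j w (Φ j w)) (m : ℕ) (K : ℝ≥0∞)
      (W : ℕ → ℤ → ℕ → ℝ≥0∞) (_ : AdmissibleWeight m K W) (f : ℝ → ℂ), Measurable f →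
      Integrable f → (∀ y, ‖f y‖ₑ ≤ 1) → ∀ k₀ v,
      ∫⁻ x in {x | idx (lev m 3 k₀) x = v}, tailSum m 3 (scaleSq Φ m W f) k₀ x ≤
        C * ((m + 4) * K ^ 2) * len (lev m 3 k₀) := by
  obtain ⟨C, hC, h⟩ := exists_scaleOp_l2_bound A D
  refine ⟨12 * C + 4 * (packetConst D * schurConst) ^ 2, ?_, ?_⟩
  · have h1 := packetConst_ne_top D
    have h2 := schurConst_ne_top
    finiteness
  intro Φ hΦ m K W hW f hfm hf hf1 k₀ v
  set i := lev m 3 k₀ with hi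
  -- `J` is the cell with its two neighbours. The part of `f` on `J` is handled by `L²`, with norm
  -- squared at most `3 * len i`; the part off `J` is at distance at least one cell length.
  set J : Set ℝ := Set.Ioo (((v : ℝ) - 1) * 2 ^ (-i)) (((v : ℝ) + 2) * 2 ^ (-i)) with hJ
  have hJm : MeasurableSet J := measurableSet_Ioo
  set f₁ := J.indicator f with hf₁
  set f₂ := Jᶜ.indicator f with hf₂
  have hf12 : f = f₁ + f₂ := (Set.indicator_self_add_compl J f).symm
  have hf₁i : Integrable f₁ := hf.indicator hJm
  have hf₂i : Integrable f₂ := hf.indicator hJm.compl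
  have hb1 : ∀ y, ‖f₁ y‖ₑ ≤ 1 := fun y => (enorm_indicator_le_enorm_self f y).trans (hf1 y)
  have hb2 : ∀ y, ‖f₂ y‖ₑ ≤ 1 := fun y => (enorm_indicator_le_enorm_self f y).trans (hf1 y)
  have hmem : MemLp f₁ 2 := memLp_two_of_integrable_of_bound hf₁i (B := 1)
    (Filter.Eventually.of_forall fun y => by
      have := hb1 y
      rwa [← ofReal_norm, ENNReal.ofReal_le_one] at this)
  have hcell := measurableSet_idx_eq i v
  set G₁ : ℝ → ℝ≥0∞ := fun x => ∑' k, scaleOp Φ m W f₁ k (idx (lev m 3 k) x) ^ 2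
  have hlocal : ∫⁻ x, G₁ x ≤ C * K ^ 2 * (3 * len i) := by
    refine (h Φ hΦ m K W hW f₁ hmem).trans ?_
    gcongr
    calc _ ≤ ∫⁻ x, J.indicator 1 x := by
          refine lintegral_mono fun x => ?_
          by_cases hx : x ∈ J
          · rw [Set.indicator_of_mem hx]
            exact pow_le_one' (hb1 x) 2
          · simp [hf₁, hx]
      _ = volume J := lintegral_indicator_one_eq hJm
      _ = ENNReal.ofReal 3 * len i := by
          rw [hJ, Real.volume_Ioo, len, ← ENNReal.ofReal_mul (by norm_num)]
          congr 1
          ring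
      _ = 3 * len i := by norm_num
  have hpt : ∀ x ∈ {x | idx i x = v}, tailSum m 3 (scaleSq Φ m W f) k₀ x ≤
      4 * G₁ x + 4 * ((packetConst D * schurConst) ^ 2 * K ^ 2 * (m + 4)) := by
    intro x hx
    -- One of the two factors produced by squaring is discarded; the other still sums to `m + 4`.
    have hfar : ∀ k, scaleOp Φ m W f₂ (k + k₀) (idx (lev m 3 (k + k₀)) x) ^ 2 ≤
        (packetConst D * schurConst) ^ 2 * K ^ 2 * min 1 (len ((3 * (k + k₀) : ℕ) - i)) := by
      intro k
      have h1 := scaleOp_far_le hΦ hW (hfm.indicator hJm.compl) hb2 (i := i) (x := x) (fun y hy =>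
        two_zpow_le_abs_sub_of_notMem hx (by
          by_contra hyJ
          exact hy (Set.indicator_of_notMem (Set.notMem_compl_iff.2 hyJ) f))) (k + k₀)
      calc _ ≤ (packetConst D * (min 1 (len ((3 * (k + k₀) : ℕ) - i)) * (schurConst * K))) ^ 2 := by
            gcongr
        _ = (packetConst D * schurConst) ^ 2 * K ^ 2 *
              (min 1 (len ((3 * (k + k₀) : ℕ) - i)) * min 1 (len ((3 * (k + k₀) : ℕ) - i))) := by
            ring
        _ ≤ _ := by
            gcongr
            exact mul_le_of_le_one_left' (min_le_left _ _)
    calc _ ≤ ∑' k, (4 * scaleOp Φ m W f₁ (k + k₀) (idx (lev m 3 (k + k₀)) x) ^ 2 +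
          4 * ((packetConst D * schurConst) ^ 2 * K ^ 2 *
            min 1 (len ((3 * (k + k₀) : ℕ) - i)))) := by
          refine ENNReal.tsum_le_tsum fun k => ?_
          unfold scaleSq
          calc _ ≤ (scaleOp Φ m W f₁ (k + k₀) (idx (lev m 3 (k + k₀)) x) +
                scaleOp Φ m W f₂ (k + k₀) (idx (lev m 3 (k + k₀)) x)) ^ 2 := by
                gcongr
                rw [hf12]
                exact scaleOp_add_le hΦ hf₁i hf₂i _ _
            _ ≤ _ := (add_sq_le_four _ _).trans (by gcongr; exact hfar k)
      _ ≤ _ := by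
          rw [ENNReal.tsum_add, ENNReal.tsum_mul_left, ENNReal.tsum_mul_left, ENNReal.tsum_mul_left]
          gcongr
          · exact ENNReal.tsum_comp_le_tsum_of_injective (add_left_injective k₀)
              (fun k => scaleOp Φ m W f₁ k (idx (lev m 3 k) x) ^ 2)
          · exact tsum_min_len_tail_le m k₀
  calc _ ≤ ∫⁻ x in {x | idx i x = v},
        (4 * G₁ x + 4 * ((packetConst D * schurConst) ^ 2 * K ^ 2 * (m + 4))) :=
        setLIntegral_mono' hcell hpt
    _ = 4 * (∫⁻ x in {x | idx i x = v}, G₁ x) +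
          4 * ((packetConst D * schurConst) ^ 2 * K ^ 2 * (m + 4)) * len i := by
        rw [lintegral_add_right _ measurable_const, lintegral_const_mul' _ _ (by norm_num),
          setLIntegral_const, volume_idx_eq]
    _ ≤ 4 * (C * K ^ 2 * (3 * len i)) +
          4 * ((packetConst D * schurConst) ^ 2 * K ^ 2 * (m + 4)) * len i := by
        gcongr
        exact (setLIntegral_le_lintegral _ _).trans hlocal
    _ ≤ 4 * (C * ((m + 4) * K ^ 2) * (3 * len i)) +
          4 * ((packetConst D * schurConst) ^ 2 * K ^ 2 * (m + 4)) * len i := by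
        gcongr
        refine le_mul_of_one_le_left' ?_
        exact le_trans (by norm_num) (le_add_self (a := (4 : ℝ≥0∞)))
    _ = _ := by ring

/-- Stands in for interpolation between the first moment and an integer moment, after normalization.
-/
theorem rpow_le_add_pow {r : ℝ} {q : ℕ} (h1 : 1 ≤ r) (hq : r ≤ q) (t : ℝ≥0∞) :
    t ^ r ≤ t + t ^ q := by
  rcases le_total t 1 with h | h
  · refine le_add_right ?_
    simpa using ENNReal.rpow_le_rpow_of_exponent_ge h h1
  · refine le_add_left ?_
    simpa using ENNReal.rpow_le_rpow_of_exponent_le h hq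

/-! ### Exponents at least two -/

/-- All the facts about a bounded function on a set of finite measure that the estimates need. -/
structure BoundedOn (f : ℝ → ℂ) (F : Set ℝ) : Prop where
  meas : Measurable f
  measSet : MeasurableSet F
  volume_ne_top : volume F ≠ ⊤
  le : ∀ x, ‖f x‖ ≤ F.indicator 1 x

variable {f : ℝ → ℂ} {F : Set ℝ}

theorem BoundedOn.enorm_le (h : BoundedOn f F) (x : ℝ) : ‖f x‖ₑ ≤ F.indicator 1 x := by
  have := ENNReal.ofReal_le_ofReal (h.le x)
  rw [ofReal_norm] at this
  refine this.trans ?_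
  by_cases hx : x ∈ F <;> simp [hx]

theorem BoundedOn.enorm_le_one (h : BoundedOn f F) (x : ℝ) : ‖f x‖ₑ ≤ 1 :=
  (h.enorm_le x).trans (Set.indicator_le_self' (by simp) x)

theorem BoundedOn.lintegral_le (h : BoundedOn f F) : ∫⁻ x, ‖f x‖ₑ ≤ volume F := by
  rw [← lintegral_indicator_one_eq h.measSet]
  exact lintegral_mono h.enorm_le

theorem BoundedOn.lintegral_sq_le (h : BoundedOn f F) : ∫⁻ x, ‖f x‖ₑ ^ 2 ≤ volume F := by
  refine le_trans (lintegral_mono fun x => ?_) h.lintegral_le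
  rw [pow_two]
  exact mul_le_of_le_one_left' (h.enorm_le_one x)

theorem BoundedOn.integrable (h : BoundedOn f F) : Integrable f :=
  ⟨h.meas.aestronglyMeasurable, h.lintegral_le.trans_lt h.volume_ne_top.lt_top⟩

theorem BoundedOn.memLp (h : BoundedOn f F) : MemLp f 2 :=
  memLp_two_of_integrable_of_bound h.integrable (B := 1) (Filter.Eventually.of_forall fun y => by
    have := h.enorm_le_one y
    rwa [← ofReal_norm, ENNReal.ofReal_le_one] at this)

/-- The estimate for exponents `p = 2 r ≥ 2`. -/
theorem exists_large_exponent_bound (A : ℝ) (D : ℕ → ℕ → ℝ) {r : ℝ} (hr : 1 ≤ r) :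
    ∃ C : ℝ≥0∞, C ≠ ⊤ ∧ ∀ (Φ : ℕ → ℝ → ℝ → ℂ) (_ : ∀ j w, IsWavePacket A D j w (Φ j w)) (m : ℕ)
      (K : ℝ≥0∞) (W : ℕ → ℤ → ℕ → ℝ≥0∞) (_ : AdmissibleWeight m K W), K ≠ 0 → K ≠ ⊤ →
      ∀ (f : ℝ → ℂ) (F : Set ℝ), BoundedOn f F →
      ∫⁻ x, tailSum m 3 (scaleSq Φ m W f) 0 x ^ r ≤ C * ((m + 4) * K) ^ (2 * r) * volume F := by
  obtain ⟨C₁, hC₁, h₁⟩ := exists_scaleOp_l2_bound A D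
  obtain ⟨C₂, hC₂, h₂⟩ := exists_carleson_bound A D
  obtain ⟨q, hq⟩ := exists_nat_ge r
  set C₃ : ℝ≥0∞ := 1 + C₁ + C₂ with hC₃
  have hC₃t : C₃ ≠ ⊤ := by finiteness
  refine ⟨(1 + (q + 1).factorial) * C₃ ^ r, ?_, ?_⟩
  · have : C₃ ^ r ≠ ⊤ := ENNReal.rpow_ne_top_of_nonneg (by linarith) hC₃t
    finiteness
  intro Φ hΦ m K W hW hK0 hK f F hf
  set B := tailSum m 3 (scaleSq Φ m W f) 0 with hB
  have hBm : Measurable B := measurable_tailSum 0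
  -- `κ` dominates both the Carleson constant and the first moment per unit volume of `F`. Dividing
  -- by it makes all moments of order one.
  set κ : ℝ≥0∞ := C₃ * ((m + 4) * K ^ 2) with hκ
  have hm4 : (1 : ℝ≥0∞) ≤ m + 4 := le_trans (by norm_num) (le_add_self (a := (4 : ℝ≥0∞)))
  have hκ0 : κ ≠ 0 := by
    have : C₃ ≠ 0 := by rw [hC₃]; simp
    simp [hκ, this, hK0]
  have hκt : κ ≠ ⊤ := by finiteness
  have hint : ∫⁻ x, B x ≤ κ * volume F := by
    calc _ ≤ C₁ * K ^ 2 * ∫⁻ x, ‖f x‖ₑ ^ 2 := h₁ Φ hΦ m K W hW f hf.memLp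
      _ ≤ C₃ * ((m + 4) * K ^ 2) * volume F := by
          gcongr
          · rw [hC₃]; exact le_add_right le_add_self
          · exact le_mul_of_one_le_left' hm4
          · exact hf.lintegral_sq_le
  have hinttop : ∫⁻ x, B x ≠ ⊤ := ne_top_of_le_ne_top (ENNReal.mul_ne_top hκt hf.volume_ne_top) hint
  have hfin : ∀ k, ∀ᵐ x, tailSum m 3 (scaleSq Φ m W f) k x ≠ ⊤ := by
    intro k
    filter_upwards [ae_lt_top hBm hinttop] with x hx
    exact ((tailSum_le_zero m 3 _ k x).trans_lt hx).ne
  have hcar : ∀ k v, ∫⁻ x in {x | idx (lev m 3 k) x = v}, tailSum m 3 (scaleSq Φ m W f) k x ≤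
      κ * len (lev m 3 k) := by
    intro k v
    refine (h₂ Φ hΦ m K W hW f hf.meas hf.integrable hf.enorm_le_one k v).trans ?_
    rw [hκ, hC₃]
    gcongr
    exact le_add_self
  have hmom := lintegral_tailSum_pow_le hcar hfin q
  have hscaled : ∫⁻ x, (κ⁻¹ * B x) ^ r ≤ (1 + (q + 1).factorial) * volume F := by
    calc _ ≤ ∫⁻ x, (κ⁻¹ * B x + (κ⁻¹ * B x) ^ (q + 1)) :=
          lintegral_mono fun x => rpow_le_add_pow hr (hq.trans (by push_cast; linarith)) _
      _ = κ⁻¹ * (∫⁻ x, B x) + κ⁻¹ ^ (q + 1) * ∫⁻ x, B x ^ (q + 1) := by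
          simp_rw [mul_pow]
          rw [lintegral_add_left (hBm.const_mul _), lintegral_const_mul _ hBm,
            lintegral_const_mul _ (hBm.pow_const _)]
      _ ≤ κ⁻¹ * (κ * volume F) +
            κ⁻¹ ^ (q + 1) * ((q + 1).factorial * κ ^ q * (κ * volume F)) := by
          gcongr
          exact hmom.trans (by gcongr)
      _ = (κ⁻¹ * κ) * volume F + (κ⁻¹ * κ) ^ (q + 1) * ((q + 1).factorial * volume F) := by ring_nf
      _ = _ := by rw [ENNReal.inv_mul_cancel hκ0 hκt]; ring
  have hBκ : ∀ x, B x ^ r = κ ^ r * (κ⁻¹ * B x) ^ r := by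
    intro x
    rw [← ENNReal.mul_rpow_of_nonneg _ _ (by linarith), ← mul_assoc,
      ENNReal.mul_inv_cancel hκ0 hκt, one_mul]
  calc _ = κ ^ r * ∫⁻ x, (κ⁻¹ * B x) ^ r := by
        simp_rw [hBκ]
        exact lintegral_const_mul _ ((hBm.const_mul _).pow_const r)
    _ ≤ κ ^ r * ((1 + (q + 1).factorial) * volume F) := by gcongr
    _ ≤ (C₃ * ((m + 4) * K) ^ 2) ^ r * ((1 + (q + 1).factorial) * volume F) := by
        rw [hκ, mul_pow]
        -- Wasteful on purpose: the bound takes the same form as the one for exponents below 2.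
        have : (m + 4 : ℝ≥0∞) ≤ (m + 4) ^ 2 := by
          rw [pow_two]; exact le_mul_of_one_le_left' hm4
        gcongr
    _ = _ := by
        have e : (C₃ * ((m + 4) * K) ^ 2) ^ r = C₃ ^ r * ((m + 4) * K) ^ (2 * r) := by
          rw [ENNReal.mul_rpow_of_nonneg _ _ (by linarith), ENNReal.rpow_mul, ENNReal.rpow_two]
        rw [e]; ring

/-! ### The Calderón–Zygmund decomposition -/

section CalderonZygmund

variable {f : ℝ → ℂ} {t : ℝ≥0∞}

theorem idx_set_eq_Ico (i n : ℤ) : {x | idx i x = n} =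
    Set.Ico ((n : ℝ) * 2 ^ (-i)) (((n : ℝ) + 1) * 2 ^ (-i)) := by
  ext x; exact idx_eq_iff

/-- Lebesgue's differentiation theorem along dyadic intervals, as a bound for the function. -/
theorem ae_enorm_le_of_cellAvg_le (hf : Integrable f) :
    ∀ᵐ y, (∀ i, cellAvg (fun z => ‖f z‖ₑ) i y ≤ t) → ‖f y‖ₑ ≤ t := by
  have hloc : LocallyIntegrable (fun z => ‖f z‖) := hf.norm.locallyIntegrable
  filter_upwards [IsUnifLocDoublingMeasure.ae_tendsto_average (μ := volume) hloc 1] with y hy hle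
  rcases eq_or_ne t ⊤ with rfl | ht
  · exact le_top
  -- The closed dyadic interval around `y` is the ball with centre its midpoint `w n` and radius
  -- half its length. These balls contain `y` without being centred there, as differentiation for
  -- doubling measures allows.
  set δ : ℕ → ℝ := fun n => 2 ^ (-(n : ℤ)) / 2
  set w : ℕ → ℝ := fun n => (idx n y : ℝ) * 2 ^ (-(n : ℤ)) + δ n
  have hδ0 : ∀ n, 0 < δ n := fun n => by positivity
  have hδ : Filter.Tendsto δ Filter.atTop (nhdsWithin 0 (Set.Ioi 0)) := by
    refine tendsto_nhdsWithin_iff.2 ⟨?_, Filter.Eventually.of_forall hδ0⟩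
    have h1 : Filter.Tendsto (fun n : ℕ => ((1 / 2 : ℝ) ^ n) / 2) Filter.atTop (nhds (0 / 2)) :=
      (tendsto_pow_atTop_nhds_zero_of_lt_one (by norm_num) (by norm_num)).div_const 2
    rw [zero_div] at h1
    refine h1.congr fun n => ?_
    simp [δ]
  have hball : ∀ n, Metric.closedBall (w n) (δ n) =
      Set.Icc ((idx n y : ℝ) * 2 ^ (-(n : ℤ))) (((idx n y : ℝ) + 1) * 2 ^ (-(n : ℤ))) := by
    intro n
    rw [Real.closedBall_eq_Icc]
    congr 1 <;> simp only [w, δ] <;> ring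
  have hmem : ∀ n : ℕ, y ∈ Set.Ico ((idx n y : ℝ) * 2 ^ (-(n : ℤ)))
      (((idx n y : ℝ) + 1) * 2 ^ (-(n : ℤ))) := fun n => idx_eq_iff.1 rfl
  have hlim := hy w δ hδ (Filter.Eventually.of_forall fun n => by
    rw [one_mul, hball]; exact Set.Ico_subset_Icc_self (hmem n))
  have hav : ∀ n : ℕ, ⨍ z in Metric.closedBall (w n) (δ n), ‖f z‖ ≤ t.toReal := by
    intro n
    have h1 := hle n
    rw [setAverage_eq, hball, integral_Icc_eq_integral_Ico, Real.volume_real_Icc, smul_eq_mul]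
    refine (ENNReal.ofReal_le_iff_le_toReal ht).1 (le_trans (le_of_eq ?_) h1)
    have e : max (((idx n y : ℝ) + 1) * 2 ^ (-(n : ℤ)) - (idx n y : ℝ) * 2 ^ (-(n : ℤ))) 0 =
        2 ^ (-(n : ℤ)) := by
      rw [max_eq_left]
      · ring
      · have : (0 : ℝ) < 2 ^ (-(n : ℤ)) := by positivity
        linarith
    rw [e, ENNReal.ofReal_mul (by positivity), ofReal_integral_norm_eq_lintegral_enorm
      hf.integrableOn, cellAvg, idx_set_eq_Ico, len, ← zpow_neg]
  have := le_of_tendsto' hlim hav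
  rw [← ofReal_norm]
  exact (ENNReal.ofReal_le_iff_le_toReal ht).2 this

/-- The mean value of `f` over a dyadic interval. -/
noncomputable def cellMean (f : ℝ → ℂ) (i n : ℤ) : ℂ :=
  ((2 : ℝ) ^ i : ℝ) * ∫ z in {z | idx i z = n}, f z

theorem enorm_cellMean_le (f : ℝ → ℂ) (i : ℤ) (y : ℝ) :
    ‖cellMean f i (idx i y)‖ₑ ≤ cellAvg (fun z => ‖f z‖ₑ) i y := by
  unfold cellMean cellAvg len
  rw [enorm_mul, neg_neg]
  refine mul_le_mul' (le_of_eq ?_) (enorm_integral_le_lintegral_enorm _)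
  rw [← ofReal_norm, Complex.norm_real, Real.norm_of_nonneg (by positivity)]

theorem setIntegral_sub_cellMean (hf : Integrable f) (i n : ℤ) :
    ∫ z in {z | idx i z = n}, (f z - cellMean f i n) = 0 := by
  have hv : volume {z | idx i z = n} ≠ ⊤ := by rw [volume_idx_eq]; exact len_ne_top i
  rw [integral_sub hf.integrableOn (by exact integrableOn_const hv), setIntegral_const,
    measureReal_def, volume_idx_eq, len, ENNReal.toReal_ofReal (by positivity), cellMean,
    Complex.real_smul, ← mul_assoc, ← Complex.ofReal_mul, ← zpow_add₀ (by norm_num)]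
  simp

/-- The level of the stopping interval that contains `y`, and zero if there is none. -/
noncomputable def stopLevel (F : ℝ → ℝ≥0∞) (t : ℝ≥0∞) (y : ℝ) : ℤ :=
  open scoped Classical in if h : ∃ i, y ∈ stopSet F t i then h.choose else 0

theorem stopLevel_eq {F : ℝ → ℝ≥0∞} {y : ℝ} {i : ℤ} (h : y ∈ stopSet F t i) :
    stopLevel F t y = i := by
  have hex : ∃ i, y ∈ stopSet F t i := ⟨i, h⟩
  unfold stopLevel
  rw [dif_pos hex]
  by_contra hne
  exact Set.disjoint_left.1 (pairwise_disjoint_stopSet F t hne) hex.choose_spec h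

theorem measurableSet_iUnion_stopSet (F : ℝ → ℝ≥0∞) (t : ℝ≥0∞) :
    MeasurableSet (⋃ i, stopSet F t i) := MeasurableSet.iUnion (measurableSet_stopSet F t)

theorem measurable_stopLevel (F : ℝ → ℝ≥0∞) (t : ℝ≥0∞) : Measurable (stopLevel F t) := by
  refine measurable_to_countable' fun i => ?_
  have h0 : ∀ y, y ∉ (⋃ i, stopSet F t i) → stopLevel F t y = 0 := by
    intro y hy
    unfold stopLevel
    rw [dif_neg (by simpa using hy)]
  -- The default value 0 of `stopLevel` adds the complement of all stopping intervals to this one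
  -- fibre.
  by_cases hi : i = 0
  · have : stopLevel F t ⁻¹' {i} = stopSet F t i ∪ (⋃ i, stopSet F t i)ᶜ := by
      ext y
      by_cases hy : y ∈ ⋃ i, stopSet F t i
      · obtain ⟨i', hi'⟩ := Set.mem_iUnion.1 hy
        have hs := stopLevel_eq hi'
        constructor
        · intro h
          left
          have : i' = i := hs.symm.trans h
          rwa [← this]
        · rintro (h | h)
          · exact stopLevel_eq h
          · exact absurd hy h
      · exact ⟨fun _ => Or.inr hy, fun _ => by rw [Set.mem_preimage, h0 y hy, hi]; rfl⟩
    rw [this]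
    exact (measurableSet_stopSet F t i).union (measurableSet_iUnion_stopSet F t).compl
  · have : stopLevel F t ⁻¹' {i} = stopSet F t i := by
      ext y
      constructor
      · intro h
        by_cases hy : y ∈ ⋃ i, stopSet F t i
        · obtain ⟨i', hi'⟩ := Set.mem_iUnion.1 hy
          have : i' = i := (stopLevel_eq hi').symm.trans h
          rwa [← this]
        · exact absurd ((h0 y hy).symm.trans h).symm hi
      · exact fun h => stopLevel_eq h
    rw [this]
    exact measurableSet_stopSet F t i

open scoped Classical in
/-- The good part of the Calderón–Zygmund decomposition of `f` at height `t`. -/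
noncomputable def goodPart (f : ℝ → ℂ) (t : ℝ≥0∞) (y : ℝ) : ℂ :=
  if y ∈ ⋃ i, stopSet (fun z => ‖f z‖ₑ) t i then
    cellMean f (stopLevel (fun z => ‖f z‖ₑ) t y) (idx (stopLevel (fun z => ‖f z‖ₑ) t y) y)
  else f y

theorem goodPart_of_mem {y : ℝ} {i : ℤ} (h : y ∈ stopSet (fun z => ‖f z‖ₑ) t i) :
    goodPart f t y = cellMean f i (idx i y) := by
  unfold goodPart
  rw [if_pos (Set.mem_iUnion.2 ⟨i, h⟩), stopLevel_eq h]

theorem goodPart_of_notMem {y : ℝ} (h : y ∉ ⋃ i, stopSet (fun z => ‖f z‖ₑ) t i) :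
    goodPart f t y = f y := by
  unfold goodPart
  rw [if_neg h]

theorem measurable_goodPart (hf : Measurable f) : Measurable (goodPart f t) := by
  classical
  refine Measurable.ite (measurableSet_iUnion_stopSet _ _) ?_ hf
  have h1 : Measurable fun p : ℤ × ℤ => cellMean f p.1 p.2 := measurable_of_countable _
  have hσ := measurable_stopLevel (fun z => ‖f z‖ₑ) t
  refine h1.comp (hσ.prodMk ?_)
  exact (measurable_id.mul ((measurable_of_countable fun n : ℤ => (2 : ℝ) ^ n).comp hσ)).floor

theorem ae_enorm_goodPart_le (hf : Integrable f) (ht : t ≠ 0) :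
    ∀ᵐ y, ‖goodPart f t y‖ₑ ≤ 2 * t := by
  filter_upwards [ae_enorm_le_of_cellAvg_le (t := t) hf] with y hy
  by_cases h : y ∈ ⋃ i, stopSet (fun z => ‖f z‖ₑ) t i
  · obtain ⟨i, hi⟩ := Set.mem_iUnion.1 h
    rw [goodPart_of_mem hi]
    exact (enorm_cellMean_le f i y).trans (cellAvg_le_of_mem_stopSet hi)
  · rw [goodPart_of_notMem h]
    refine (hy fun i => cellAvg_le_of_notMem hf.2.ne ht fun i' _ hi' =>
      h (Set.mem_iUnion.2 ⟨i', hi'⟩)).trans ?_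
    exact le_mul_of_one_le_left' (by norm_num)

theorem lintegral_goodPart_le (f : ℝ → ℂ) (t : ℝ≥0∞) :
    ∫⁻ y, ‖goodPart f t y‖ₑ ≤ ∫⁻ y, ‖f y‖ₑ := by
  set Ω := ⋃ i, stopSet (fun z => ‖f z‖ₑ) t i with hΩ
  have hm := measurableSet_iUnion_stopSet (fun z => ‖f z‖ₑ) t
  have hms := measurableSet_stopSet (fun z => ‖f z‖ₑ) t
  have hd := pairwise_disjoint_stopSet (fun z => ‖f z‖ₑ) t
  rw [← lintegral_add_compl _ hm, ← lintegral_add_compl (fun y => ‖f y‖ₑ) hm]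
  refine add_le_add ?_ (le_of_eq ?_)
  · rw [lintegral_iUnion hms hd, lintegral_iUnion hms hd]
    refine ENNReal.tsum_le_tsum fun i => ?_
    rw [← setLIntegral_cellAvg (fun z => ‖f z‖ₑ) i (hms i) (fun x y hxy hx =>
      (mem_stopSet_congr _ t le_rfl hxy).1 hx)]
    refine setLIntegral_mono' (hms i) fun y hy => ?_
    rw [goodPart_of_mem hy]
    exact enorm_cellMean_le f i y
  · exact setLIntegral_congr_fun hm.compl fun y hy => by simp only [goodPart_of_notMem hy]

/-- A stopping set of level `i` either contains a whole cell of that level or misses it. On a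
contained cell the good part is the mean of `f`. -/
theorem setIntegral_badPart (hf : Integrable f) (i n : ℤ) :
    ∫ y in stopSet (fun z => ‖f z‖ₑ) t i ∩ {y | idx i y = n}, (f y - goodPart f t y) = 0 := by
  set S := stopSet (fun z => ‖f z‖ₑ) t i
  by_cases h : ∃ y ∈ S, idx i y = n
  · obtain ⟨y₀, hy₀, rfl⟩ := h
    have hsub : {y | idx i y = idx i y₀} ⊆ S := fun y hy =>
      (mem_stopSet_congr _ t le_rfl (Eq.symm hy)).1 hy₀
    rw [Set.inter_eq_self_of_subset_right hsub, ← setIntegral_sub_cellMean hf i (idx i y₀)]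
    refine setIntegral_congr_fun (measurableSet_idx_eq i _) fun y hy => ?_
    simp only [goodPart_of_mem (hsub hy), show idx i y = idx i y₀ from hy]
  · have : S ∩ {y | idx i y = n} = ∅ := by
      ext y
      simp only [Set.mem_inter_iff, Set.mem_ofPred_eq, Set.mem_empty_iff_false, iff_false]
      exact fun hy => h ⟨y, hy.1, hy.2⟩
    rw [this, Measure.restrict_empty, integral_zero_measure]

end CalderonZygmund

/-! ### The bad part and the weak `(1,1)` bound -/

variable {m : ℕ} {K : ℝ≥0∞} {W : ℕ → ℤ → ℕ → ℝ≥0∞} {A : ℝ} {D : ℕ → ℕ → ℝ} {Φ : ℕ → ℝ → ℝ → ℂ}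
  {f : ℝ → ℂ} {t : ℝ≥0∞}

/-- The bad part is the sum of its pieces on single stopping cells, each of mean zero. The bounds on
pieces of equal level are regrouped into an integral over `stopSet`, the form required by
`lintegral_far_sum_le`. -/
theorem ecoeff_badPart_le (hΦ : ∀ j w, IsWavePacket A D j w (Φ j w)) (hf : Integrable f)
    (hg : Integrable (goodPart f t)) (j : ℕ) (w : ℝ) :
    ecoeff Φ (f - goodPart f t) j w ≤ packetConst D * ∑' i : ℤ, min 1 (len (i - j)) *
      ∫⁻ y in stopSet (fun z => ‖f z‖ₑ) t i, ‖(f - goodPart f t) y‖ₑ * ker 10 j w y := by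
  set b := f - goodPart f t with hb
  have hbi : Integrable b := hf.sub hg
  set S := stopSet (fun z => ‖f z‖ₑ) t with hS
  have hSm := measurableSet_stopSet (fun z => ‖f z‖ₑ) t
  set E : ℤ × ℤ → Set ℝ := fun q => S q.1 ∩ {y | idx q.1 y = q.2} with hE
  have hEm : ∀ q, MeasurableSet (E q) := fun q => (hSm _).inter (measurableSet_idx_eq _ _)
  have hEd : Pairwise (Function.onFun Disjoint E) := by
    intro q q' hne
    rw [Function.onFun, Set.disjoint_left]
    intro y hy hy'
    have h1 : q.1 = q'.1 := by
      by_contra h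
      exact Set.disjoint_left.1 (pairwise_disjoint_stopSet _ t h) hy.1 hy'.1
    have h2 : q.2 = q'.2 := by
      have e1 : idx q.1 y = q.2 := hy.2
      have e2 : idx q'.1 y = q'.2 := hy'.2
      rw [← e1, ← e2, h1]
    exact hne (Prod.ext h1 h2)
  set φ := Φ j w
  have hφ : IsWavePacket A D j w φ := hΦ j w
  have hbφ := hφ.integrable_mul_conj hbi
  have hzero : ∀ y, y ∉ (⋃ q, E q) → b y * conj (φ y) = 0 := by
    intro y hy
    have : y ∉ ⋃ i, S i := by
      intro hy'
      obtain ⟨i, hi⟩ := Set.mem_iUnion.1 hy'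
      exact hy (Set.mem_iUnion.2 ⟨(i, idx i y), hi, rfl⟩)
    rw [hb, Pi.sub_apply, goodPart_of_notMem this, sub_self, zero_mul]
  have hsum := hasSum_integral_iUnion hEm hEd hbφ.integrableOn
  rw [setIntegral_eq_integral_of_forall_compl_eq_zero hzero] at hsum
  unfold ecoeff
  calc _ ≤ (∑' q, ‖∫ y in E q, b y * conj (φ y)‖ₑ) * height j := by
        gcongr
        rw [← hsum.tsum_eq]
        exact enorm_tsum_le_tsum_enorm
    _ = ∑' q, ‖∫ y in E q, b y * conj (φ y)‖ₑ * height j := ENNReal.tsum_mul_right.symm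
    _ ≤ ∑' q : ℤ × ℤ, packetConst D *
          (min 1 (len (q.1 - j)) * ∫⁻ y in E q, ‖b y‖ₑ * ker 10 j w y) := by
        refine ENNReal.tsum_le_tsum fun q => ?_
        exact hφ.enorm_setIntegral_le_of_mean_zero hbi (hEm q) Set.inter_subset_right
          (setIntegral_badPart hf q.1 q.2)
    _ = _ := by
        rw [ENNReal.tsum_mul_left, ENNReal.tsum_prod']
        congr 1
        refine tsum_congr fun i => ?_
        simp only
        rw [ENNReal.tsum_mul_left]
        congr 1
        have hU : S i = ⋃ n, E (i, n) := by
          ext y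
          simp [hE]
        rw [hU, lintegral_iUnion (fun n => hEm (i, n))]
        intro n n' hne
        exact hEd (by simpa using hne)

theorem scaleOp_badPart_le (hΦ : ∀ j w, IsWavePacket A D j w (Φ j w)) (hfm : Measurable f)
    (hf : Integrable f) (hg : Integrable (goodPart f t)) (k : ℕ) (v : ℤ) :
    scaleOp Φ m W (f - goodPart f t) k v ≤ packetConst D * ∑' i : ℤ, min 1 (len (i - lev m 3 k)) *
      ∫⁻ y in stopSet (fun z => ‖f z‖ₑ) t i,
        ‖(f - goodPart f t) y‖ₑ * scaleKer m W k v y := by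
  have hbm : Measurable fun y => ‖(f - goodPart f t) y‖ₑ :=
    (hfm.sub (measurable_goodPart hfm)).enorm
  simp_rw [lintegral_mul_scaleKer hbm, Finset.mul_sum]
  rw [Summable.tsum_finsetSum (fun _ _ => ENNReal.summable), Finset.mul_sum]
  refine Finset.sum_le_sum fun p _ => ?_
  simp_rw [mul_left_comm _ (W k (v / 2 ^ k) p)]
  rw [ENNReal.tsum_mul_left, mul_left_comm]
  gcongr
  have := ecoeff_badPart_le hΦ hf hg (m + 3 * k) ((v : ℝ) - (p : ℝ) ^ 3 / 2 ^ (2 * m))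
  rwa [natCast_level] at this

/-- The square function is of weak type `(1, 1)`, with norm `O(m)`. -/
theorem exists_weak_bound (A : ℝ) (D : ℕ → ℕ → ℝ) : ∃ C : ℝ≥0∞, C ≠ ⊤ ∧
    ∀ (Φ : ℕ → ℝ → ℝ → ℂ) (_ : ∀ j w, IsWavePacket A D j w (Φ j w)) (m : ℕ) (K : ℝ≥0∞)
      (W : ℕ → ℤ → ℕ → ℝ≥0∞) (_ : AdmissibleWeight m K W), K ≠ 0 → K ≠ ⊤ →
      ∀ f : ℝ → ℂ, Measurable f → Integrable f → ∀ t : ℝ≥0∞, t ≠ 0 → t ≠ ⊤ →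
      t * volume {x | 8 * (t * K) ^ 2 ≤ tailSum m 3 (scaleSq Φ m W f) 0 x} ≤
        C * (m + 4) * ∫⁻ x, ‖f x‖ₑ := by
  obtain ⟨C, hC, h⟩ := exists_scaleOp_l2_bound A D
  refine ⟨3 + 2 * C + 2 * (packetConst D * schurConst), ?_, ?_⟩
  · have h1 := packetConst_ne_top D
    have h2 := schurConst_ne_top
    finiteness
  intro Φ hΦ m K W hW hK0 hK f hfm hf t ht0 ht
  set g := goodPart f t with hg
  set b := f - g with hb
  have hgm : Measurable g := measurable_goodPart hfm
  have hgi : Integrable g :=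
    ⟨hgm.aestronglyMeasurable, (lintegral_goodPart_le f t).trans_lt hf.2⟩
  have hbi : Integrable b := hf.sub hgi
  have hfgb : f = g + b := by rw [hb]; abel
  have hgb := ae_enorm_goodPart_le hf ht0
  have hg2 : MemLp g 2 := memLp_two_of_integrable_of_bound hgi (B := (2 * t).toReal) (by
    filter_upwards [hgb] with y hy
    rw [← ofReal_norm] at hy
    exact (ENNReal.ofReal_le_iff_le_toReal (by finiteness)).1 hy)
  have hm4 : (1 : ℝ≥0∞) ≤ m + 4 := le_trans (by norm_num) (le_add_self (a := (4 : ℝ≥0∞)))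
  set Gg : ℝ → ℝ≥0∞ := fun x => ∑' k, scaleOp Φ m W g k (idx (lev m 3 k) x) ^ 2 with hGg
  set Gb : ℝ → ℝ≥0∞ := fun x => ∑' k, scaleOp Φ m W b k (idx (lev m 3 k) x) with hGb
  have hGgm : Measurable Gg := Measurable.tsum fun k =>
    measurable_comp_idx (fun v => scaleOp Φ m W g k v ^ 2) _
  have hGbm : Measurable Gb := Measurable.tsum fun k => measurable_comp_idx _ _
  set Ω := ⋃ i, starSet (fun z => ‖f z‖ₑ) t i with hΩ
  have hΩm : MeasurableSet Ω := MeasurableSet.iUnion (measurableSet_starSet _ t)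
  -- The good part keeps the `ℓ²` sum over scales for the `L²` bound; for the bad part `ℓ²` is
  -- relaxed to `ℓ¹`, which an `L¹` estimate controls.
  have hpt : ∀ x, tailSum m 3 (scaleSq Φ m W f) 0 x ≤ 4 * Gg x + 4 * Gb x ^ 2 := by
    intro x
    calc _ ≤ ∑' k, (4 * scaleOp Φ m W g k (idx (lev m 3 k) x) ^ 2 +
          4 * scaleOp Φ m W b k (idx (lev m 3 k) x) ^ 2) := by
          refine ENNReal.tsum_le_tsum fun k => ?_
          simp only [add_zero]
          refine le_trans ?_ (add_sq_le_four _ _)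
          unfold scaleSq
          gcongr
          conv_lhs => rw [hfgb]
          exact scaleOp_add_le hΦ hgi hbi _ _
      _ ≤ _ := by
          rw [ENNReal.tsum_add, ENNReal.tsum_mul_left, ENNReal.tsum_mul_left]
          gcongr
          calc _ ≤ ∑' k, scaleOp Φ m W b k (idx (lev m 3 k) x) * Gb x := by
                refine ENNReal.tsum_le_tsum fun k => ?_
                rw [pow_two]
                gcongr
                exact ENNReal.le_tsum (f := fun k => scaleOp Φ m W b k (idx (lev m 3 k) x)) k
            _ = _ := by rw [ENNReal.tsum_mul_right, pow_two]
  -- The constant is `8 = 4 + 4`, one 4 for each part in `hpt`.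
  have hsub : {x | 8 * (t * K) ^ 2 ≤ tailSum m 3 (scaleSq Φ m W f) 0 x} ⊆
      Ω ∪ ({x | (t * K) ^ 2 ≤ Gg x} ∪ {x | t * K ≤ Ωᶜ.indicator Gb x}) := by
    intro x hx
    by_cases hxΩ : x ∈ Ω
    · exact Or.inl hxΩ
    right
    by_contra hcon
    simp only [Set.mem_union, Set.mem_ofPred_eq, not_or, not_le,
      Set.indicator_of_mem (Set.mem_compl hxΩ)] at hcon
    have h1 : Gb x ^ 2 ≤ (t * K) ^ 2 := by gcongr; exact hcon.2.le
    have h2 : tailSum m 3 (scaleSq Φ m W f) 0 x < 8 * (t * K) ^ 2 := by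
      calc _ ≤ 4 * Gg x + 4 * (t * K) ^ 2 := (hpt x).trans (by gcongr)
        _ < 4 * (t * K) ^ 2 + 4 * (t * K) ^ 2 := by
            refine ENNReal.add_lt_add_right (by finiteness) ?_
            exact (ENNReal.mul_lt_mul_iff_right (by norm_num) (by norm_num)).2 hcon.1
        _ = _ := by ring
    exact absurd hx (not_le.2 h2)
  have hgood : t * volume {x | (t * K) ^ 2 ≤ Gg x} ≤ 2 * C * ∫⁻ x, ‖f x‖ₑ := by
    have h1 := (mul_meas_ge_le_lintegral hGgm ((t * K) ^ 2)).trans (h Φ hΦ m K W hW g hg2)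
    -- One factor `|g| ≤ 2t` is taken out; the factor `t` cancels in Chebyshev's inequality.
    have h2 : ∫⁻ x, ‖g x‖ₑ ^ 2 ≤ 2 * t * ∫⁻ x, ‖f x‖ₑ := by
      calc _ ≤ ∫⁻ x, 2 * t * ‖g x‖ₑ := by
            refine lintegral_mono_ae ?_
            filter_upwards [hgb] with y hy
            rw [pow_two]
            gcongr
        _ ≤ _ := by
            rw [lintegral_const_mul _ hgm.enorm]
            gcongr 1
            exact lintegral_goodPart_le f t
    have h3 : t * K ^ 2 * (t * volume {x | (t * K) ^ 2 ≤ Gg x}) ≤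
        t * K ^ 2 * (2 * C * ∫⁻ x, ‖f x‖ₑ) := by
      calc _ = (t * K) ^ 2 * volume {x | (t * K) ^ 2 ≤ Gg x} := by ring
        _ ≤ C * K ^ 2 * (2 * t * ∫⁻ x, ‖f x‖ₑ) := h1.trans (by gcongr)
        _ = _ := by ring
    exact (ENNReal.mul_le_mul_iff_right (by positivity) (by finiteness)).1 h3
  have hbad : t * volume {x | t * K ≤ Ωᶜ.indicator Gb x} ≤
      2 * (packetConst D * schurConst) * (m + 4) * ∫⁻ x, ‖f x‖ₑ := by
    have h1 := mul_meas_ge_le_lintegral₀ (hGbm.indicator hΩm.compl).aemeasurable (μ := volume)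
      (t * K)
    rw [lintegral_indicator hΩm.compl] at h1
    have hP := packetConst_ne_top D
    -- Mean zero handles scales much coarser than a stopping interval, distance those much finer;
    -- about `m` scales between them give the factor `m + 4`.
    have h2 : ∫⁻ x in Ωᶜ, Gb x ≤ packetConst D *
        ((m + 4) * (schurConst * K) * ∫⁻ y, ‖b y‖ₑ) := by
      refine le_trans ?_ (mul_le_mul' le_rfl (hW.kernelBound.lintegral_far_sum_le (by norm_num)
        (fun z => ‖f z‖ₑ) t (hfm.sub hgm).enorm))
      rw [← lintegral_const_mul' _ _ hP]
      refine lintegral_mono fun x => ?_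
      rw [← ENNReal.tsum_mul_left]
      exact ENNReal.tsum_le_tsum fun k => scaleOp_badPart_le hΦ hfm hf hgi k _
    have h3 : ∫⁻ y, ‖b y‖ₑ ≤ 2 * ∫⁻ y, ‖f y‖ₑ := by
      calc _ ≤ ∫⁻ y, (‖f y‖ₑ + ‖g y‖ₑ) := lintegral_mono fun y => enorm_sub_le
        _ ≤ _ := by
            rw [lintegral_add_left hfm.enorm, two_mul]
            gcongr 1
            exact lintegral_goodPart_le f t
    have h4 : K * (t * volume {x | t * K ≤ Ωᶜ.indicator Gb x}) ≤
        K * (2 * (packetConst D * schurConst) * (m + 4) * ∫⁻ x, ‖f x‖ₑ) := by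
      calc _ = t * K * volume {x | t * K ≤ Ωᶜ.indicator Gb x} := by ring
        _ ≤ packetConst D * ((m + 4) * (schurConst * K) * (2 * ∫⁻ y, ‖f y‖ₑ)) :=
            (h1.trans h2).trans (by gcongr)
        _ = _ := by ring
    exact (ENNReal.mul_le_mul_iff_right hK0 hK).1 h4
  set I := ∫⁻ x, ‖f x‖ₑ with hI
  calc _ ≤ t * (volume Ω + (volume {x | (t * K) ^ 2 ≤ Gg x} +
          volume {x | t * K ≤ Ωᶜ.indicator Gb x})) := by
        gcongr
        refine (measure_mono hsub).trans ((measure_union_le _ _).trans ?_)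
        gcongr
        exact measure_union_le _ _
    _ ≤ 3 * I + (2 * C * I + 2 * (packetConst D * schurConst) * (m + 4) * I) := by
        rw [mul_add, mul_add]
        exact add_le_add (mul_volume_iUnion_starSet_le _ t) (add_le_add hgood hbad)
    _ ≤ 3 * ((m + 4) * I) + (2 * C * ((m + 4) * I) +
          2 * (packetConst D * schurConst) * (m + 4) * I) := by
        gcongr <;> exact le_mul_of_one_le_left' hm4
    _ = _ := by ring

/-! ### Exponents between one and two -/

theorem exists_len_sq_le {s : ℝ≥0∞} (h0 : s ≠ 0) (h1 : s < 1) :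
    ∃ n : ℕ, len (n + 1) ^ 2 ≤ s ∧ s ≤ len n ^ 2 := by
  have hst : s ≠ ⊤ := (h1.trans ENNReal.one_lt_top).ne
  have hpos : 0 < s.toReal := ENNReal.toReal_pos h0 hst
  have hle : s.toReal ≤ 1 := by
    have := ENNReal.toReal_mono ENNReal.one_ne_top h1.le
    simpa using this
  obtain ⟨n, hn1, hn2⟩ := exists_nat_pow_near_of_lt_one hpos hle
    (show (0 : ℝ) < 1 / 4 by norm_num) (by norm_num)
  have hlen : ∀ n : ℕ, len n ^ 2 = ENNReal.ofReal ((1 / 4) ^ n) := by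
    intro n
    unfold len
    rw [← ENNReal.ofReal_pow (by positivity)]
    congr 1
    rw [zpow_neg, zpow_natCast, ← inv_pow, ← pow_mul, mul_comm, pow_mul]
    norm_num
  refine ⟨n, ?_, ?_⟩
  · have := hlen (n + 1)
    push_cast at this
    rw [this, ← ENNReal.ofReal_toReal hst]
    exact ENNReal.ofReal_le_ofReal hn1.le
  · rw [hlen, ← ENNReal.ofReal_toReal hst]
    exact ENNReal.ofReal_le_ofReal hn2

/-- A discrete layer cake formula: values of at least 1 are left to the first moment, smaller ones
are sorted by powers of 4 for the weak type bound. -/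
theorem rpow_le_add_tsum {r : ℝ} (hr0 : 0 < r) (hr1 : r ≤ 1) (s : ℝ≥0∞) :
    s ^ r ≤ s + ∑' n : ℕ, len n ^ (2 * r) * {a : ℝ≥0∞ | len (n + 1) ^ 2 ≤ a}.indicator 1 s := by
  rcases eq_or_ne s 0 with rfl | h0
  · simp [ENNReal.zero_rpow_of_pos hr0]
  rcases le_or_gt 1 s with h1 | h1
  · refine le_add_right ?_
    simpa using ENNReal.rpow_le_rpow_of_exponent_le h1 hr1
  · obtain ⟨n, hn1, hn2⟩ := exists_len_sq_le h0 h1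
    refine le_add_left (le_trans ?_ (ENNReal.le_tsum n))
    rw [Set.indicator_of_mem (show s ∈ {a : ℝ≥0∞ | len (n + 1) ^ 2 ≤ a} from hn1), Pi.one_apply,
      mul_one, ENNReal.rpow_mul, ENNReal.rpow_two]
    exact ENNReal.rpow_le_rpow hn2 hr0.le

/-- The terms are `2 * 2^{-n(2r-1)}`: the weak type bound at height `2^{-n-1}` costs `2^{n+1}`.
Convergence is where `p = 2r > 1` enters. -/
theorem tsum_len_rpow_ne_top {r : ℝ} (hr : 1 / 2 < r) :
    ∑' n : ℕ, len n ^ (2 * r) * len (-(n + 1)) ≠ ⊤ := by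
  have hlen1 : len 1 = 2⁻¹ := by
    unfold len
    rw [zpow_neg, zpow_one, ENNReal.ofReal_inv_of_pos (by norm_num)]
    simp
  have hpow : ∀ n : ℕ, len n = 2⁻¹ ^ n := by
    intro n
    induction n with
    | zero => simp [len_zero]
    | succ n ih => rw [Nat.cast_succ, len_add, ih, hlen1, pow_succ]
  have hterm : ∀ n : ℕ, len n ^ (2 * r) * len (-(n + 1)) = 2 * ((2⁻¹ : ℝ≥0∞) ^ (2 * r - 1)) ^ n := by
    intro n
    have h1 : len (-((n : ℤ) + 1)) = 2 * (len n)⁻¹ := by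
      have e1 : len (-((n : ℤ) + 1)) = 2 ^ (n + 1) := by
        have := len_neg_natCast (n + 1)
        push_cast at this
        rw [this]
      rw [e1, hpow, ENNReal.inv_pow, inv_inv, pow_succ, mul_comm]
    have h2 : len n ^ (2 * r) = len n ^ (2 * r - 1) * len n := by
      conv_lhs => rw [show 2 * r = (2 * r - 1) + 1 by ring]
      rw [ENNReal.rpow_add _ _ (len_ne_zero _) (len_ne_top _), ENNReal.rpow_one]
    rw [h1, h2]
    calc _ = 2 * len n ^ (2 * r - 1) * (len n * (len n)⁻¹) := by ring
      _ = 2 * len n ^ (2 * r - 1) := by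
          rw [ENNReal.mul_inv_cancel (len_ne_zero _) (len_ne_top _), mul_one]
      _ = _ := by
          rw [hpow, ← ENNReal.rpow_natCast, ← ENNReal.rpow_mul, ← ENNReal.rpow_natCast,
            ← ENNReal.rpow_mul, mul_comm (n : ℝ)]
  simp_rw [hterm]
  rw [ENNReal.tsum_mul_left, ENNReal.tsum_geometric]
  refine ENNReal.mul_ne_top (by norm_num) (ENNReal.inv_ne_top.2 ?_)
  rw [ne_eq, tsub_eq_zero_iff_le, not_le]
  exact ENNReal.rpow_lt_one (by norm_num) (by linarith)

/-- The estimate for exponents `p = 2 r` with `1 < p < 2`. -/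
theorem exists_small_exponent_bound (A : ℝ) (D : ℕ → ℕ → ℝ) {r : ℝ} (hr : 1 / 2 < r)
    (hr1 : r ≤ 1) :
    ∃ C : ℝ≥0∞, C ≠ ⊤ ∧ ∀ (Φ : ℕ → ℝ → ℝ → ℂ) (_ : ∀ j w, IsWavePacket A D j w (Φ j w)) (m : ℕ)
      (K : ℝ≥0∞) (W : ℕ → ℤ → ℕ → ℝ≥0∞) (_ : AdmissibleWeight m K W), K ≠ 0 → K ≠ ⊤ →
      ∀ (f : ℝ → ℂ) (F : Set ℝ), BoundedOn f F →
      ∫⁻ x, tailSum m 3 (scaleSq Φ m W f) 0 x ^ r ≤ C * ((m + 4) * K) ^ (2 * r) * volume F := by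
  obtain ⟨C₁, hC₁, h₁⟩ := exists_scaleOp_l2_bound A D
  obtain ⟨C₂, hC₂, h₂⟩ := exists_weak_bound A D
  set S₀ : ℝ≥0∞ := ∑' n : ℕ, len n ^ (2 * r) * len (-(n + 1)) with hS₀
  have hS : S₀ ≠ ⊤ := tsum_len_rpow_ne_top hr
  refine ⟨8 ^ r * (C₁ + S₀ * C₂), ?_, ?_⟩
  · have : (8 : ℝ≥0∞) ^ r ≠ ⊤ := ENNReal.rpow_ne_top_of_nonneg (by linarith) (by norm_num)
    finiteness
  intro Φ hΦ m K W hW hK0 hK f F hf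
  have hr0 : 0 < r := by linarith
  set B := tailSum m 3 (scaleSq Φ m W f) 0 with hB
  have hBm : Measurable B := measurable_tailSum 0
  set κ : ℝ≥0∞ := 8 * K ^ 2 with hκ
  have hκ0 : κ ≠ 0 := mul_ne_zero (by norm_num) (pow_ne_zero _ hK0)
  have hκt : κ ≠ ⊤ := by finiteness
  have hm4 : (1 : ℝ≥0∞) ≤ m + 4 := le_trans (by norm_num) (le_add_self (a := (4 : ℝ≥0∞)))
  have hint : ∫⁻ x, κ⁻¹ * B x ≤ C₁ * volume F := by
    rw [lintegral_const_mul _ hBm]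
    calc _ ≤ κ⁻¹ * (C₁ * K ^ 2 * volume F) := by
          gcongr
          exact (h₁ Φ hΦ m K W hW f hf.memLp).trans (by gcongr; exact hf.lintegral_sq_le)
      _ ≤ κ⁻¹ * (C₁ * κ * volume F) := by
          gcongr
          exact le_mul_of_one_le_left' (by norm_num)
      _ = (κ⁻¹ * κ) * (C₁ * volume F) := by ring
      _ = _ := by rw [ENNReal.inv_mul_cancel hκ0 hκt, one_mul]
  -- The weak bound at height `t = 2^{-n-1}`; the 8 in `κ` matches the 8 of `exists_weak_bound`.
  have hweak : ∀ n : ℕ, volume {x | len (n + 1) ^ 2 ≤ κ⁻¹ * B x} ≤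
      len (-(n + 1)) * (C₂ * (m + 4) * volume F) := by
    intro n
    have h3 := (h₂ Φ hΦ m K W hW hK0 hK f hf.meas hf.integrable (len (n + 1)) (len_ne_zero _)
      (len_ne_top _)).trans (mul_le_mul' le_rfl hf.lintegral_le)
    have h4 : {x | len (n + 1) ^ 2 ≤ κ⁻¹ * B x} ⊆ {x | 8 * (len (n + 1) * K) ^ 2 ≤ B x} := by
      intro x hx
      calc 8 * (len (n + 1) * K) ^ 2 = κ * len (n + 1) ^ 2 := by ring
        _ ≤ κ * (κ⁻¹ * B x) := mul_le_mul' le_rfl hx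
        _ = B x := by rw [← mul_assoc, ENNReal.mul_inv_cancel hκ0 hκt, one_mul]
    calc _ ≤ volume {x | 8 * (len (n + 1) * K) ^ 2 ≤ B x} := measure_mono h4
      _ = len (-(n + 1)) * (len (n + 1) * volume {x | 8 * (len (n + 1) * K) ^ 2 ≤ B x}) := by
          rw [← mul_assoc, len_neg_mul, one_mul]
      _ ≤ _ := by gcongr
  have hmeas : ∀ n : ℕ, MeasurableSet {x | len (n + 1) ^ 2 ≤ κ⁻¹ * B x} := fun n =>
    measurableSet_le measurable_const (hBm.const_mul _)
  have hscaled : ∫⁻ x, (κ⁻¹ * B x) ^ r ≤ (C₁ + S₀ * C₂) * (m + 4) * volume F := by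
    calc _ ≤ ∫⁻ x, (κ⁻¹ * B x + ∑' n : ℕ, len n ^ (2 * r) *
          {x | len (n + 1) ^ 2 ≤ κ⁻¹ * B x}.indicator 1 x) :=
          lintegral_mono fun x => rpow_le_add_tsum hr0 hr1 _
      _ = (∫⁻ x, κ⁻¹ * B x) + ∑' n : ℕ, len n ^ (2 * r) *
            volume {x | len (n + 1) ^ 2 ≤ κ⁻¹ * B x} := by
          rw [lintegral_add_left (hBm.const_mul _), lintegral_tsum fun n =>
            ((measurable_one.indicator (hmeas n)).const_mul _).aemeasurable]
          congr 1
          refine tsum_congr fun n => ?_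
          rw [lintegral_const_mul _ (measurable_one.indicator (hmeas n)),
            lintegral_indicator_one_eq (hmeas n)]
      _ ≤ C₁ * volume F + ∑' n : ℕ, len n ^ (2 * r) *
            (len (-(n + 1)) * (C₂ * (m + 4) * volume F)) := by
          gcongr with n
          exact hweak n
      _ = C₁ * volume F + S₀ * (C₂ * (m + 4) * volume F) := by
          rw [hS₀, ← ENNReal.tsum_mul_right]
          simp_rw [mul_assoc]
      _ ≤ C₁ * ((m + 4) * volume F) + S₀ * (C₂ * (m + 4) * volume F) := by
          gcongr
          exact le_mul_of_one_le_left' hm4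
      _ = _ := by ring
  have hBκ : ∀ x, B x ^ r = κ ^ r * (κ⁻¹ * B x) ^ r := by
    intro x
    rw [← ENNReal.mul_rpow_of_nonneg _ _ hr0.le, ← mul_assoc,
      ENNReal.mul_inv_cancel hκ0 hκt, one_mul]
  calc _ = κ ^ r * ∫⁻ x, (κ⁻¹ * B x) ^ r := by
        simp_rw [hBκ]
        exact lintegral_const_mul _ ((hBm.const_mul _).pow_const r)
    _ ≤ κ ^ r * ((C₁ + S₀ * C₂) * (m + 4) ^ (2 * r) * volume F) := by
        -- The loss `m + 4` is at most `(m + 4)^{2r}` because `2r ≥ 1`.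
        gcongr
        refine hscaled.trans ?_
        gcongr
        conv_lhs => rw [← ENNReal.rpow_one (m + 4 : ℝ≥0∞)]
        exact ENNReal.rpow_le_rpow_of_exponent_le hm4 (by linarith)
    _ = _ := by
        have e : κ ^ r = 8 ^ r * K ^ (2 * r) := by
          rw [hκ, ENNReal.mul_rpow_of_nonneg _ _ hr0.le, ENNReal.rpow_mul, ENNReal.rpow_two]
        rw [e, ENNReal.mul_rpow_of_nonneg _ _ (by linarith)]
        ring

theorem exists_exponent_bound (A : ℝ) (D : ℕ → ℕ → ℝ) {r : ℝ} (hr : 1 / 2 < r) :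
    ∃ C : ℝ≥0∞, C ≠ ⊤ ∧ ∀ (Φ : ℕ → ℝ → ℝ → ℂ) (_ : ∀ j w, IsWavePacket A D j w (Φ j w)) (m : ℕ)
      (K : ℝ≥0∞) (W : ℕ → ℤ → ℕ → ℝ≥0∞) (_ : AdmissibleWeight m K W), K ≠ 0 → K ≠ ⊤ →
      ∀ (f : ℝ → ℂ) (F : Set ℝ), BoundedOn f F →
      ∫⁻ x, tailSum m 3 (scaleSq Φ m W f) 0 x ^ r ≤ C * ((m + 4) * K) ^ (2 * r) * volume F := by
  rcases le_total r 1 with h | h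
  · exact exists_small_exponent_bound A D hr h
  · exact exists_large_exponent_bound A D h

/-! ### Weights of large mass -/

section BadWeights

variable {m : ℕ} {F₁ F₂ F : Set ℝ} {K₀ : ℝ≥0∞} {A : ℝ} {D : ℕ → ℕ → ℝ} {Φ : ℕ → ℝ → ℝ → ℂ}
  {f : ℝ → ℂ}

open scoped Classical in
/-- The weights over the intervals where their total mass is under control. -/
noncomputable def goodWeight (m : ℕ) (F₁ F₂ : Set ℝ) (K : ℝ≥0∞) (k : ℕ) (u : ℤ) (p : ℕ) : ℝ≥0∞ :=
  if m ≤ k ∧ ∑ p ∈ shiftRange m, weight m F₁ F₂ k u p ≤ K then weight m F₁ F₂ k u p else 0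

open scoped Classical in
/-- The weights over the intervals where their total mass is large. -/
noncomputable def badWeight (m : ℕ) (F₁ F₂ : Set ℝ) (K : ℝ≥0∞) (k : ℕ) (u : ℤ) (p : ℕ) : ℝ≥0∞ :=
  if m ≤ k ∧ ¬ ∑ p ∈ shiftRange m, weight m F₁ F₂ k u p ≤ K then weight m F₁ F₂ k u p else 0

theorem goodWeight_add_badWeight {k : ℕ} (hk : m ≤ k) (K : ℝ≥0∞) (u : ℤ) (p : ℕ) :
    goodWeight m F₁ F₂ K k u p + badWeight m F₁ F₂ K k u p = weight m F₁ F₂ k u p := by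
  unfold goodWeight badWeight
  by_cases h : ∑ p ∈ shiftRange m, weight m F₁ F₂ k u p ≤ K <;> simp [h, hk]

theorem admissible_goodWeight (m : ℕ) (F₁ F₂ : Set ℝ) (K : ℝ≥0∞) :
    AdmissibleWeight m K (goodWeight m F₁ F₂ K) := by
  refine ⟨fun k u => ?_, fun k u p hk => ?_⟩
  · unfold goodWeight
    by_cases h : m ≤ k ∧ ∑ p ∈ shiftRange m, weight m F₁ F₂ k u p ≤ K
    · simp only [h, and_self, if_true]
    · simp [h]
  · unfold goodWeight
    rw [if_neg (fun h => absurd h.1 (by lia))]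

/-- Far from the parent interval, a bump of the fine scale is very small. -/
theorem ker_le_of_far {k : ℕ} (hmk : m ≤ k) {θ : ℝ} (hθ : |θ| ≤ 8 * 2 ^ m) {v : ℤ} {y : ℝ}
    (hd : 99 ≤ |((v / 2 ^ k : ℤ) : ℝ) - idx (lev m 2 k) y|) :
    ker 10 (lev m 3 k) ((v : ℝ) - θ) y ≤ 4 ^ 10 * (len k * (len (-lev m 2 k) *
      rho 10 (((v / 2 ^ k : ℤ) : ℝ) - idx (lev m 2 k) y))) := by
  set d : ℝ := ((v / 2 ^ k : ℤ) : ℝ) - idx (lev m 2 k) y with hd'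
  set z : ℝ := y * 2 ^ lev m 3 k - v + θ with hz
  have e3 : lev m 3 k = lev m 2 k + k := by unfold lev; push_cast; ring
  have hfar : 1 + |d| ≤ 4 * 2 ^ (-(k : ℤ)) * (1 + |z|) := by
    have h0 : (0 : ℝ) < 2 ^ (-(k : ℤ)) := by positivity
    have ha := abs_div_two_pow_sub_le v k
    have hb : |y * 2 ^ lev m 2 k - idx (lev m 2 k) y| ≤ 1 := by
      have h1 := Int.floor_le (y * (2 : ℝ) ^ lev m 2 k)
      have h2 := (Int.lt_floor_add_one (y * (2 : ℝ) ^ lev m 2 k)).le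
      unfold idx
      rw [abs_le]; constructor <;> linarith
    have hc : |θ * 2 ^ (-(k : ℤ))| ≤ 8 := by
      rw [abs_mul, abs_of_pos h0]
      have : (2 : ℝ) ^ (-(k : ℤ)) ≤ 2 ^ (-(m : ℤ)) :=
        zpow_le_zpow_right₀ (by norm_num) (by lia)
      calc _ ≤ 8 * 2 ^ m * (2 : ℝ) ^ (-(m : ℤ)) := by gcongr
        _ = 8 := by rw [zpow_neg, zpow_natCast]; field_simp
    have hk1 : (2 : ℝ) ^ (k : ℤ) * 2 ^ (-(k : ℤ)) = 1 := by
      rw [← zpow_add₀ (by norm_num)]; simp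
    have key : d = ((y * 2 ^ lev m 2 k - idx (lev m 2 k) y) + θ * 2 ^ (-(k : ℤ))
        - ((v : ℝ) * 2 ^ (-(k : ℤ)) - ((v / 2 ^ k : ℤ) : ℝ))) - z * 2 ^ (-(k : ℤ)) := by
      rw [hz, hd', e3, zpow_add₀ (by norm_num)]
      linear_combination (y * 2 ^ lev m 2 k) * hk1
    -- The errors are `10 = 1 + 8 + 1`: rounding of `y`, the shift, rounding of the parent. Since
    -- `|d| ≥ 99`, `1 + |d|` is at most `4 * (|d| - 10)`.
    have h1 : |d| ≤ 10 + |z| * 2 ^ (-(k : ℤ)) := by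
      rw [key]
      have s1 := abs_sub ((y * 2 ^ lev m 2 k - idx (lev m 2 k) y) + θ * 2 ^ (-(k : ℤ))
        - ((v : ℝ) * 2 ^ (-(k : ℤ)) - ((v / 2 ^ k : ℤ) : ℝ))) (z * 2 ^ (-(k : ℤ)))
      have s2 := abs_sub ((y * 2 ^ lev m 2 k - idx (lev m 2 k) y) + θ * 2 ^ (-(k : ℤ)))
        ((v : ℝ) * 2 ^ (-(k : ℤ)) - ((v / 2 ^ k : ℤ) : ℝ))
      have s3 := abs_add_le (y * 2 ^ lev m 2 k - idx (lev m 2 k) y) (θ * 2 ^ (-(k : ℤ)))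
      have s4 : |z * 2 ^ (-(k : ℤ))| = |z| * 2 ^ (-(k : ℤ)) := by rw [abs_mul, abs_of_pos h0]
      linarith
    nlinarith
  have h2 := rho_le_mul (N := 10) (by positivity) hfar
  have e4 : ENNReal.ofReal (4 * 2 ^ (-(k : ℤ))) = 4 * len k := by
    rw [ENNReal.ofReal_mul (by norm_num), len]; norm_num
  rw [e4] at h2
  have e5 : y * 2 ^ lev m 3 k - ((v : ℝ) - θ) = z := by rw [hz]; ring
  unfold ker
  rw [e5]
  have hlk : len (-lev m 3 k) * len k ^ 10 ≤ len k * len (-lev m 2 k) := by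
    have e6 : len (-lev m 3 k) * len k = len (-lev m 2 k) := by
      rw [← len_add, e3]; congr 1; ring
    have h7 : len k ≤ 1 := by rw [← len_zero]; exact len_anti (by lia)
    calc _ = len k ^ 8 * (len k * (len (-lev m 3 k) * len k)) := by ring
      _ ≤ _ := by
          rw [e6]
          exact mul_le_of_le_one_left' (pow_le_one' h7 8)
  calc _ ≤ len (-lev m 3 k) * ((4 * len k) ^ 10 * rho 10 d) := by gcongr
    _ = 4 ^ 10 * ((len (-lev m 3 k) * len k ^ 10) * rho 10 d) := by ring
    _ ≤ 4 ^ 10 * ((len k * len (-lev m 2 k)) * rho 10 d) := by gcongr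
    _ = _ := by ring

/-- If the mass over the parent of `v` exceeds `100^8 * K₀`, the bound `hF` places the parent far
from every point of `F`. There the decay of the fine bumps beats the growth of the mass and leaves a
factor `2^{-k}` and an integrable bump at the parent scale. -/
theorem scaleOp_badWeight_le (hΦ : ∀ j w, IsWavePacket A D j w (Φ j w)) (hf : BoundedOn f F)
    (hF : ∀ x ∈ F, ∀ k, m ≤ k → ∀ u : ℤ, ∑ p ∈ shiftRange m, weight m F₁ F₂ k u p ≤
      K₀ * jb ((u : ℝ) - idx (lev m 2 k) x) ^ 8) (k : ℕ) (v : ℤ) :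
    scaleOp Φ m (badWeight m F₁ F₂ (100 ^ 8 * K₀)) f k v ≤ packetConst D * 4 ^ 10 * K₀ * len k *
      ∫⁻ y in F, len (-lev m 2 k) * rho 2 (((v / 2 ^ k : ℤ) : ℝ) - idx (lev m 2 k) y) := by
  by_cases hbad : m ≤ k ∧
      ¬ ∑ p ∈ shiftRange m, weight m F₁ F₂ k (v / 2 ^ k) p ≤ 100 ^ 8 * K₀
  swap
  · have : scaleOp Φ m (badWeight m F₁ F₂ (100 ^ 8 * K₀)) f k v = 0 := by
      unfold scaleOp
      refine Finset.sum_eq_zero fun p _ => ?_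
      rw [badWeight, if_neg hbad, zero_mul]
    rw [this]; exact zero_le
  obtain ⟨hmk, hbig⟩ := hbad
  refine (scaleOp_le_lintegral hΦ hf.meas k v).trans ?_
  have hP := packetConst_ne_top D
  set c := packetConst D
  have hpt : ∀ y ∈ F, scaleKer m (badWeight m F₁ F₂ (100 ^ 8 * K₀)) k v y ≤
      4 ^ 10 * K₀ * len k * (len (-lev m 2 k) *
        rho 2 (((v / 2 ^ k : ℤ) : ℝ) - idx (lev m 2 k) y)) := by
    intro y hy
    set d : ℝ := ((v / 2 ^ k : ℤ) : ℝ) - idx (lev m 2 k) y with hd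
    have hS := hF y hy k hmk (v / 2 ^ k)
    -- At distance below 99 the bracket is at most 100, and `hF` would give a mass of at most `100^8
    -- * K₀`.
    have hdfar : 99 ≤ |d| := by
      by_contra! hlt
      refine hbig (hS.trans ?_)
      have hj : jb d ≤ 100 := by
        unfold jb
        rw [show (100 : ℝ≥0∞) = ENNReal.ofReal 100 by norm_num]
        exact ENNReal.ofReal_le_ofReal (by linarith)
      rw [mul_comm]
      gcongr
    unfold scaleKer avgKernel
    calc _ ≤ ∑ p ∈ shiftRange m, weight m F₁ F₂ k (v / 2 ^ k) p *
          (4 ^ 10 * (len k * (len (-lev m 2 k) * rho 10 d))) := by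
          refine Finset.sum_le_sum fun p hp => ?_
          gcongr
          · unfold badWeight
            split_ifs
            · exact le_rfl
            · exact zero_le
          · exact ker_le_of_far hmk (abs_cube_shift_le hp) hdfar
      _ ≤ (K₀ * jb d ^ 8) * (4 ^ 10 * (len k * (len (-lev m 2 k) * rho 10 d))) := by
          rw [← Finset.sum_mul]
          gcongr
      -- The decay order is `10 = 8 + 2`: order 8 cancels the growth of the mass, order 2 is kept
      -- for summation over cells.
      _ = 4 ^ 10 * K₀ * len k * (len (-lev m 2 k) * (jb d ^ 8 * rho 8 d * rho 2 d)) := by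
          rw [show (10 : ℕ) = 8 + 2 by norm_num, rho_add]; ring
      _ = _ := by rw [jb_pow_mul_rho, one_mul]
  calc _ ≤ c * ∫⁻ y in F, 4 ^ 10 * K₀ * len k * (len (-lev m 2 k) *
        rho 2 (((v / 2 ^ k : ℤ) : ℝ) - idx (lev m 2 k) y)) := by
        gcongr 1
        rw [← lintegral_indicator hf.measSet]
        refine lintegral_mono fun y => ?_
        by_cases hy : y ∈ F
        · rw [Set.indicator_of_mem hy]
          exact (mul_le_of_le_one_left' (hf.enorm_le_one y)).trans (hpt y hy)
        · have h0 : ‖f y‖ₑ = 0 := by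
            have := hf.enorm_le y
            simpa [hy] using this
          rw [h0, zero_mul]; exact zero_le
    _ = _ := by
        have hmeas : Measurable fun y => len (-lev m 2 k) *
            rho 2 (((v / 2 ^ k : ℤ) : ℝ) - idx (lev m 2 k) y) :=
          measurable_comp_idx (fun n : ℤ => len (-lev m 2 k) *
            rho 2 (((v / 2 ^ k : ℤ) : ℝ) - n)) _
        rw [lintegral_const_mul _ hmeas]
        ring

/-- The contribution of the bad weights to the square function, bounded by an `ℓ¹` sum. -/
noncomputable def badSum (Φ : ℕ → ℝ → ℝ → ℂ) (m : ℕ) (F₁ F₂ : Set ℝ) (K : ℝ≥0∞) (f : ℝ → ℂ)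
    (x : ℝ) : ℝ≥0∞ := ∑' k, scaleOp Φ m (badWeight m F₁ F₂ K) f k (idx (lev m 3 k) x)

theorem tsum_len_mul_le (c : ℝ≥0∞) : ∑' k : ℕ, c * len k = c * 2 := by
  rw [ENNReal.tsum_mul_left, tsum_len_natCast]

theorem badSum_le (hΦ : ∀ j w, IsWavePacket A D j w (Φ j w)) (hf : BoundedOn f F)
    (hF : ∀ x ∈ F, ∀ k, m ≤ k → ∀ u : ℤ, ∑ p ∈ shiftRange m, weight m F₁ F₂ k u p ≤
      K₀ * jb ((u : ℝ) - idx (lev m 2 k) x) ^ 8) (x : ℝ) :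
    badSum Φ m F₁ F₂ (100 ^ 8 * K₀) f x ≤ 2 * (packetConst D * 4 ^ 10 * bumpConst) * K₀ := by
  calc _ ≤ ∑' k : ℕ, packetConst D * 4 ^ 10 * bumpConst * K₀ * len k := by
        refine ENNReal.tsum_le_tsum fun k => (scaleOp_badWeight_le hΦ hf hF k _).trans ?_
        calc _ ≤ packetConst D * 4 ^ 10 * K₀ * len k * bumpConst := by
              gcongr
              refine (setLIntegral_le_lintegral _ _).trans ?_
              rw [lintegral_comp_idx (lev m 2 k) (fun n : ℤ => len (-lev m 2 k) *
                rho 2 (((idx (lev m 3 k) x / 2 ^ k : ℤ) : ℝ) - n)), ENNReal.tsum_mul_left,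
                ← mul_assoc, len_mul_neg, one_mul]
              exact tsum_rho_sub_le _
          _ = _ := by ring
    _ = _ := by rw [tsum_len_mul_le]; ring

theorem lintegral_setLIntegral_comp_idx (i : ℤ) (c : ℝ≥0∞) (g : ℤ × ℤ → ℝ≥0∞) (F : Set ℝ) :
    ∫⁻ x, c * ∫⁻ y in F, g (idx i x, idx i y) =
      c * ∫⁻ y in F, ∫⁻ x, g (idx i x, idx i y) := by
  have hidx : Measurable fun q : ℝ × ℝ => (idx i q.1, idx i q.2) :=
    ((measurable_idx i).comp measurable_fst).prodMk ((measurable_idx i).comp measurable_snd)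
  have hg : Measurable fun q : ℝ × ℝ => g (idx i q.1, idx i q.2) :=
    (measurable_of_countable g).comp hidx
  rw [lintegral_const_mul _ (Measurable.lintegral_prod_right' hg),
    lintegral_lintegral_swap hg.aemeasurable]

theorem lintegral_bump_idx_le (i : ℤ) (c : ℝ≥0∞) (F : Set ℝ) :
    ∫⁻ x, c * ∫⁻ y in F, len (-i) * rho 2 ((idx i x : ℝ) - idx i y) ≤
      c * (bumpConst * volume F) := by
  rw [lintegral_setLIntegral_comp_idx i c fun q : ℤ × ℤ => len (-i) * rho 2 ((q.1 : ℝ) - q.2),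
    ← setLIntegral_const]
  refine mul_le_mul' le_rfl (lintegral_mono fun y => ?_)
  have h := lintegral_comp_idx i (fun n : ℤ => len (-i) * rho 2 ((n : ℝ) - idx i y))
  rw [ENNReal.tsum_mul_left, ← mul_assoc, len_mul_neg, one_mul] at h
  refine h.le.trans (le_trans (le_of_eq (tsum_congr fun n => ?_)) (tsum_rho_sub_le (idx i y : ℝ)))
  rw [← rho_neg, neg_sub]

theorem idx_lev_two (m k : ℕ) (x : ℝ) : idx (lev m 3 k) x / 2 ^ k = idx (lev m 2 k) x := by
  rw [idx_eq_ediv (lev m 2 k) k]; congr 2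
  unfold lev; push_cast; ring

theorem lintegral_scaleOp_badWeight_le (hΦ : ∀ j w, IsWavePacket A D j w (Φ j w))
    (hf : BoundedOn f F)
    (hF : ∀ x ∈ F, ∀ k, m ≤ k → ∀ u : ℤ, ∑ p ∈ shiftRange m, weight m F₁ F₂ k u p ≤
      K₀ * jb ((u : ℝ) - idx (lev m 2 k) x) ^ 8) (k : ℕ) :
    ∫⁻ x, scaleOp Φ m (badWeight m F₁ F₂ (100 ^ 8 * K₀)) f k (idx (lev m 3 k) x) ≤
      packetConst D * 4 ^ 10 * bumpConst * K₀ * volume F * len k := by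
  have hpt : ∀ x, scaleOp Φ m (badWeight m F₁ F₂ (100 ^ 8 * K₀)) f k (idx (lev m 3 k) x) ≤
      packetConst D * 4 ^ 10 * K₀ * len k *
        ∫⁻ y in F, len (-lev m 2 k) * rho 2 ((idx (lev m 2 k) x : ℝ) - idx (lev m 2 k) y) := by
    intro x
    have h := scaleOp_badWeight_le hΦ hf hF k (idx (lev m 3 k) x)
    rwa [idx_lev_two] at h
  refine (lintegral_mono hpt).trans ((lintegral_bump_idx_le _ _ _).trans (le_of_eq ?_))
  ring

theorem lintegral_badSum_le (hΦ : ∀ j w, IsWavePacket A D j w (Φ j w)) (hf : BoundedOn f F)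
    (hF : ∀ x ∈ F, ∀ k, m ≤ k → ∀ u : ℤ, ∑ p ∈ shiftRange m, weight m F₁ F₂ k u p ≤
      K₀ * jb ((u : ℝ) - idx (lev m 2 k) x) ^ 8) :
    ∫⁻ x, badSum Φ m F₁ F₂ (100 ^ 8 * K₀) f x ≤
      2 * (packetConst D * 4 ^ 10 * bumpConst) * K₀ * volume F := by
  unfold badSum
  rw [lintegral_tsum fun k => (measurable_comp_idx
    (fun v => scaleOp Φ m (badWeight m F₁ F₂ (100 ^ 8 * K₀)) f k v) _).aemeasurable]
  refine (ENNReal.tsum_le_tsum (lintegral_scaleOp_badWeight_le hΦ hf hF)).trans ?_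
  rw [tsum_len_mul_le]
  exact le_of_eq (by ring)

theorem measurable_badSum (K : ℝ≥0∞) : Measurable (badSum Φ m F₁ F₂ K f) :=
  Measurable.tsum fun _ => measurable_comp_idx _ _

/-- The factors `2^{-k}` sum to 2 both in the supremum and in `L¹`, so one constant serves for both
and every exponent `p ≥ 1` follows. -/
theorem lintegral_badSum_rpow_le (hΦ : ∀ j w, IsWavePacket A D j w (Φ j w)) (hf : BoundedOn f F)
    (hF : ∀ x ∈ F, ∀ k, m ≤ k → ∀ u : ℤ, ∑ p ∈ shiftRange m, weight m F₁ F₂ k u p ≤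
      K₀ * jb ((u : ℝ) - idx (lev m 2 k) x) ^ 8) {p : ℝ} (hp : 1 ≤ p) :
    ∫⁻ x, badSum Φ m F₁ F₂ (100 ^ 8 * K₀) f x ^ p ≤
      (2 * (packetConst D * 4 ^ 10 * bumpConst) * K₀) ^ p * volume F := by
  set M := 2 * (packetConst D * 4 ^ 10 * bumpConst) * K₀ with hM
  have hsplit : ∀ a : ℝ≥0∞, a ^ p = a ^ (p - 1) * a := fun a => by
    conv_lhs => rw [show p = (p - 1) + 1 by ring]
    rw [ENNReal.rpow_add_of_nonneg _ _ (by linarith) (by norm_num), ENNReal.rpow_one]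
  calc _ ≤ ∫⁻ x, M ^ (p - 1) * badSum Φ m F₁ F₂ (100 ^ 8 * K₀) f x := by
        refine lintegral_mono fun x => ?_
        simp only
        rw [hsplit]
        gcongr
        exact badSum_le hΦ hf hF x
    _ ≤ M ^ (p - 1) * (M * volume F) := by
        rw [lintegral_const_mul _ (measurable_badSum _)]
        gcongr
        exact lintegral_badSum_le hΦ hf hF
    _ = _ := by rw [hsplit]; ring

end BadWeights

/-! ### Reduction to one triple of intervals per scale -/

theorem eq_ediv_of_dyadicInterval_subset {a k : ℕ} {r u : ℤ}
    (h : dyadicInterval (a + k) u ⊆ dyadicInterval a r) : r = u / 2 ^ k := by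
  have hpos : (0 : ℝ) < 2 ^ (a + k) := by positivity
  have hne : (u : ℝ) / 2 ^ (a + k) ≤ ((u : ℝ) + 1) / 2 ^ (a + k) := by gcongr; linarith
  have hl := (h (Set.left_mem_Icc.2 hne)).1
  have hr := (h (Set.right_mem_Icc.2 hne)).2
  have e : ∀ z : ℝ, z / 2 ^ a = z * 2 ^ k / 2 ^ (a + k) := fun z => by
    rw [pow_add]; field_simp
  rw [e, div_le_div_iff_of_pos_right hpos] at hl hr
  have hl' : r * 2 ^ k ≤ u := by exact_mod_cast hl
  have hr' : u + 1 ≤ (r + 1) * 2 ^ k := by exact_mod_cast hr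
  have h2 : (0 : ℤ) < 2 ^ k := by positivity
  apply le_antisymm
  · rwa [Int.le_ediv_iff_mul_le h2]
  · have := (Int.ediv_lt_iff_lt_mul h2 (a := u) (b := r + 1)).2 (by lia)
    lia

/-- Closed dyadic intervals overlap at endpoints. Off this countable set, membership in the closed
interval determines the index. -/
theorem ae_ne_dyadic : ∀ᵐ x : ℝ, ∀ (j : ℕ) (n : ℤ), x ≠ ((n : ℝ) + 1) / 2 ^ j := by
  simp_rw [ae_all_iff]
  exact fun j n => Measure.ae_ne volume _

theorem idx_eq_of_mem_dyadicInterval {j : ℕ} {v : ℤ} {x : ℝ} (hx : x ∈ dyadicInterval j v)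
    (hne : x ≠ ((v : ℝ) + 1) / 2 ^ j) : idx j x = v := by
  rw [idx_eq_iff, zpow_neg, zpow_natCast, ← div_eq_mul_inv, ← div_eq_mul_inv]
  exact ⟨hx.1, lt_of_le_of_ne hx.2 hne⟩

/-- A sum with at most one nonzero term, which also requires `Q`. -/
theorem tsum_le_of_eq_of_ne_zero {ι : Type*} {e : ι → ℤ} (he : Function.Injective e)
    {g : ι → ℝ≥0∞} {Q : Prop} {a : ℤ} {c : ℝ≥0∞} (h : ∀ z, g z ≠ 0 → (Q ∧ e z = a) ∧ g z ≤ c)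
    (h0 : ∑' z, g z ≠ 0) : Q ∧ ∑' z, g z ≤ c := by
  obtain ⟨z, hz⟩ : ∃ z, g z ≠ 0 := by
    by_contra! hall
    exact h0 (ENNReal.tsum_eq_zero.2 hall)
  obtain ⟨⟨hQ, hza⟩, hc⟩ := h z hz
  refine ⟨hQ, ?_⟩
  rw [tsum_eq_single z fun z' hz' => ?_]
  · exact hc
  · by_contra hne
    exact hz' (he ((h z' hne).1.2.trans hza.symm))

theorem curvedAverage_nonneg (Φ : ℕ → ℝ → ℝ → ℂ) (m k : ℕ) (r u v : ℤ) (f₁ f₂ f₄ : ℝ → ℂ) :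
    0 ≤ curvedAverage Φ m k r u v f₁ f₂ f₄ := by
  unfold curvedAverage coeff
  positivity

/-- Almost everywhere only one term of each scale contributes to the square function. -/
theorem curvedSquareSq_le_tsum (Φ : ℕ → ℝ → ℝ → ℂ) (m : ℕ) (f₁ f₂ f₄ : ℝ → ℂ) {x : ℝ}
    (hx : ∀ (j : ℕ) (n : ℤ), x ≠ ((n : ℝ) + 1) / 2 ^ j) :
    curvedSquareSq Φ m f₁ f₂ f₄ x ≤ ∑' k : {k : ℕ // m ≤ k},
      ENNReal.ofReal (curvedAverage Φ m k (idx (lev m 3 k) x / 2 ^ (k : ℕ) / 2 ^ (k : ℕ))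
        (idx (lev m 3 k) x / 2 ^ (k : ℕ)) (idx (lev m 3 k) x) f₁ f₂ f₄) ^ 2 := by
  refine ENNReal.tsum_le_tsum fun ⟨k, hk⟩ => ?_
  simp only
  set v₀ := idx (lev m 3 k) x with hv₀
  set c := ENNReal.ofReal (curvedAverage Φ m k (v₀ / 2 ^ k / 2 ^ k) (v₀ / 2 ^ k) v₀ f₁ f₂ f₄) ^ 2
    with hc
  refine le_of_not_gt fun hlt => ?_
  -- The lemma is applied to the sums over `r`, `u`, `v` in turn. The proposition `Q` carries
  -- outwards that a nonzero inner sum already forces the outer indices to be the ancestors of the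
  -- cell of `x`.
  refine absurd (tsum_le_of_eq_of_ne_zero (Q := True) (a := v₀ / 2 ^ k / 2 ^ k) (c := c)
    Function.injective_id (fun r => ?_) (ne_zero_of_lt hlt)).2 hlt.not_ge
  refine tsum_le_of_eq_of_ne_zero (a := v₀ / 2 ^ k) Subtype.val_injective fun u => ?_
  refine tsum_le_of_eq_of_ne_zero (a := v₀) Subtype.val_injective fun v hv => ?_
  have hmem : x ∈ dyadicInterval (m + 3 * k) v := by
    by_contra hnot
    exact hv (Set.indicator_of_notMem hnot _)
  have hv1 : (v : ℤ) = v₀ := by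
    have := idx_eq_of_mem_dyadicInterval hmem (hx _ _)
    rw [natCast_level] at this
    exact this.symm
  have hu1 : (u : ℤ) = v₀ / 2 ^ k := by
    rw [← hv1]
    refine eq_ediv_of_dyadicInterval_subset (a := m + 2 * k) ?_
    rw [show m + 2 * k + k = m + 3 * k by ring]
    exact v.2
  have hr1 : r = v₀ / 2 ^ k / 2 ^ k := by
    rw [← hu1]
    refine eq_ediv_of_dyadicInterval_subset (a := m + k) ?_
    rw [show m + k + k = m + 2 * k by ring]
    exact u.2
  refine ⟨⟨⟨⟨trivial, hr1⟩, hu1⟩, hv1⟩, ?_⟩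
  rw [Set.indicator_of_mem hmem, hv1, hu1, hr1, hc, ENNReal.ofReal_pow (curvedAverage_nonneg ..)]

/-! ### Assembly of the estimates -/

section

variable {A : ℝ} {D : ℕ → ℕ → ℝ} {Φ : ℕ → ℝ → ℝ → ℂ}

theorem ecoeff_le_amp (hΦ : ∀ j w, IsWavePacket A D j w (Φ j w)) {f : ℝ → ℂ} {F : Set ℝ}
    (hf : BoundedOn f F) (j : ℕ) (w : ℝ) : ecoeff Φ f j w ≤ packetConst D * amp F j w := by
  refine (ecoeff_le hΦ f j w).trans (mul_le_mul' le_rfl ?_)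
  unfold amp
  rw [← lintegral_indicator hf.measSet]
  refine lintegral_mono fun y => ?_
  have h := hf.enorm_le y
  by_cases hy : y ∈ F
  · rw [Set.indicator_of_mem hy]
    exact mul_le_of_le_one_left' (hf.enorm_le_one y)
  · have h0 : ‖f y‖ₑ = 0 := by simpa [hy] using h
    rw [h0, zero_mul]; exact zero_le

/-- The coefficients of `f₁` and `f₂` are replaced by their majorants, which with the factor
`2^{-m}` form `weight`. Splitting the weight at the mass `K` is exact since `m ≤ k`. -/
theorem ofReal_curvedAverage_le (hΦ : ∀ j w, IsWavePacket A D j w (Φ j w)) {f₁ f₂ : ℝ → ℂ}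
    {F₁ F₂ : Set ℝ} (hf₁ : BoundedOn f₁ F₁) (hf₂ : BoundedOn f₂ F₂) (f₄ : ℝ → ℂ) {m k : ℕ}
    (hk : m ≤ k) (K : ℝ≥0∞) (v : ℤ) :
    ENNReal.ofReal (curvedAverage Φ m k (v / 2 ^ k / 2 ^ k) (v / 2 ^ k) v f₁ f₂ f₄) ≤
      packetConst D ^ 2 * (scaleOp Φ m (goodWeight m F₁ F₂ K) f₄ k v
        + scaleOp Φ m (badWeight m F₁ F₂ K) f₄ k v) := by
  have e1 : ((m + k : ℕ) : ℤ) = lev m 1 k := by unfold lev; push_cast; ring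
  have e2 : ((m + 2 * k : ℕ) : ℤ) = lev m 2 k := by unfold lev; push_cast; ring
  have em : ENNReal.ofReal (1 / 2 ^ m) = len m := by
    rw [len, zpow_neg, zpow_natCast, one_div]
  have hc : ∀ f j w, 0 ≤ coeff Φ f j w := fun f j w => by unfold coeff; positivity
  unfold scaleOp curvedAverage
  rw [← Finset.sum_add_distrib, ENNReal.ofReal_mul (by positivity), em,
    ENNReal.ofReal_sum_of_nonneg fun p _ => mul_nonneg (mul_nonneg (hc ..) (hc ..)) (hc ..),
    Finset.mul_sum, Finset.mul_sum]
  refine Finset.sum_le_sum fun p _ => ?_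
  rw [← add_mul, goodWeight_add_badWeight hk, ENNReal.ofReal_mul (mul_nonneg (hc ..) (hc ..)),
    ENNReal.ofReal_mul (hc ..), ofReal_coeff, ofReal_coeff, ofReal_coeff]
  have h1 := ecoeff_le_amp hΦ hf₁ (m + k) (((v / 2 ^ k / 2 ^ k : ℤ) : ℝ) - p)
  have h2 := ecoeff_le_amp hΦ hf₂ (m + 2 * k) (((v / 2 ^ k : ℤ) : ℝ) + (p : ℝ) ^ 2 / 2 ^ m)
  rw [e1] at h1
  rw [e2] at h2
  refine (mul_le_mul' le_rfl (mul_le_mul' (mul_le_mul' h1 h2) le_rfl)).trans (le_of_eq ?_)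
  unfold weight
  ring

theorem curvedSquareSq_le (hΦ : ∀ j w, IsWavePacket A D j w (Φ j w)) {f₁ f₂ : ℝ → ℂ}
    {F₁ F₂ : Set ℝ} (hf₁ : BoundedOn f₁ F₁) (hf₂ : BoundedOn f₂ F₂) (f₄ : ℝ → ℂ) (m : ℕ)
    (K : ℝ≥0∞) {x : ℝ} (hx : ∀ (j : ℕ) (n : ℤ), x ≠ ((n : ℝ) + 1) / 2 ^ j) :
    curvedSquareSq Φ m f₁ f₂ f₄ x ≤ 4 * packetConst D ^ 4 *
      (tailSum m 3 (scaleSq Φ m (goodWeight m F₁ F₂ K) f₄) 0 x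
        + badSum Φ m F₁ F₂ K f₄ x ^ 2) := by
  set g : ℕ → ℝ≥0∞ := fun k => scaleOp Φ m (goodWeight m F₁ F₂ K) f₄ k (idx (lev m 3 k) x) with hg
  set b : ℕ → ℝ≥0∞ := fun k => scaleOp Φ m (badWeight m F₁ F₂ K) f₄ k (idx (lev m 3 k) x) with hb
  have hbad : ∑' k, b k ^ 2 ≤ badSum Φ m F₁ F₂ K f₄ x ^ 2 := by
    have e : badSum Φ m F₁ F₂ K f₄ x = ∑' k, b k := rfl
    rw [e, pow_two (∑' k, b k), ← ENNReal.tsum_mul_right]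
    refine ENNReal.tsum_le_tsum fun k => ?_
    rw [pow_two]
    exact mul_le_mul' le_rfl (ENNReal.le_tsum k)
  calc _ ≤ ∑' k : {k : ℕ // m ≤ k}, 4 * packetConst D ^ 4 * (g k ^ 2 + b k ^ 2) := by
        refine (curvedSquareSq_le_tsum Φ m f₁ f₂ f₄ hx).trans (ENNReal.tsum_le_tsum fun k => ?_)
        calc _ ≤ (packetConst D ^ 2 * (g k + b k)) ^ 2 :=
              pow_le_pow_left' (ofReal_curvedAverage_le hΦ hf₁ hf₂ f₄ k.2 K _) 2
          _ = packetConst D ^ 4 * (g k + b k) ^ 2 := by ring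
          _ ≤ packetConst D ^ 4 * (4 * g k ^ 2 + 4 * b k ^ 2) :=
              mul_le_mul' le_rfl (add_sq_le_four _ _)
          _ = _ := by ring
    _ ≤ ∑' k, 4 * packetConst D ^ 4 * (g k ^ 2 + b k ^ 2) :=
        ENNReal.tsum_comp_le_tsum_of_injective Subtype.val_injective _
    _ = 4 * packetConst D ^ 4 * (∑' k, g k ^ 2 + ∑' k, b k ^ 2) := by
        rw [ENNReal.tsum_mul_left, ENNReal.tsum_add]
    _ ≤ _ := mul_le_mul' le_rfl (add_le_add le_rfl hbad)

theorem add_rpow_le_two_rpow_mul {r : ℝ} (hr : 0 ≤ r) (a b : ℝ≥0∞) :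
    (a + b) ^ r ≤ 2 ^ r * (a ^ r + b ^ r) := by
  have hle : a + b ≤ 2 * max a b := by
    rw [two_mul]
    exact add_le_add (le_max_left _ _) (le_max_right _ _)
  calc _ ≤ (2 * max a b) ^ r := ENNReal.rpow_le_rpow hle hr
    _ = 2 ^ r * max a b ^ r := ENNReal.mul_rpow_of_nonneg _ _ hr
    _ ≤ _ := by
        gcongr
        rcases le_total a b with h | h
        · rw [max_eq_right h]; exact le_add_self
        · rw [max_eq_left h]; exact le_self_add

theorem weightConst_ne_zero : weightConst ≠ 0 := by
  have h1 : bumpConst ≠ 0 := (zero_lt_one.trans_le one_le_bumpConst).ne'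
  have h2 := schurConst_ne_zero
  unfold weightConst
  simp [h1, h2]

/-- The good weights have mass at most `100^8 * K₀`, so the square function bound applies with
exponent `r = p / 2`; the bad ones enter through `badSum`. -/
theorem lintegral_curvedSquare_rpow_le (A : ℝ) (D : ℕ → ℕ → ℝ) {p : ℝ} (hp : 1 < p) :
    ∃ C : ℝ≥0∞, C ≠ ⊤ ∧ ∀ (Φ : ℕ → ℝ → ℝ → ℂ) (_ : ∀ j w, IsWavePacket A D j w (Φ j w)) (m : ℕ)
      (K₀ : ℝ≥0∞) (F₁ F₂ F : Set ℝ), K₀ ≠ 0 → K₀ ≠ ⊤ →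
      (∀ x ∈ F, ∀ k, m ≤ k → ∀ u : ℤ, ∑ p ∈ shiftRange m, weight m F₁ F₂ k u p ≤
        K₀ * jb ((u : ℝ) - idx (lev m 2 k) x) ^ 8) →
      ∀ f₁ f₂ f : ℝ → ℂ, BoundedOn f₁ F₁ → BoundedOn f₂ F₂ → BoundedOn f F →
      ∫⁻ x, curvedSquare Φ m f₁ f₂ f x ^ p ≤ (C * ((m + 4) * K₀)) ^ p * volume F := by
  obtain ⟨C₁, hC₁, h₁⟩ := exists_exponent_bound A D (show 1 / 2 < p / 2 by linarith)
  have hp0 : 0 < p := by linarith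
  have hP := packetConst_ne_top D
  have hb := bumpConst_ne_top
  set M := 2 * (packetConst D * 4 ^ 10 * bumpConst) with hM
  have hMt : M ≠ ⊤ := by finiteness
  set Q : ℝ≥0∞ := (2 * (4 * packetConst D ^ 4)) ^ (p / 2) with hQ
  have hQt : Q ≠ ⊤ := ENNReal.rpow_ne_top_of_nonneg (by linarith) (by finiteness)
  set R : ℝ≥0∞ := Q * (C₁ * (100 ^ 8) ^ p + M ^ p) with hR
  have hRt : R ≠ ⊤ := by
    have h2 : ((100 : ℝ≥0∞) ^ 8) ^ p ≠ ⊤ := ENNReal.rpow_ne_top_of_nonneg hp0.le (by finiteness)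
    have h3 : M ^ p ≠ ⊤ := ENNReal.rpow_ne_top_of_nonneg hp0.le hMt
    finiteness
  refine ⟨R ^ (1 / p), ENNReal.rpow_ne_top_of_nonneg (by positivity) hRt, ?_⟩
  intro Φ hΦ m K₀ F₁ F₂ F hK0 hKt hF f₁ f₂ f hf₁ hf₂ hf
  set K : ℝ≥0∞ := 100 ^ 8 * K₀ with hK
  set B := tailSum m 3 (scaleSq Φ m (goodWeight m F₁ F₂ K) f) 0 with hB
  set G := badSum Φ m F₁ F₂ K f with hG
  have hpt : ∀ᵐ x, curvedSquare Φ m f₁ f₂ f x ^ p ≤ Q * (B x ^ (p / 2) + G x ^ p) := by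
    filter_upwards [ae_ne_dyadic] with x hx
    unfold curvedSquare
    rw [← ENNReal.rpow_mul, show 1 / 2 * p = p / 2 by ring]
    calc _ ≤ (4 * packetConst D ^ 4 * (B x + G x ^ 2)) ^ (p / 2) :=
          ENNReal.rpow_le_rpow (curvedSquareSq_le hΦ hf₁ hf₂ f m K hx) (by linarith)
      _ ≤ (4 * packetConst D ^ 4) ^ (p / 2) *
            (2 ^ (p / 2) * (B x ^ (p / 2) + (G x ^ 2) ^ (p / 2))) := by
          rw [ENNReal.mul_rpow_of_nonneg _ _ (by linarith)]
          exact mul_le_mul' le_rfl (add_rpow_le_two_rpow_mul (by linarith) _ _)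
      _ = _ := by
          rw [← ENNReal.rpow_two, ← ENNReal.rpow_mul, show 2 * (p / 2) = p by ring, hQ,
            ENNReal.mul_rpow_of_nonneg 2 _ (by linarith)]
          ring
  have hBint := h₁ Φ hΦ m K _ (admissible_goodWeight m F₁ F₂ K)
    (mul_ne_zero (by norm_num) hK0) (by finiteness) f F hf
  rw [show 2 * (p / 2) = p by ring] at hBint
  have hGint := lintegral_badSum_rpow_le hΦ hf hF hp.le
  have hm4 : (1 : ℝ≥0∞) ≤ m + 4 := le_trans (by norm_num) (le_add_self (a := (4 : ℝ≥0∞)))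
  calc _ ≤ ∫⁻ x, Q * (B x ^ (p / 2) + G x ^ p) := lintegral_mono_ae hpt
    _ = Q * ((∫⁻ x, B x ^ (p / 2)) + ∫⁻ x, G x ^ p) := by
        have hBm : Measurable fun x => B x ^ (p / 2) := (measurable_tailSum 0).pow_const _
        have hGm : Measurable fun x => G x ^ p := (measurable_badSum K).pow_const _
        have hsum : Measurable fun x => B x ^ (p / 2) + G x ^ p := hBm.add hGm
        rw [lintegral_const_mul _ hsum, lintegral_add_left hBm]
    _ ≤ Q * (C₁ * ((m + 4) * K) ^ p * volume F + (M * ((m + 4) * K₀)) ^ p * volume F) := by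
        refine mul_le_mul' le_rfl (add_le_add hBint (hGint.trans ?_))
        gcongr
        exact le_mul_of_one_le_left' hm4
    _ = R * ((m + 4) * K₀) ^ p * volume F := by
        rw [hK, mul_left_comm (m + 4 : ℝ≥0∞), ENNReal.mul_rpow_of_nonneg (100 ^ 8) _ hp0.le,
          ENNReal.mul_rpow_of_nonneg M _ hp0.le, hR]
        ring
    _ = _ := by
        rw [ENNReal.mul_rpow_of_nonneg (R ^ (1 / p)) _ hp0.le, ← ENNReal.rpow_mul, one_div,
          inv_mul_cancel₀ hp0.ne', ENNReal.rpow_one]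

theorem mul_succ_le_pow_ten {m : ℕ} (hm : 1 ≤ m) :
    ((m : ℝ≥0∞) + 4) * (m + 7) ≤ 40 * m ^ 10 := by
  have h : (m + 4) * (m + 7) ≤ 40 * m ^ 10 := by
    calc (m + 4) * (m + 7) ≤ (5 * m) * (8 * m) := Nat.mul_le_mul (by lia) (by lia)
      _ = 40 * m ^ 2 := by ring
      _ ≤ 40 * m ^ 10 := Nat.mul_le_mul le_rfl (Nat.pow_le_pow_right hm (by norm_num))
  exact_mod_cast h

/-- One factor of `m` is in the size of the weights on the major subset, the other in the square
function bound. -/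
theorem exists_eLpNorm_curvedSquare_le (A : ℝ) (D : ℕ → ℕ → ℝ) {p : ℝ} (hp : 1 < p) :
    ∃ C : ℝ≥0∞, C ≠ ⊤ ∧ ∀ (Φ : ℕ → ℝ → ℝ → ℂ) (_ : ∀ j w, IsWavePacket A D j w (Φ j w)) (m : ℕ)
      (_ : 1 ≤ m) (ρ₁ ρ₂ : ℝ≥0∞) (F₁ F₂ F : Set ℝ), ρ₁ ≠ 0 → ρ₁ ≠ ⊤ → ρ₂ ≠ 0 → ρ₂ ≠ ⊤ →
      (∀ x ∈ F, ∀ k, m ≤ k → ∀ u : ℤ, ∑ p ∈ shiftRange m, weight m F₁ F₂ k u p ≤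
        weightConst * (m + 7) * ρ₁ * ρ₂ * jb ((u : ℝ) - idx (lev m 2 k) x) ^ 8) →
      ∀ f₁ f₂ f : ℝ → ℂ, BoundedOn f₁ F₁ → BoundedOn f₂ F₂ → BoundedOn f F →
      eLpNorm (curvedSquare Φ m f₁ f₂ f) (ENNReal.ofReal p) volume ≤
        C * m ^ 10 * ρ₁ * ρ₂ * volume F ^ (1 / p) := by
  obtain ⟨C, hC, h⟩ := lintegral_curvedSquare_rpow_le A D hp
  have hw := weightConst_ne_top
  have hp0 : 0 < p := by linarith
  refine ⟨C * weightConst * 40, by finiteness, ?_⟩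
  intro Φ hΦ m hm ρ₁ ρ₂ F₁ F₂ F h1 h1' h2 h2' hF f₁ f₂ f hf₁ hf₂ hf
  have hm7 : (m : ℝ≥0∞) + 7 ≠ 0 := by simp
  have key := h Φ hΦ m _ F₁ F₂ F
    (mul_ne_zero (mul_ne_zero (mul_ne_zero weightConst_ne_zero hm7) h1) h2) (by finiteness)
    hF f₁ f₂ f hf₁ hf₂ hf
  rw [eLpNorm_eq_lintegral_rpow_enorm_toReal (by simpa using hp0) ENNReal.ofReal_ne_top,
    ENNReal.toReal_ofReal hp0.le]
  simp only [enorm_eq_self]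
  calc _ ≤ ((C * ((m + 4) * (weightConst * (m + 7) * ρ₁ * ρ₂))) ^ p * volume F) ^ (1 / p) :=
        ENNReal.rpow_le_rpow key (by positivity)
    _ = C * weightConst * ((m + 4) * (m + 7)) * ρ₁ * ρ₂ * volume F ^ (1 / p) := by
        rw [ENNReal.mul_rpow_of_nonneg _ _ (by positivity), ← ENNReal.rpow_mul, mul_one_div,
          div_self hp0.ne', ENNReal.rpow_one]
        ring
    _ ≤ C * weightConst * (40 * m ^ 10) * ρ₁ * ρ₂ * volume F ^ (1 / p) := by
        gcongr ?_ * ρ₁ * ρ₂ * _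
        exact mul_le_mul' le_rfl (mul_succ_le_pow_ten hm)
    _ = _ := by ring

end

end CurvedSquareFunction

theorem proposition2p3 (A : ℝ) (D : ℕ → ℕ → ℝ) :
    ∃ C : ℝ → ℝ, ∀ Φ : ℕ → ℝ → ℝ → ℂ,
      (∀ (j : ℕ) (w : ℝ), CurvedSquareFunction.IsWavePacket A D j w (Φ j w)) →
      ∀ m : ℕ, 1 ≤ m →
      ∀ F₁ F₂ F₄ : Set ℝ, MeasurableSet F₁ → MeasurableSet F₂ → MeasurableSet F₄ →
        0 < volume F₁ → volume F₁ < ⊤ →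
        0 < volume F₂ → volume F₂ < ⊤ →
        0 < volume F₄ → volume F₄ < ⊤ →
        ∃ F₄' : Set ℝ, F₄' ⊆ F₄ ∧ MeasurableSet F₄' ∧ volume F₄ / 2 ≤ volume F₄' ∧
          ∀ f₁ f₂ f₄ : ℝ → ℂ, Measurable f₁ → Measurable f₂ → Measurable f₄ →
            (∀ x, ‖f₁ x‖ ≤ F₁.indicator 1 x) →
            (∀ x, ‖f₂ x‖ ≤ F₂.indicator 1 x) →
            (∀ x, ‖f₄ x‖ ≤ F₄'.indicator 1 x) →
            ∀ p : ℝ, 1 < p →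
              eLpNorm (CurvedSquareFunction.curvedSquare Φ m f₁ f₂ f₄)
                  (ENNReal.ofReal p) volume
                ≤ ENNReal.ofReal
                    (C p * (m : ℝ) ^ 10
                      * (volume.real F₁ / volume.real F₄)
                      * (volume.real F₂ / volume.real F₄)
                      * volume.real F₄ ^ (1 / p)) := by
  -- The constant must be a function of every real `p`; outside `p > 1` it takes the irrelevant
  -- value 0.
  have hbound : ∀ p : ℝ, ∃ C : ℝ≥0∞, C ≠ ⊤ ∧ (1 < p →
      ∀ (Φ : ℕ → ℝ → ℝ → ℂ)
        (_ : ∀ j w, CurvedSquareFunction.IsWavePacket A D j w (Φ j w)) (m : ℕ)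
        (_ : 1 ≤ m) (ρ₁ ρ₂ : ℝ≥0∞) (F₁ F₂ F : Set ℝ), ρ₁ ≠ 0 → ρ₁ ≠ ⊤ → ρ₂ ≠ 0 → ρ₂ ≠ ⊤ →
        (∀ x ∈ F, ∀ k, m ≤ k → ∀ u : ℤ, ∑ p ∈ CurvedSquareFunction.shiftRange m,
          CurvedSquareFunction.weight m F₁ F₂ k u p ≤
            CurvedSquareFunction.weightConst * (m + 7) * ρ₁ * ρ₂ *
              CurvedSquareFunction.jb
                ((u : ℝ) - CurvedSquareFunction.idx (CurvedSquareFunction.lev m 2 k) x) ^ 8) →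
        ∀ f₁ f₂ f : ℝ → ℂ, CurvedSquareFunction.BoundedOn f₁ F₁ →
          CurvedSquareFunction.BoundedOn f₂ F₂ → CurvedSquareFunction.BoundedOn f F →
          eLpNorm (CurvedSquareFunction.curvedSquare Φ m f₁ f₂ f) (ENNReal.ofReal p) volume ≤
            C * m ^ 10 * ρ₁ * ρ₂ * volume F ^ (1 / p)) := by
    intro p
    by_cases hp : 1 < p
    · obtain ⟨C, hC, h⟩ := CurvedSquareFunction.exists_eLpNorm_curvedSquare_le A D hp
      exact ⟨C, hC, fun _ => h⟩
    · exact ⟨0, ENNReal.zero_ne_top, fun h => absurd h hp⟩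
  choose C hC hmain using hbound
  refine ⟨fun p => (C p).toReal, ?_⟩
  intro Φ hΦ m hm F₁ F₂ F₄ hF₁ hF₂ hF₄ h₁ h₁' h₂ h₂' h₄ h₄'
  obtain ⟨F, hFF, hFm, hFv, hF⟩ := CurvedSquareFunction.exists_major_subset m hF₁ hF₂ hF₄
    h₁.ne' h₁'.ne h₂.ne' h₂'.ne h₄.ne' h₄'.ne
  refine ⟨F, hFF, hFm, hFv, ?_⟩
  intro f₁ f₂ f₄ hf₁ hf₂ hf₄ hb₁ hb₂ hb₄ p hp
  refine (hmain p hp Φ hΦ m hm _ _ F₁ F₂ F (ENNReal.div_ne_zero.2 ⟨h₁.ne', h₄'.ne⟩)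
    (ENNReal.div_ne_top h₁'.ne h₄.ne') (ENNReal.div_ne_zero.2 ⟨h₂.ne', h₄'.ne⟩)
    (ENNReal.div_ne_top h₂'.ne h₄.ne') hF f₁ f₂ f₄ ⟨hf₁, hF₁, h₁'.ne, hb₁⟩
    ⟨hf₂, hF₂, h₂'.ne, hb₂⟩
    ⟨hf₄, hFm, ((measure_mono hFF).trans_lt h₄').ne, hb₄⟩).trans ?_
  have hr₄ : 0 < volume.real F₄ := ENNReal.toReal_pos h₄.ne' h₄'.ne
  have e₁ : ENNReal.ofReal (volume.real F₁) = volume F₁ := ENNReal.ofReal_toReal h₁'.ne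
  have e₂ : ENNReal.ofReal (volume.real F₂) = volume F₂ := ENNReal.ofReal_toReal h₂'.ne
  have e₄ : ENNReal.ofReal (volume.real F₄) = volume F₄ := ENNReal.ofReal_toReal h₄'.ne
  rw [ENNReal.ofReal_mul (by positivity), ENNReal.ofReal_mul (by positivity),
    ENNReal.ofReal_mul (by positivity), ENNReal.ofReal_mul (by positivity),
    ENNReal.ofReal_toReal (hC p), ENNReal.ofReal_pow (by positivity), ENNReal.ofReal_natCast,
    ENNReal.ofReal_div_of_pos hr₄, ENNReal.ofReal_div_of_pos hr₄,
    ← ENNReal.ofReal_rpow_of_pos hr₄, e₁, e₂, e₄]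
  -- Only `|F| ≤ |F₄|`, from `hFF`, is left.
  gcongr
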